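/- Let $(M,I,J,K)$ be a compact hypercomplex manifold of complex dimension $n$: a compact smooth manifold without boundary of real dimension $2n$ (Hausdorff, not necessarily connected), with three integrable almost complex structures $I,J,K$ satisfying $IJ=-JI=K$. Then $M$ admits a hyperhermitian metric, i.e. a Riemannian metric that is Hermitian with respect to $I$, $J$ and $K$; so the following applies to every compact hyperhermitian manifold $(M,I,J,K,g_M)$, and these include all compact hypercomplex manifolds. Let $Z=M\times S^2$ be the twistor space of $M$. Here $S^2=\{x\in\mathbb R^3: |x|=1\}$ is identified with $\mathbb{CP}^1$ by the stereographic projection $(x_1,x_2,x_3)\mapsto (x_1-\sqrt{-1}\,x_2)/(1-x_3)$; equivalently, its complex structure is $I_{\mathbb{CP}^1}V=A\times V$ for $V\in T_AS^2=A^\perp$. The endomorphism $\mathcal I$ of $TZ$ is given at $(m,A)$, $A=(x_1,x_2,x_3)$, by $$\mathcal I(X,V)=\big((x_1I+x_2J+x_3K)X,\; I_{\mathbb{CP}^1}V\big),\qquad X\in T_mM,\ V\in T_AS^2 .$$ Then $\mathcal I$ is an integrable almost complex structure, so that $Z$ is a complex manifold of complex dimension $n+1$, and $Z$ admits a balanced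 metric: there is a smooth Riemannian metric $g_Z$ on $Z$ with $g_Z(\mathcal I\,\cdot,\mathcal I\,\cdot)=g_Z$ whose Hermitian form $\omega(U,W)=g_Z(\mathcal IU,W)$ satisfies $d(\omega^{n})=0$. -/

import Mathlib

open Set Bundle Metric VectorField
open scoped Manifold ContDiff

noncomputable section

section LinearAlgebra

variable {V : Type*} [NormedAddCommGroup V] [NormedSpace ℝ V]

/-- The multilinear form `(v₀, …, v₂ₖ₋₁) ↦ B(v₀, v₁) B(v₂, v₃) ⋯ B(v₂ₖ₋₂, v₂ₖ₋₁)`. -/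
def pairingProduct (B : V →L[ℝ] V →L[ℝ] ℝ) (k : ℕ) :
    ContinuousMultilinearMap ℝ (fun _ : Fin (2 * k) => V) ℝ where
  toFun v := ∏ i : Fin k, B (v ⟨2 * i, by omega⟩) (v ⟨2 * i + 1, by omega⟩)
  map_update_add' := by
    intro _ v m x y
    obtain rfl := Subsingleton.elim ‹DecidableEq (Fin (2 * k))› (instDecidableEqFin (2 * k))
    have hi : (m : ℕ) / 2 < k := by omega
    rw [← Finset.mul_prod_erase _ _ (Finset.mem_univ (⟨(m : ℕ) / 2, hi⟩ : Fin k)),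
      ← Finset.mul_prod_erase _ _ (Finset.mem_univ (⟨(m : ℕ) / 2, hi⟩ : Fin k)),
      ← Finset.mul_prod_erase _ _ (Finset.mem_univ (⟨(m : ℕ) / 2, hi⟩ : Fin k))]
    have key : ∀ z : V, ∏ i ∈ Finset.univ.erase (⟨(m : ℕ) / 2, hi⟩ : Fin k),
        B (Function.update v m z ⟨2 * i, by omega⟩) (Function.update v m z ⟨2 * i + 1, by omega⟩)
        = ∏ i ∈ Finset.univ.erase (⟨(m : ℕ) / 2, hi⟩ : Fin k),
        B (v ⟨2 * i, by omega⟩) (v ⟨2 * i + 1, by omega⟩) := by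
      intro z
      refine Finset.prod_congr rfl fun i hmem => ?_
      have hne : (i : ℕ) ≠ (m : ℕ) / 2 := fun h => (Finset.ne_of_mem_erase hmem) (Fin.ext h)
      rw [Function.update_of_ne (fun h => hne (by have := congrArg Fin.val h; simp at this; omega)),
        Function.update_of_ne (fun h => hne (by have := congrArg Fin.val h; simp at this; omega))]
    rw [key, key, key, ← add_mul]
    congr 1
    rcases Nat.mod_two_eq_zero_or_one (m : ℕ) with h | h
    · have h0 : (⟨2 * ((m : ℕ) / 2), by omega⟩ : Fin (2 * k)) = m := Fin.ext (by simp; omega)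
      have h1 : (⟨2 * ((m : ℕ) / 2) + 1, by omega⟩ : Fin (2 * k)) ≠ m := fun h' => by
        have := congrArg Fin.val h'; simp at this; omega
      simp [h0, Function.update_of_ne h1]
    · have h0 : (⟨2 * ((m : ℕ) / 2) + 1, by omega⟩ : Fin (2 * k)) = m := Fin.ext (by simp; omega)
      have h1 : (⟨2 * ((m : ℕ) / 2), by omega⟩ : Fin (2 * k)) ≠ m := fun h' => by
        have := congrArg Fin.val h'; simp at this; omega
      simp [h0, Function.update_of_ne h1]
  map_update_smul' := by
    intro _ v m c x
    obtain rfl := Subsingleton.elim ‹DecidableEq (Fin (2 * k))› (instDecidableEqFin (2 * k))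
    have hi : (m : ℕ) / 2 < k := by omega
    rw [← Finset.mul_prod_erase _ _ (Finset.mem_univ (⟨(m : ℕ) / 2, hi⟩ : Fin k)),
      ← Finset.mul_prod_erase _ _ (Finset.mem_univ (⟨(m : ℕ) / 2, hi⟩ : Fin k))]
    have key : ∀ z : V, ∏ i ∈ Finset.univ.erase (⟨(m : ℕ) / 2, hi⟩ : Fin k),
        B (Function.update v m z ⟨2 * i, by omega⟩) (Function.update v m z ⟨2 * i + 1, by omega⟩)
        = ∏ i ∈ Finset.univ.erase (⟨(m : ℕ) / 2, hi⟩ : Fin k),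
        B (v ⟨2 * i, by omega⟩) (v ⟨2 * i + 1, by omega⟩) := by
      intro z
      refine Finset.prod_congr rfl fun i hmem => ?_
      have hne : (i : ℕ) ≠ (m : ℕ) / 2 := fun h => (Finset.ne_of_mem_erase hmem) (Fin.ext h)
      rw [Function.update_of_ne (fun h => hne (by have := congrArg Fin.val h; simp at this; omega)),
        Function.update_of_ne (fun h => hne (by have := congrArg Fin.val h; simp at this; omega))]
    rw [key, key, smul_eq_mul, ← mul_assoc]
    congr 1
    rcases Nat.mod_two_eq_zero_or_one (m : ℕ) with h | h
    · have h0 : (⟨2 * ((m : ℕ) / 2), by omega⟩ : Fin (2 * k)) = m := Fin.ext (by simp; omega)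
      have h1 : (⟨2 * ((m : ℕ) / 2) + 1, by omega⟩ : Fin (2 * k)) ≠ m := fun h' => by
        have := congrArg Fin.val h'; simp at this; omega
      simp [h0, Function.update_of_ne h1]
    · have h0 : (⟨2 * ((m : ℕ) / 2) + 1, by omega⟩ : Fin (2 * k)) = m := Fin.ext (by simp; omega)
      have h1 : (⟨2 * ((m : ℕ) / 2), by omega⟩ : Fin (2 * k)) ≠ m := fun h' => by
        have := congrArg Fin.val h'; simp at this; omega
      simp [h0, Function.update_of_ne h1]
  cont := by fun_prop

/-- The exterior power `ω ∧ ⋯ ∧ ω` (`k` factors) of a 2-form `ω`, given as the (skew) bilinear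
map `B`: `ωᵏ(v₀, …, v₂ₖ₋₁) = 2⁻ᵏ ∑_σ sgn(σ) ∏ᵢ B(v_σ(2i), v_σ(2i+1))`. -/
def wedgePow (B : V →L[ℝ] V →L[ℝ] ℝ) (k : ℕ) : V [⋀^Fin (2 * k)]→L[ℝ] ℝ :=
  ((2 : ℝ) ^ k)⁻¹ • (pairingProduct B k).alternatization

theorem wedgePow_apply (B : V →L[ℝ] V →L[ℝ] ℝ) (k : ℕ) (v : Fin (2 * k) → V) :
    wedgePow B k v = ((2 : ℝ) ^ k)⁻¹ * ∑ σ : Equiv.Perm (Fin (2 * k)), Equiv.Perm.sign σ •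
      ∏ i : Fin k, B (v (σ ⟨2 * i, by omega⟩)) (v (σ ⟨2 * i + 1, by omega⟩)) := by
  simp only [wedgePow, ContinuousAlternatingMap.smul_apply, smul_eq_mul,
    ContinuousMultilinearMap.alternatization_apply_apply]
  rfl

end LinearAlgebra

section Manifolds

variable {F : Type*} [NormedAddCommGroup F] [NormedSpace ℝ F]
  {H : Type*} [TopologicalSpace H] (I : ModelWithCorners ℝ F H)
  {X : Type*} [TopologicalSpace X] [ChartedSpace H X]

/-- A differential `k`-form `α` is closed: in each of the charts, the exterior derivative of the
coordinate expression of `α` vanishes. -/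
def IsClosedForm {k : ℕ} (α : Π x : X, TangentSpace I x [⋀^Fin k]→L[ℝ] ℝ) : Prop :=
  ∀ x₀ : X, ∀ y ∈ (extChartAt I x₀).target,
    extDerivWithin (fun y : F =>
      ((α ((extChartAt I x₀).symm y)).compContinuousLinearMap
        (mfderivWithin 𝓘(ℝ, F) I (extChartAt I x₀).symm (range I) y) :
          F [⋀^Fin k]→L[ℝ] ℝ)) (range I) y = 0

/-- The value at `x` of the Nijenhuis tensor of the field of endomorphisms `J`, applied to the
vector fields `U` and `W`: `[JU, JW] - J[JU, W] - J[U, JW] - [U, W]`. -/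
def nijenhuis (J : Π x : X, TangentSpace I x →L[ℝ] TangentSpace I x)
    (U W : Π x : X, TangentSpace I x) (x : X) : TangentSpace I x :=
  mlieBracket I (fun y => J y (U y)) (fun y => J y (W y)) x
    - J x (mlieBracket I (fun y => J y (U y)) W x)
    - J x (mlieBracket I U (fun y => J y (W y)) x)
    - mlieBracket I U W x

variable [IsManifold I ∞ X]

/-- `J` is a complex structure: a smooth field of endomorphisms of the tangent bundle with
`J² = -1` that is integrable, i.e. whose Nijenhuis tensor vanishes (on all local vector fields). -/
structure IsComplexStructure (J : Π x : X, TangentSpace I x →L[ℝ] TangentSpace I x) : Prop where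
  smooth : ContMDiff I (I.prod 𝓘(ℝ, F →L[ℝ] F)) ∞
    (fun x => TotalSpace.mk' (F →L[ℝ] F)
      (E := fun x : X => TangentSpace I x →L[ℝ] TangentSpace I x) x (J x))
  sq : ∀ (x : X) (v : TangentSpace I x), J x (J x v) = -v
  integrable : ∀ (x : X) (U W : Π x : X, TangentSpace I x),
    ContMDiffAt I I.tangent ∞ (fun y => (⟨y, U y⟩ : TangentBundle I X)) x →
    ContMDiffAt I I.tangent ∞ (fun y => (⟨y, W y⟩ : TangentBundle I X)) x →
    nijenhuis I J U W x = 0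

/-- Smooth Riemannian metrics on the manifold `X`. -/
abbrev SmoothMetric (X : Type*) [TopologicalSpace X] [ChartedSpace H X] [IsManifold I ∞ X] :
    Type _ :=
  ContMDiffRiemannianMetric I ∞ F (fun x : X => TangentSpace I x)

variable {I}

/-- The Riemannian metric `g` is Hermitian with respect to `J`. -/
def IsHermitian (J : Π x : X, TangentSpace I x →L[ℝ] TangentSpace I x)
    (g : SmoothMetric I X) : Prop :=
  ∀ (x : X) (u v : TangentSpace I x), g.inner x (J x u) (J x v) = g.inner x u v

/-- The Hermitian form `ω(u, v) = g(Ju, v)`. -/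
def hermitianForm (J : Π x : X, TangentSpace I x →L[ℝ] TangentSpace I x)
    (g : SmoothMetric I X) (x : X) : TangentSpace I x →L[ℝ] TangentSpace I x →L[ℝ] ℝ :=
  (g.inner x).comp (J x)

/-- The power `ωᵏ` of the Hermitian form, a differential form of degree `2k`. -/
def hermitianFormPow (J : Π x : X, TangentSpace I x →L[ℝ] TangentSpace I x)
    (g : SmoothMetric I X) (k : ℕ) (x : X) : TangentSpace I x [⋀^Fin (2 * k)]→L[ℝ] ℝ :=
  wedgePow (V := F) (hermitianForm J g x) k

/-- `g` is a balanced metric on the manifold `(X, J)` of complex dimension `n`: it is Hermitian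
and `d(ωⁿ⁻¹) = 0`. -/
structure IsBalancedMetric (n : ℕ) (J : Π x : X, TangentSpace I x →L[ℝ] TangentSpace I x)
    (g : SmoothMetric I X) : Prop where
  dim : Module.finrank ℝ F = 2 * n
  hermitian : IsHermitian J g
  closed : IsClosedForm I (hermitianFormPow J g (n - 1))

/-- `(I₁, I₂, I₃)` is a hypercomplex structure: three complex structures satisfying the
quaternionic relations. -/
structure IsHypercomplex (I₁ I₂ I₃ : Π x : X, TangentSpace I x →L[ℝ] TangentSpace I x) :
    Prop where
  fst : IsComplexStructure I I₁
  snd : IsComplexStructure I I₂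
  trd : IsComplexStructure I I₃
  mul : ∀ (x : X) (v : TangentSpace I x), I₁ x (I₂ x v) = I₃ x v
  anti : ∀ (x : X) (v : TangentSpace I x), I₂ x (I₁ x v) = -I₃ x v

/-- `g` is a hyperhermitian metric for `(I₁, I₂, I₃)`. -/
structure IsHyperhermitian (I₁ I₂ I₃ : Π x : X, TangentSpace I x →L[ℝ] TangentSpace I x)
    (g : SmoothMetric I X) : Prop where
  fst : IsHermitian I₁ g
  snd : IsHermitian I₂ g
  trd : IsHermitian I₃ g

end Manifolds

section Twistor

/-- The unit sphere `S² ⊂ ℝ³ = Im ℍ`. -/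
abbrev Sph : Type := sphere (0 : EuclideanSpace ℝ (Fin 3)) 1

/-- The map `v ↦ A × v` on `ℝ³`. -/
def crossLeft (A : EuclideanSpace ℝ (Fin 3)) :
    EuclideanSpace ℝ (Fin 3) →ₗ[ℝ] EuclideanSpace ℝ (Fin 3) :=
  (WithLp.linearEquiv 2 ℝ (Fin 3 → ℝ)).symm.toLinearMap ∘ₗ
    crossProduct (WithLp.ofLp A) ∘ₗ (WithLp.linearEquiv 2 ℝ (Fin 3 → ℝ)).toLinearMap

/-- The inclusion `T_A S² → ℝ³`, i.e. the differential at `A` of the inclusion `S² → ℝ³`. -/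
def sphIncl (A : Sph) : TangentSpace (𝓡 2) A →L[ℝ] EuclideanSpace ℝ (Fin 3) :=
  mvfderiv (𝓡 2) (Subtype.val : Sph → EuclideanSpace ℝ (Fin 3)) A

theorem sphIncl_injective (A : Sph) : Function.Injective (sphIncl A).toLinearMap :=
  haveI : Fact (Module.finrank ℝ (EuclideanSpace ℝ (Fin 3)) = 2 + 1) := ⟨by simp⟩
  injective_mvfderiv_subtypeVal_sphere (n := 2) A

theorem crossLeft_mem_range (A : Sph) (v : EuclideanSpace ℝ (Fin 3)) :
    crossLeft A v ∈ LinearMap.range (sphIncl A).toLinearMap := by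
  have : Fact (Module.finrank ℝ (EuclideanSpace ℝ (Fin 3)) = 2 + 1) := ⟨by simp⟩
  have h : LinearMap.range (sphIncl A).toLinearMap
      = (Submodule.span ℝ {(A : EuclideanSpace ℝ (Fin 3))})ᗮ := range_mvfderiv_subtypeVal A
  rw [h, Submodule.mem_orthogonal_singleton_iff_inner_right]
  simp [crossLeft, PiLp.inner_apply, Fin.sum_univ_three, cross_apply]
  ring

/-- The complex structure of `S² = ℂP¹`: at `A ∈ S²` it is the rotation `V ↦ A × V = A V`
(quaternionic product) of `T_A S² = A^⊥`. This is the complex structure for which the stereographic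
projection `(x₁, x₂, x₃) ↦ (x₁ - i x₂) / (1 - x₃)` is holomorphic. -/
def sphJ (A : Sph) : TangentSpace (𝓡 2) A →L[ℝ] TangentSpace (𝓡 2) A :=
  LinearMap.toContinuousLinearMap (𝕜 := ℝ) (E := EuclideanSpace ℝ (Fin 2))
    (F' := EuclideanSpace ℝ (Fin 2))
    ((LinearEquiv.ofInjective (sphIncl A).toLinearMap (sphIncl_injective A)).symm.toLinearMap ∘ₗ
      LinearMap.codRestrict _ (crossLeft A) (crossLeft_mem_range A) ∘ₗ (sphIncl A).toLinearMap)

variable {F : Type*} [NormedAddCommGroup F] [NormedSpace ℝ F]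
  {H : Type*} [TopologicalSpace H] {I : ModelWithCorners ℝ F H}
  {M : Type*} [TopologicalSpace M] [ChartedSpace H M]

/-- The almost complex structure of the twistor space `Z = M × S²` of `(M, I₁, I₂, I₃)`: at
`(m, A)` it maps `(X, V) ∈ T_m M ⊕ T_A S²` to `(A X, I_{ℂP¹} V)`, where
`A = (x₁, x₂, x₃) ∈ S²` acts on `T_m M` as `x₁ I₁ + x₂ I₂ + x₃ I₃`. -/
def twistorJ (I₁ I₂ I₃ : Π x : M, TangentSpace I x →L[ℝ] TangentSpace I x) (z : M × Sph) :
    TangentSpace (I.prod (𝓡 2)) z →L[ℝ] TangentSpace (I.prod (𝓡 2)) z :=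
  ContinuousLinearMap.prodMap
    (M₁ := TangentSpace I z.1) (M₂ := TangentSpace I z.1)
    (M₃ := TangentSpace (𝓡 2) z.2) (M₄ := TangentSpace (𝓡 2) z.2)
    ((z.2 : EuclideanSpace ℝ (Fin 3)) 0 • I₁ z.1 + (z.2 : EuclideanSpace ℝ (Fin 3)) 1 • I₂ z.1
      + (z.2 : EuclideanSpace ℝ (Fin 3)) 2 • I₃ z.1)
    (sphJ z.2)

end Twistor

end

/-! Write n = k + 1 for the complex dimension of M when it is positive, and `ω_A = g(A·,·)` for A in
the 2-sphere and a hyperhermitian metric g. Two algebraic facts drive the construction: `ω_Aⁿ = n!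
ν` does not depend on A (`wedgePow_eq`), and `ω_Aⁿ⁻¹ = (n-1)! (A₀θ₀ + A₁θ₁ + A₂θ₂)` is linear in A
(`wedgePow_eq_sum`). For a product metric the obstruction to balancedness is therefore `dθⱼ = ι_{Tⱼ}
ν`.

The remedy is to realise ωⁿ as `Cν + dβ`. Start from the cyclic sum of `(Aᵢ dAⱼ - Aⱼ dAᵢ) ∧ θₘ`. The
part of its differential of degree two along the sphere is twice the area form wedged with `A₀θ₀ +
A₁θ₁ + A₂θ₂`, as for a product metric `a g + b g_{S²}` with `n! aⁿ⁻¹ b = 2`. The part of degree one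
along the sphere is in general not of type (n,n); subtracting `∑ AᵢAⱼ ι_{IᵢTⱼ} ν` repairs this. It
becomes `ε₁ ∧ ι_{Φ(e)} ν + ε₂ ∧ ι_{Φ(f)} ν` for an oriented orthonormal frame e, f of A^⊥, where Φ
is `twistVector` and satisfies `Φ(A × v) = A Φ(v)`. Such mixed terms are produced by shearing the
metric: `|V|²` is replaced by `|V + rX|²` with `r = ½ g(Φ,·)`
(`IsQuaternionicHermitian.wedgePow_twistorForm`).

What remains is the coefficient of ν. It is matched by solving `n! aⁿ = C - S` for the function a,
where S is smooth on M × S²; compactness makes the right side positive for large C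
(`exists_positive_root`). Then `ωⁿ = Cν + dβ` is closed, since ν has top degree on M
(`extDeriv_wedgePow_twistorForm`).

The hyperhermitian metric comes from averaging over the quaternion units in charts and gluing by
convexity (`IsHypercomplex.exists_contMDiff_mem_invariantInners`). Integrability is checked in
product charts: the Nijenhuis tensor of `x₁I + x₂J + x₃K` is quadratic in x, its mixed coefficients
vanish by pure algebra (`nijenhuisAlg_mixed_eq_zero`), and the derivatives of x cancel because x is
holomorphic in the sense `dx(jσ) = x × dx(σ)` (`localNijenhuis_twistorField`). -/

noncomputable section

/-! ### Wedge products with covectors and with 2-forms, and contractions. -/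

section ExteriorAlgebra

variable {V : Type*} [NormedAddCommGroup V] [NormedSpace ℝ V]

/-- The exterior product `ξ ∧ α` of a covector with an alternating form, as a continuous bilinear
map. -/
def wedgeOneL (V : Type*) [NormedAddCommGroup V] [NormedSpace ℝ V] (k : ℕ) :
    (V →L[ℝ] ℝ) →L[ℝ] (V [⋀^Fin k]→L[ℝ] ℝ) →L[ℝ] (V [⋀^Fin (k + 1)]→L[ℝ] ℝ) :=
  (ContinuousAlternatingMap.alternatizeUncurryFinCLM ℝ V ℝ).postcomp _ ∘L
    ContinuousLinearMap.smulRightL ℝ V (V [⋀^Fin k]→L[ℝ] ℝ)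

/-- The exterior product `ξ ∧ α` of a covector with an alternating form. -/
def wedgeOne {k : ℕ} (ξ : V →L[ℝ] ℝ) (α : V [⋀^Fin k]→L[ℝ] ℝ) : V [⋀^Fin (k + 1)]→L[ℝ] ℝ :=
  wedgeOneL V k ξ α

/-- The exterior product of a covector with an alternating form. -/
infixr:70 " ⋏ " => wedgeOne

open ContinuousAlternatingMap (alternatizeUncurryFin alternatizeUncurryFin_apply
  alternatizeUncurryFinCLM_apply alternatizeUncurryFin_curryLeft curryLeft_apply_apply
  alternatizeUncurryFin_alternatizeUncurryFinCLM_comp_of_symmetric compContinuousLinearMap_apply)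

variable {k : ℕ}

theorem wedgeOne_eq (ξ : V →L[ℝ] ℝ) (α : V [⋀^Fin k]→L[ℝ] ℝ) :
    ξ ⋏ α = alternatizeUncurryFin (ξ.smulRight α) := rfl

theorem wedgeOne_apply (ξ : V →L[ℝ] ℝ) (α : V [⋀^Fin k]→L[ℝ] ℝ) (v : Fin (k + 1) → V) :
    (ξ ⋏ α) v = ∑ i : Fin (k + 1), (-1) ^ (i : ℕ) * (ξ (v i) * α (i.removeNth v)) := by
  rw [wedgeOne_eq, alternatizeUncurryFin_apply]
  simp

theorem add_wedgeOne (ξ η : V →L[ℝ] ℝ) (α : V [⋀^Fin k]→L[ℝ] ℝ) :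
    (ξ + η) ⋏ α = ξ ⋏ α + η ⋏ α := by simp [wedgeOne]

theorem sub_wedgeOne (ξ η : V →L[ℝ] ℝ) (α : V [⋀^Fin k]→L[ℝ] ℝ) :
    (ξ - η) ⋏ α = ξ ⋏ α - η ⋏ α := by simp [wedgeOne]

theorem neg_wedgeOne (ξ : V →L[ℝ] ℝ) (α : V [⋀^Fin k]→L[ℝ] ℝ) : (-ξ) ⋏ α = -(ξ ⋏ α) := by
  simp [wedgeOne]

theorem smul_wedgeOne (c : ℝ) (ξ : V →L[ℝ] ℝ) (α : V [⋀^Fin k]→L[ℝ] ℝ) :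
    (c • ξ) ⋏ α = c • (ξ ⋏ α) := by simp [wedgeOne]

theorem sum_wedgeOne {ι : Type*} (s : Finset ι) (ξ : ι → V →L[ℝ] ℝ) (α : V [⋀^Fin k]→L[ℝ] ℝ) :
    (∑ i ∈ s, ξ i) ⋏ α = ∑ i ∈ s, ξ i ⋏ α := by
  simp [wedgeOne]

theorem wedgeOne_add (ξ : V →L[ℝ] ℝ) (α β : V [⋀^Fin k]→L[ℝ] ℝ) :
    ξ ⋏ (α + β) = ξ ⋏ α + ξ ⋏ β := by simp [wedgeOne]

theorem wedgeOne_sub (ξ : V →L[ℝ] ℝ) (α β : V [⋀^Fin k]→L[ℝ] ℝ) :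
    ξ ⋏ (α - β) = ξ ⋏ α - ξ ⋏ β := by simp [wedgeOne]

theorem wedgeOne_neg (ξ : V →L[ℝ] ℝ) (α : V [⋀^Fin k]→L[ℝ] ℝ) : ξ ⋏ (-α) = -(ξ ⋏ α) := by
  simp [wedgeOne]

theorem wedgeOne_smul (c : ℝ) (ξ : V →L[ℝ] ℝ) (α : V [⋀^Fin k]→L[ℝ] ℝ) :
    ξ ⋏ (c • α) = c • (ξ ⋏ α) := by simp [wedgeOne]

theorem wedgeOne_sum {ι : Type*} (s : Finset ι) (ξ : V →L[ℝ] ℝ) (α : ι → V [⋀^Fin k]→L[ℝ] ℝ) :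
    ξ ⋏ (∑ i ∈ s, α i) = ∑ i ∈ s, ξ ⋏ α i := by
  simp [wedgeOne]

theorem wedgeOne_comp {W : Type*} [NormedAddCommGroup W] [NormedSpace ℝ W] (L : W →L[ℝ] V)
    (ξ : V →L[ℝ] ℝ) (α : V [⋀^Fin k]→L[ℝ] ℝ) :
    (ξ ⋏ α).compContinuousLinearMap L = (ξ.comp L) ⋏ (α.compContinuousLinearMap L) := by
  ext v
  simp only [compContinuousLinearMap_apply, wedgeOne_apply]
  rfl

/-- Alternating the symmetric bilinear map `(x, y) ↦ ξ(x) ξ(y) α` twice gives zero. -/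
theorem wedgeOne_wedgeOne_self (ξ : V →L[ℝ] ℝ) (α : V [⋀^Fin k]→L[ℝ] ℝ) : ξ ⋏ ξ ⋏ α = 0 := by
  have := alternatizeUncurryFin_alternatizeUncurryFinCLM_comp_of_symmetric
    (f := ξ.smulRight (ξ.smulRight α)) (fun x y => by simp [smul_smul, mul_comm])
  rw [← this, wedgeOne_eq]
  congr 1
  ext x : 1
  simp [wedgeOne_eq]

theorem wedgeOne_anticomm (ξ η : V →L[ℝ] ℝ) (α : V [⋀^Fin k]→L[ℝ] ℝ) :
    ξ ⋏ η ⋏ α = -(η ⋏ ξ ⋏ α) := by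
  have h := wedgeOne_wedgeOne_self (ξ + η) α
  simp only [add_wedgeOne, wedgeOne_add, wedgeOne_wedgeOne_self, zero_add, add_zero] at h
  exact eq_neg_of_add_eq_zero_right h

/-- Contraction with a vector is an antiderivation. Degree zero is stated separately because
`curryLeft` needs a positive degree. -/
theorem curryLeft_wedgeOne (X : V) (ξ : V →L[ℝ] ℝ) (α : V [⋀^Fin (k + 1)]→L[ℝ] ℝ) :
    (ξ ⋏ α).curryLeft X = ξ X • α - ξ ⋏ (α.curryLeft X) := by
  ext v
  simp only [curryLeft_apply_apply, wedgeOne_apply, ContinuousAlternatingMap.sub_apply, ContinuousAlternatingMap.smul_apply, smul_eq_mul]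
  rw [Fin.sum_univ_succ]
  simp only [Fin.val_zero, pow_zero, one_mul, Matrix.cons_val_zero, Fin.val_succ, pow_succ]
  rw [sub_eq_add_neg, ← Finset.sum_neg_distrib]
  congr 1
  refine Finset.sum_congr rfl fun i _ => ?_
  have : i.succ.removeNth (Matrix.vecCons X v) = Matrix.vecCons X (i.removeNth v) := by
    ext j
    refine Fin.cases ?_ (fun j => ?_) j <;> simp [Fin.removeNth]
  rw [this]
  simp

theorem curryLeft_wedgeOne_zero (X : V) (ξ : V →L[ℝ] ℝ) (α : V [⋀^Fin 0]→L[ℝ] ℝ) :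
    (ξ ⋏ α).curryLeft X = ξ X • α := by
  ext v
  simp [curryLeft_apply_apply, wedgeOne_apply]

theorem curryLeft_smul' (c : ℝ) (α : V [⋀^Fin (k + 1)]→L[ℝ] ℝ) (X : V) :
    (c • α).curryLeft X = c • α.curryLeft X := by
  ext; simp

section FiniteDimensional

variable {ι : Type*} (b : Module.Basis ι ℝ V) [FiniteDimensional ℝ V]

/-- The coordinate covectors of a basis of a finite dimensional space. -/
def coordL (i : ι) : V →L[ℝ] ℝ := LinearMap.toContinuousLinearMap (b.coord i)

@[simp] theorem coordL_apply (i : ι) (v : V) : coordL b i v = b.repr v i := rfl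

variable [Fintype ι]

theorem sum_coordL_smul (v : V) : ∑ i, coordL b i v • b i = v := b.sum_repr v

theorem sum_apply_smul_coordL (ξ : V →L[ℝ] ℝ) : ∑ i, ξ (b i) • coordL b i = ξ := by
  ext v
  conv_rhs => rw [← sum_coordL_smul b v, map_sum]
  simp [mul_comm]

theorem alternatizeUncurryFin_eq_sum (f : V →L[ℝ] V [⋀^Fin k]→L[ℝ] ℝ) :
    alternatizeUncurryFin f = ∑ i, coordL b i ⋏ f (b i) := by
  have : f = ∑ i, (coordL b i).smulRight (f (b i)) := by
    ext v : 1
    conv_lhs => rw [← sum_coordL_smul b v, map_sum]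
    simp
  conv_lhs => rw [this, ← alternatizeUncurryFinCLM_apply, map_sum]
  rfl

theorem sum_coordL_wedgeOne_curryLeft (α : V [⋀^Fin (k + 1)]→L[ℝ] ℝ) :
    ∑ i, coordL b i ⋏ (α.curryLeft (b i)) = ((k : ℝ) + 1) • α := by
  rw [← alternatizeUncurryFin_eq_sum b, alternatizeUncurryFin_curryLeft]
  ext v
  simp

/-- A form of degree less than the dimension is determined by its products with covectors. -/
theorem eq_zero_of_wedgeOne_eq_zero {m : ℕ} (hm : m < Module.finrank ℝ V)
    (α : V [⋀^Fin m]→L[ℝ] ℝ) (h : ∀ ξ : V →L[ℝ] ℝ, ξ ⋏ α = 0) : α = 0 := by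
  set b := Module.finBasis ℝ V
  rcases m with _ | k
  · have i : Fin (Module.finrank ℝ V) := ⟨0, hm⟩
    have h1 := curryLeft_wedgeOne_zero (b i) (coordL b i) α
    rw [h] at h1
    simpa using h1.symm
  -- These are the contractions of `eⁱ ∧ α = 0` with `eᵢ`. Summed over i they give `(dim V - deg α)
  -- α = 0`, with a nonzero factor.
  · have h1 : ∀ i, coordL b i (b i) • α - coordL b i ⋏ (α.curryLeft (b i)) = 0 := fun i => by
      rw [← curryLeft_wedgeOne, h]; simp
    have h2 := Finset.sum_congr (rfl : Finset.univ = Finset.univ) (fun i _ => h1 i)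
    rw [Finset.sum_sub_distrib, sum_coordL_wedgeOne_curryLeft, ← Finset.sum_smul, ← sub_smul] at h2
    simp only [coordL_apply, Module.Basis.repr_self, Finsupp.single_eq_same, Finset.sum_const,
      Finset.card_univ, Fintype.card_fin, nsmul_eq_mul, mul_one, smul_zero,
      smul_eq_zero] at h2
    refine h2.resolve_left (sub_ne_zero.2 ?_)
    exact_mod_cast hm.ne'

theorem eq_zero_of_finrank_lt {m : ℕ} (hm : Module.finrank ℝ V < m) (α : V [⋀^Fin m]→L[ℝ] ℝ) :
    α = 0 := by
  ext v
  refine α.toAlternatingMap.map_linearDependent v fun h => ?_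
  have := h.fintype_card_le_finrank
  simp at this
  omega

theorem exists_eq_smul_of_ne_zero {m : ℕ} (hm : Module.finrank ℝ V = m)
    (α ν : V [⋀^Fin m]→L[ℝ] ℝ) (hν : ν ≠ 0) : ∃ c : ℝ, α = c • ν := by
  subst hm
  set b := Module.finBasis ℝ V
  have h : ∀ γ : V [⋀^Fin (Module.finrank ℝ V)]→L[ℝ] ℝ, ∀ v, γ v = γ b * b.det v := fun γ v => by
    have := congrArg (fun δ => δ v) (γ.toAlternatingMap.eq_smul_basis_det b)
    simpa using this
  have h0 : ν b ≠ 0 := fun h0 => hν (by ext v; rw [h, h0]; simp)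
  refine ⟨α b / ν b, ?_⟩
  ext v
  rw [ContinuousAlternatingMap.smul_apply, h α v, smul_eq_mul, div_mul_eq_mul_div, h ν v]
  field_simp

end FiniteDimensional

section WedgeTwo

/-- The exterior product `B ∧ α` of a 2-form, given as a skew bilinear map, with a form. -/
def wedgeTwo (B : V →L[ℝ] V →L[ℝ] ℝ) (α : V [⋀^Fin k]→L[ℝ] ℝ) : V [⋀^Fin (k + 2)]→L[ℝ] ℝ :=
  (2⁻¹ : ℝ) • alternatizeUncurryFin (((wedgeOneL V k).flip α).comp B)

theorem wedgeTwo_apply (B : V →L[ℝ] V →L[ℝ] ℝ) (α : V [⋀^Fin k]→L[ℝ] ℝ) (v : Fin (k + 2) → V) :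
    wedgeTwo B α v = 2⁻¹ * ∑ i : Fin (k + 2), (-1) ^ (i : ℕ) * (B (v i) ⋏ α) (i.removeNth v) := by
  rw [wedgeTwo, ContinuousAlternatingMap.smul_apply, alternatizeUncurryFin_apply]
  simp [wedgeOne]

/-- Laplace expansion of an antisymmetrised sum along the first slot: permutations are grouped by
the index p sent to position 0, and `m' p` is the antisymmetrisation over the remaining slots. -/
theorem sum_alternating_perm {n : ℕ} (m : (Fin (n + 1) → V) → ℝ)
    (m' : Fin (n + 1) → V [⋀^Fin n]→L[ℝ] ℝ) (v : Fin (n + 1) → V)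
    (h : ∀ p, ∀ w : Fin n → V,
      m' p w = ∑ σ : Equiv.Perm (Fin n), Equiv.Perm.sign σ • m (Fin.cons (v p) (w ∘ σ))) :
    ∑ σ : Equiv.Perm (Fin (n + 1)), Equiv.Perm.sign σ • m (v ∘ σ)
      = ∑ p : Fin (n + 1), (-1) ^ (p : ℕ) * m' p (p.removeNth v) := by
  rw [← Equiv.Perm.decomposeFin.symm.sum_comp, Fintype.sum_prod_type]
  refine Finset.sum_congr rfl fun p _ => ?_
  have h1 : ∀ e : Equiv.Perm (Fin n), v ∘ (Equiv.Perm.decomposeFin.symm (p, e))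
      = Fin.cons (v p) ((fun i : Fin n => v (Equiv.swap 0 p i.succ)) ∘ e) := fun e => by
    ext i
    refine Fin.cases ?_ (fun j => ?_) i
    · simp
    · simp [Equiv.Perm.decomposeFin_symm_apply_succ]
  simp only [h1, Equiv.Perm.decomposeFin.symm_sign]
  -- The transposition (0 p) leaves `v 0` in the place of `v p`, whereas `removeNth` keeps it in
  -- front; the two orders differ by a cycle of p entries. The sign is read off from the tuple with
  -- `v p` replaced by `v 0`, which has a repeated entry.
  have h2 : (-1) ^ (p : ℕ) * m' p (p.removeNth v)
      = (if p = 0 then 1 else -1 : ℤˣ) • m' p (fun i : Fin n => v (Equiv.swap 0 p i.succ)) := by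
    by_cases hp : p = 0
    · subst hp
      simp [Fin.removeNth_zero, Fin.tail_def]
    · have := (m' p).neg_one_pow_smul_map_removeNth_add_eq_zero_of_eq
        (v := Function.update v p (v 0)) (i := 0) (j := p)
        (by simp [Function.update_of_ne (Ne.symm hp)]) (Ne.symm hp)
      have e1 : p.removeNth (Function.update v p (v 0)) = p.removeNth v := by
        ext j; simp [Fin.removeNth]
      have e2 : (0 : Fin (n + 1)).removeNth (Function.update v p (v 0))
          = fun i : Fin n => v (Equiv.swap 0 p i.succ) := by
        ext j
        simp only [Fin.removeNth, Fin.zero_succAbove, Function.update_apply, Equiv.swap_apply_def,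
          Fin.succ_ne_zero, if_false]
        split_ifs <;> rfl
      rw [e1, e2] at this
      simp only [Fin.val_zero, pow_zero, one_smul, if_neg hp, Units.neg_smul] at this ⊢
      rw [eq_neg_of_add_eq_zero_left this]
      simp
  rw [h2, h, Finset.smul_sum]
  refine Finset.sum_congr rfl fun e _ => ?_
  rw [mul_smul]

theorem wedgePow_zero (B : V →L[ℝ] V →L[ℝ] ℝ) (v : Fin (2 * 0) → V) : wedgePow B 0 v = 1 := by
  rw [wedgePow_apply]
  have : Subsingleton (Equiv.Perm (Fin (2 * 0))) := by rw [mul_zero]; infer_instance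
  rw [Fintype.sum_subsingleton _ 1]
  simp

/-- The permutation sum is expanded twice, once for each argument of the first factor of `B`. This
turns the explicit formula for the power into a recursion, on which all later identities rest. -/
theorem wedgePow_succ (B : V →L[ℝ] V →L[ℝ] ℝ) (k : ℕ) :
    wedgePow B (k + 1) = wedgeTwo B (wedgePow B k) := by
  ext v
  rw [wedgePow_apply, wedgeTwo_apply]
  have h1 := sum_alternating_perm (n := 2 * k + 1)
    (fun w => ∏ i : Fin (k + 1), B (w ⟨2 * i, by omega⟩) (w ⟨2 * i + 1, by omega⟩))
    (fun p => (2 : ℝ) ^ k • (B (v p) ⋏ wedgePow B k)) v ?_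
  · refine Eq.trans (congrArg (fun t : ℝ => ((2 : ℝ) ^ (k + 1))⁻¹ * t) h1) ?_
    rw [Finset.mul_sum, Finset.mul_sum]
    refine Finset.sum_congr rfl fun p _ => ?_
    simp only [ContinuousAlternatingMap.smul_apply, smul_eq_mul]
    field_simp
    ring
  · intro p w
    have h2 := sum_alternating_perm (n := 2 * k)
      (fun u => ∏ i : Fin (k + 1), B ((Fin.cons (v p) u : Fin (2 * k + 2) → V) ⟨2 * i, by omega⟩)
        ((Fin.cons (v p) u : Fin (2 * k + 2) → V) ⟨2 * i + 1, by omega⟩))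
      (fun q => ((2 : ℝ) ^ k * B (v p) (w q)) • wedgePow B k) w ?_
    · refine Eq.trans ?_ h2.symm
      simp only [ContinuousAlternatingMap.smul_apply, wedgeOne_apply, smul_eq_mul, Finset.mul_sum]
      refine Finset.sum_congr rfl fun p _ => ?_
      ring
    · intro q u
      rw [ContinuousAlternatingMap.smul_apply, wedgePow_apply, smul_eq_mul, Finset.mul_sum, Finset.mul_sum]
      refine Finset.sum_congr rfl fun σ _ => ?_
      rw [Fin.prod_univ_succ]
      simp only [Units.smul_def, zsmul_eq_mul]
      have e0 : ∀ x : V, ∀ y : Fin (2 * k + 1) → V,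
        (Fin.cons x y : Fin (2 * k + 2) → V) ⟨2 * ((0 : Fin (k + 1)) : ℕ), by simp⟩ = x :=
        fun x y => rfl
      have e1 : ∀ x y : V, ∀ z : Fin (2 * k) → V,
        (Fin.cons x (Fin.cons y z : Fin (2 * k + 1) → V) : Fin (2 * k + 2) → V)
          ⟨2 * ((0 : Fin (k + 1)) : ℕ) + 1, by simp⟩ = y :=
        fun x y z => rfl
      rw [e0, e1]
      have e2 : ∀ i : Fin k, ∀ x y : V, ∀ z : Fin (2 * k) → V,
        (Fin.cons x (Fin.cons y z : Fin (2 * k + 1) → V) : Fin (2 * k + 2) → V)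
          ⟨2 * (i.succ : ℕ), by simp; omega⟩ = z ⟨2 * i, by omega⟩ := fun i x y z => by
        have : (⟨2 * (i.succ : ℕ), by simp; omega⟩ : Fin (2 * k + 2))
          = (⟨2 * i, by omega⟩ : Fin (2 * k)).succ.succ := Fin.ext (by simp [mul_add])
        rw [this, Fin.cons_succ, Fin.cons_succ]
      have e3 : ∀ i : Fin k, ∀ x y : V, ∀ z : Fin (2 * k) → V,
        (Fin.cons x (Fin.cons y z : Fin (2 * k + 1) → V) : Fin (2 * k + 2) → V)
          ⟨2 * (i.succ : ℕ) + 1, by simp⟩ = z ⟨2 * i + 1, by omega⟩ := fun i x y z => by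
        have : (⟨2 * (i.succ : ℕ) + 1, by simp⟩ : Fin (2 * k + 2))
          = (⟨2 * i + 1, by omega⟩ : Fin (2 * k)).succ.succ := Fin.ext (by simp [mul_add])
        rw [this, Fin.cons_succ, Fin.cons_succ]
      simp only [e2, e3, Function.comp_apply]
      field_simp

theorem wedgePow_comp {W : Type*} [NormedAddCommGroup W] [NormedSpace ℝ W] (L : W →L[ℝ] V)
    (B : V →L[ℝ] V →L[ℝ] ℝ) (k : ℕ) :
    (wedgePow B k).compContinuousLinearMap L = wedgePow (B.bilinearComp L L) k := by
  ext v
  rw [compContinuousLinearMap_apply, wedgePow_apply, wedgePow_apply]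
  rfl

theorem wedgeTwo_add (B : V →L[ℝ] V →L[ℝ] ℝ) (α β : V [⋀^Fin k]→L[ℝ] ℝ) :
    wedgeTwo B (α + β) = wedgeTwo B α + wedgeTwo B β := by
  ext v
  simp only [wedgeTwo_apply, wedgeOne_add, ContinuousAlternatingMap.add_apply, mul_add, Finset.sum_add_distrib]

theorem wedgeTwo_smul (B : V →L[ℝ] V →L[ℝ] ℝ) (c : ℝ) (α : V [⋀^Fin k]→L[ℝ] ℝ) :
    wedgeTwo B (c • α) = c • wedgeTwo B α := by
  ext v
  simp only [wedgeTwo_apply, wedgeOne_smul, ContinuousAlternatingMap.smul_apply, smul_eq_mul, Finset.mul_sum]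
  exact Finset.sum_congr rfl fun i _ => by ring

theorem add_wedgeTwo (B C : V →L[ℝ] V →L[ℝ] ℝ) (α : V [⋀^Fin k]→L[ℝ] ℝ) :
    wedgeTwo (B + C) α = wedgeTwo B α + wedgeTwo C α := by
  ext v
  have : ∀ u, (B + C) u = B u + C u := fun _ => rfl
  simp only [wedgeTwo_apply, this, add_wedgeOne, ContinuousAlternatingMap.add_apply, mul_add,
    Finset.sum_add_distrib]

theorem smul_wedgeTwo (B : V →L[ℝ] V →L[ℝ] ℝ) (c : ℝ) (α : V [⋀^Fin k]→L[ℝ] ℝ) :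
    wedgeTwo (c • B) α = c • wedgeTwo B α := by
  ext v
  have : ∀ u, (c • B) u = c • B u := fun _ => rfl
  simp only [wedgeTwo_apply, this, smul_wedgeOne, ContinuousAlternatingMap.smul_apply,
    smul_eq_mul, Finset.mul_sum]
  exact Finset.sum_congr rfl fun i _ => by ring

/-- The 2-form `ξ ∧ η` as a bilinear map. -/
def wedgeBilin (ξ η : V →L[ℝ] ℝ) : V →L[ℝ] V →L[ℝ] ℝ := ξ.smulRight η - η.smulRight ξ

theorem wedgeBilin_apply (ξ η : V →L[ℝ] ℝ) (u v : V) :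
    wedgeBilin ξ η u v = ξ u * η v - η u * ξ v := by
  simp [wedgeBilin]

theorem curryLeft_wedgeTwo_zero (B : V →L[ℝ] V →L[ℝ] ℝ) (hB : ∀ u v, B u v = -B v u) (X : V)
    (α : V [⋀^Fin 0]→L[ℝ] ℝ) :
    (wedgeTwo B α).curryLeft X = B X ⋏ α := by
  ext v
  rw [curryLeft_apply_apply, wedgeTwo_apply, Fin.sum_univ_two]
  simp only [wedgeOne_apply]
  have : ∀ w : Fin 0 → V, α w = α 0 := fun w => congrArg α (Subsingleton.elim _ _)
  simp [this, Fin.removeNth]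
  rw [hB (v 0) X]
  ring

variable [FiniteDimensional ℝ V]

theorem wedgeTwo_eq_sum {ι : Type*} [Fintype ι] (b : Module.Basis ι ℝ V)
    (B : V →L[ℝ] V →L[ℝ] ℝ) (α : V [⋀^Fin k]→L[ℝ] ℝ) :
    wedgeTwo B α = (2⁻¹ : ℝ) • ∑ i, coordL b i ⋏ B (b i) ⋏ α := by
  rw [wedgeTwo, alternatizeUncurryFin_eq_sum b]
  rfl

/-- A 2-form commutes past a covector because two sign changes cancel. -/
theorem wedgeTwo_wedgeOne (B : V →L[ℝ] V →L[ℝ] ℝ) (ξ : V →L[ℝ] ℝ) (α : V [⋀^Fin k]→L[ℝ] ℝ) :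
    wedgeTwo B (ξ ⋏ α) = ξ ⋏ wedgeTwo B α := by
  rw [wedgeTwo_eq_sum (Module.finBasis ℝ V), wedgeTwo_eq_sum (Module.finBasis ℝ V), wedgeOne_smul,
    wedgeOne_sum]
  congr 1
  refine Finset.sum_congr rfl fun i _ => ?_
  rw [wedgeOne_anticomm _ ξ, wedgeOne_neg, wedgeOne_anticomm _ ξ, neg_neg]

theorem wedgeBilin_wedgeTwo (ξ η : V →L[ℝ] ℝ) (α : V [⋀^Fin k]→L[ℝ] ℝ) :
    wedgeTwo (wedgeBilin ξ η) α = ξ ⋏ η ⋏ α := by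
  set b := Module.finBasis ℝ V
  rw [wedgeTwo_eq_sum b]
  have : ∀ i, coordL b i ⋏ (wedgeBilin ξ η) (b i) ⋏ α
      = (ξ (b i) • coordL b i) ⋏ η ⋏ α - (η (b i) • coordL b i) ⋏ ξ ⋏ α := fun i => by
    simp [wedgeBilin, sub_wedgeOne, wedgeOne_sub, smul_wedgeOne, wedgeOne_smul]
  simp only [this, Finset.sum_sub_distrib, ← sum_wedgeOne, sum_apply_smul_coordL]
  rw [wedgeOne_anticomm η ξ, sub_neg_eq_add, ← two_smul ℝ, smul_smul]
  norm_num

/-- In a basis `B = ½ ∑ eⁱ ∧ B(eᵢ,·)`; skewness of `B` makes the contractions of its two factors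
equal, which removes the factor ½. -/
theorem curryLeft_wedgeTwo (B : V →L[ℝ] V →L[ℝ] ℝ) (hB : ∀ u v, B u v = -B v u) (X : V)
    (α : V [⋀^Fin (k + 1)]→L[ℝ] ℝ) :
    (wedgeTwo B α).curryLeft X = B X ⋏ α + wedgeTwo B (α.curryLeft X) := by
  set b := Module.finBasis ℝ V
  rw [wedgeTwo_eq_sum b, wedgeTwo_eq_sum b, curryLeft_smul']
  have hs : (∑ i, coordL b i ⋏ B (b i) ⋏ α).curryLeft X
      = ∑ i, (coordL b i ⋏ B (b i) ⋏ α).curryLeft X := by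
    ext v; simp [curryLeft_apply_apply]
  rw [hs]
  simp only [curryLeft_wedgeOne, wedgeOne_sub, wedgeOne_smul, Finset.sum_sub_distrib,
    ← smul_wedgeOne, ← sum_wedgeOne]
  have e1 : ∑ i, coordL b i X • B (b i) = B X := by
    conv_rhs => rw [← sum_coordL_smul b X, map_sum]
    simp
  have e2 : ∑ i, B (b i) X • coordL b i = -B X := by
    conv_rhs => rw [← sum_apply_smul_coordL b (B X), ← Finset.sum_neg_distrib]
    refine Finset.sum_congr rfl fun i _ => ?_
    rw [hB]
    exact neg_smul (B X (b i)) (coordL b i)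
  rw [e1, e2, neg_wedgeOne, smul_sub, smul_sub, smul_neg]
  have : (2⁻¹ : ℝ) • (B X ⋏ α) + (2⁻¹ : ℝ) • (B X ⋏ α) = B X ⋏ α := by
    rw [← add_smul]; norm_num
  conv_rhs => rw [← this]
  module

/-- The identity `ι_X ωᵏ⁺¹ = (k+1) ω(X,·) ∧ ωᵏ`, through which nondegeneracy of ω enters all
statements on its powers. -/
theorem curryLeft_wedgePow (B : V →L[ℝ] V →L[ℝ] ℝ) (hB : ∀ u v, B u v = -B v u) (X : V) (k : ℕ) :
    (wedgePow B (k + 1)).curryLeft X = ((k : ℝ) + 1) • (B X ⋏ wedgePow B k) := by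
  induction k with
  | zero =>
    rw [wedgePow_succ]
    refine (curryLeft_wedgeTwo_zero B hB X _).trans ?_
    simp
  | succ k ih =>
    rw [wedgePow_succ]
    refine (curryLeft_wedgeTwo B hB X (k := 2 * k + 1) _).trans ?_
    rw [ih, wedgeTwo_smul, wedgeTwo_wedgeOne, ← wedgePow_succ]
    push_cast
    have : ∀ β : V [⋀^Fin (2 * (k + 1) + 1)]→L[ℝ] ℝ,
      β + ((k : ℝ) + 1) • β = ((k : ℝ) + 1 + 1) • β := fun β => by module
    exact this _

/-- The binomial formula for the powers of `ω + ξ ∧ η`. -/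
theorem wedgePow_add_wedgeBilin (B : V →L[ℝ] V →L[ℝ] ℝ) (a c : ℝ) (ξ η : V →L[ℝ] ℝ) (k : ℕ) :
    wedgePow (a • B + c • wedgeBilin ξ η) (k + 1)
      = a ^ (k + 1) • wedgePow B (k + 1)
        + (((k : ℝ) + 1) * a ^ k * c) • (ξ ⋏ η ⋏ wedgePow B k) := by
  have h0 : wedgePow (a • B + c • wedgeBilin ξ η) 0 = wedgePow B 0 := by
    ext v; rw [wedgePow_zero, wedgePow_zero]
  induction k with
  | zero =>
    rw [wedgePow_succ, h0, add_wedgeTwo, smul_wedgeTwo, smul_wedgeTwo, wedgeBilin_wedgeTwo,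
      ← wedgePow_succ]
    simp
  | succ k ih =>
    rw [wedgePow_succ, ih]
    refine (wedgeTwo_add _ _ _).trans ?_
    simp only [wedgeTwo_smul, add_wedgeTwo, smul_wedgeTwo]
    have e1 := wedgePow_succ B (k + 1)
    have e2 : wedgeTwo B (ξ ⋏ η ⋏ wedgePow B k) = ξ ⋏ η ⋏ wedgePow B (k + 1) := by
      rw [wedgeTwo_wedgeOne, wedgeTwo_wedgeOne, ← wedgePow_succ]
    -- The square of a decomposable 2-form vanishes, so the binomial series stops after its second
    -- term.
    have e3 : wedgeTwo (wedgeBilin ξ η) (ξ ⋏ η ⋏ wedgePow B k) = 0 := by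
      rw [wedgeBilin_wedgeTwo, wedgeOne_anticomm η ξ, wedgeOne_neg, wedgeOne_wedgeOne_self, neg_zero]
    have e4 := wedgeBilin_wedgeTwo ξ η (wedgePow B (k + 1))
    refine (congrArg₂ (· + ·) (congrArg _ (congrArg₂ (· + ·) (congrArg _ e1.symm)
      (congrArg _ e4))) (congrArg _ (congrArg₂ (· + ·) (congrArg _ e2) (congrArg _ e3)))).trans ?_
    have : ∀ β γ : V [⋀^Fin (2 * (k + 1) + 2)]→L[ℝ] ℝ,
      a ^ (k + 1) • (a • β + c • γ) + (((k : ℝ) + 1) * a ^ k * c) • (a • γ + c • 0)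
        = a ^ (k + 1 + 1) • β + ((((k + 1 : ℕ) : ℝ) + 1) * a ^ (k + 1) * c) • γ := by
      intro β γ
      push_cast
      module
    exact this _ _

end WedgeTwo

end ExteriorAlgebra

/-! ### Powers of the fundamental forms of a quaternionic Hermitian vector space. -/

section QuaternionicAlgebra

open ContinuousAlternatingMap (curryLeft_apply_apply compContinuousLinearMap_apply)
open scoped Matrix Nat

variable {E : Type*} [NormedAddCommGroup E] [NormedSpace ℝ E]

theorem dotProduct_fin3 (x y : Fin 3 → ℝ) : x ⬝ᵥ y = x 0 * y 0 + x 1 * y 1 + x 2 * y 2 := by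
  simp [dotProduct, Fin.sum_univ_three]

/-- A triple of endomorphisms satisfying the quaternionic relations, together with a compatible
scalar product. -/
structure IsQuaternionicHermitian (I₁ I₂ I₃ : E →L[ℝ] E) (g : E →L[ℝ] E →L[ℝ] ℝ) : Prop where
  sq₁ : ∀ v, I₁ (I₁ v) = -v
  sq₂ : ∀ v, I₂ (I₂ v) = -v
  mul : ∀ v, I₁ (I₂ v) = I₃ v
  anti : ∀ v, I₂ (I₁ v) = -I₃ v
  inv₁ : ∀ u v, g (I₁ u) (I₁ v) = g u v
  inv₂ : ∀ u v, g (I₂ u) (I₂ v) = g u v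
  symm : ∀ u v, g u v = g v u
  pos : ∀ v, v ≠ 0 → 0 < g v v

/-- The action `x₁ I₁ + x₂ I₂ + x₃ I₃` of an imaginary quaternion. -/
def quatAct (I₁ I₂ I₃ : E →L[ℝ] E) (x : Fin 3 → ℝ) : E →L[ℝ] E :=
  x 0 • I₁ + x 1 • I₂ + x 2 • I₃

theorem quatAct_apply (I₁ I₂ I₃ : E →L[ℝ] E) (x : Fin 3 → ℝ) (v : E) :
    quatAct I₁ I₂ I₃ x v = x 0 • I₁ v + x 1 • I₂ v + x 2 • I₃ v := rfl

theorem quatAct_add (I₁ I₂ I₃ : E →L[ℝ] E) (x y : Fin 3 → ℝ) :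
    quatAct I₁ I₂ I₃ (x + y) = quatAct I₁ I₂ I₃ x + quatAct I₁ I₂ I₃ y := by
  simp only [quatAct, Pi.add_apply]; module

theorem quatAct_smul (I₁ I₂ I₃ : E →L[ℝ] E) (c : ℝ) (x : Fin 3 → ℝ) :
    quatAct I₁ I₂ I₃ (c • x) = c • quatAct I₁ I₂ I₃ x := by
  simp only [quatAct, Pi.smul_apply, smul_eq_mul]; module

namespace IsQuaternionicHermitian

variable {I₁ I₂ I₃ : E →L[ℝ] E} {g : E →L[ℝ] E →L[ℝ] ℝ} (h : IsQuaternionicHermitian I₁ I₂ I₃ g)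
include h

/-- The product of imaginary quaternions: minus the scalar product plus the cross product. -/
theorem quatAct_quatAct (x y : Fin 3 → ℝ) (v : E) :
    quatAct I₁ I₂ I₃ x (quatAct I₁ I₂ I₃ y v) = -(x ⬝ᵥ y) • v + quatAct I₁ I₂ I₃ (x ⨯₃ y) v := by
  have h12 := h.mul
  have h21 := h.anti
  have h11 := h.sq₁
  have h22 := h.sq₂
  have h13 : ∀ v, I₁ (I₃ v) = -I₂ v := fun v => by rw [← h12, h11]
  have h31 : ∀ v, I₃ (I₁ v) = I₂ v := fun v => by rw [← h12, h21, map_neg, h13, neg_neg]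
  have h32 : ∀ v, I₃ (I₂ v) = -I₁ v := fun v => by rw [← h12, h22, map_neg]
  have h23 : ∀ v, I₂ (I₃ v) = I₁ v := fun v => by rw [← h12, h21, h32, neg_neg]
  have h33 : ∀ v, I₃ (I₃ v) = -v := fun v => by rw [← h12 (I₃ v), h23, h11]
  simp only [quatAct_apply, map_add, map_smul, h11, h12, h13, h21, h22, h23, h31, h32, h33,
    cross_apply, Matrix.cons_val, dotProduct_fin3]
  module

theorem inv₃ (u v : E) : g (I₃ u) (I₃ v) = g u v := by
  rw [← h.mul, ← h.mul, h.inv₁, h.inv₂]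

theorem skew (x : Fin 3 → ℝ) (u v : E) :
    g (quatAct I₁ I₂ I₃ x u) v = -g u (quatAct I₁ I₂ I₃ x v) := by
  have e1 : g (I₁ u) v = -g u (I₁ v) := by
    rw [← h.inv₁ (I₁ u) v, h.sq₁]; simp
  have e2 : g (I₂ u) v = -g u (I₂ v) := by
    rw [← h.inv₂ (I₂ u) v, h.sq₂]; simp
  have e3 : g (I₃ u) v = -g u (I₃ v) := by
    rw [← h.inv₃ (I₃ u) v]
    have := h.quatAct_quatAct ![0, 0, 1] ![0, 0, 1] u
    simp [quatAct_apply] at this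
    rw [this]; simp
  simp only [quatAct_apply, map_add, map_smul, add_apply, smul_apply, e1, e2, e3, smul_eq_mul]
  ring

theorem quatAct_sq {A : Fin 3 → ℝ} (hA : A ⬝ᵥ A = 1) (v : E) :
    quatAct I₁ I₂ I₃ A (quatAct I₁ I₂ I₃ A v) = -v := by
  rw [h.quatAct_quatAct, hA, cross_self]
  simp [quatAct]

theorem quatAct_inv {A : Fin 3 → ℝ} (hA : A ⬝ᵥ A = 1) (u v : E) :
    g (quatAct I₁ I₂ I₃ A u) (quatAct I₁ I₂ I₃ A v) = g u v := by
  rw [h.skew, h.quatAct_sq hA]; simp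

theorem fundamental_skew (A : Fin 3 → ℝ) (u v : E) :
    (g.comp (quatAct I₁ I₂ I₃ A)) u v = -(g.comp (quatAct I₁ I₂ I₃ A)) v u := by
  change g (quatAct I₁ I₂ I₃ A u) v = -g (quatAct I₁ I₂ I₃ A v) u
  rw [h.skew, h.symm]

variable [FiniteDimensional ℝ E]

theorem exists_metric_eq (ξ : E →L[ℝ] ℝ) : ∃ Y, g Y = ξ := by
  have hinj : Function.Injective (g : E →ₗ[ℝ] E →L[ℝ] ℝ) := by
    rw [injective_iff_map_eq_zero]
    intro v hv
    by_contra hne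
    have := h.pos v hne
    have h0 : g v = 0 := hv
    rw [h0] at this
    simp at this
  have hfr : Module.finrank ℝ E = Module.finrank ℝ (E →L[ℝ] ℝ) := by
    rw [← (LinearMap.toContinuousLinearMap (𝕜 := ℝ) (E := E) (F' := ℝ)).finrank_eq]
    exact (Subspace.dual_finrank_eq (K := ℝ) (V := E)).symm
  exact (LinearMap.injective_iff_surjective_of_finrank_eq_finrank hfr).1 hinj ξ

theorem exists_fundamental_eq {A : Fin 3 → ℝ} (hA : A ⬝ᵥ A = 1) (ξ : E →L[ℝ] ℝ) :
    ∃ X, (g.comp (quatAct I₁ I₂ I₃ A)) X = ξ := by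
  obtain ⟨Y, hY⟩ := h.exists_metric_eq ξ
  refine ⟨-quatAct I₁ I₂ I₃ A Y, ?_⟩
  change g (quatAct I₁ I₂ I₃ A (-quatAct I₁ I₂ I₃ A Y)) = ξ
  rw [map_neg, h.quatAct_sq hA, neg_neg, hY]

/-- If `ωᵏ⁺¹ = 0`, contracting with every X gives `ω(X,·) ∧ ωᵏ = 0`. Since ω is nondegenerate, every
covector then annihilates `ωᵏ`, which forces `ωᵏ = 0` below the top degree. -/
theorem wedgePow_ne_zero {A : Fin 3 → ℝ} (hA : A ⬝ᵥ A = 1) {k : ℕ}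
    (hk : 2 * k ≤ Module.finrank ℝ E) : wedgePow (g.comp (quatAct I₁ I₂ I₃ A)) k ≠ 0 := by
  induction k with
  | zero =>
    intro h0
    have := wedgePow_zero (g.comp (quatAct I₁ I₂ I₃ A)) (fun _ => 0)
    rw [h0] at this
    simp at this
  | succ k ih =>
    intro h0
    refine ih (by omega) (eq_zero_of_wedgeOne_eq_zero (by omega) _ fun ξ => ?_)
    obtain ⟨X, rfl⟩ := h.exists_fundamental_eq hA ξ
    have h1 := curryLeft_wedgePow _ (h.fundamental_skew A) X k
    have h2 : (wedgePow (g.comp (quatAct I₁ I₂ I₃ A)) (k + 1)).curryLeft X = 0 := by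
      rw [h0]; rfl
    rw [h2] at h1
    exact (smul_eq_zero.1 h1.symm).resolve_left (by positivity)

variable {k : ℕ} (hE : Module.finrank ℝ E = 2 * (k + 1))
include hE

/-- An almost complex structure from the quaternionic family preserves the volume form. -/
theorem wedgePow_compContinuousLinearMap {A : Fin 3 → ℝ} (hA : A ⬝ᵥ A = 1)
    (ν : E [⋀^Fin (2 * (k + 1))]→L[ℝ] ℝ) :
    ν.compContinuousLinearMap (quatAct I₁ I₂ I₃ A) = ν := by
  -- Top forms are one-dimensional, so it suffices to treat the top power of `ω_A`, and A preserves
  -- `ω_A`.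
  obtain ⟨c, rfl⟩ := exists_eq_smul_of_ne_zero hE ν _ (h.wedgePow_ne_zero hA hE.ge)
  have : (wedgePow (g.comp (quatAct I₁ I₂ I₃ A)) (k + 1)).compContinuousLinearMap
      (quatAct I₁ I₂ I₃ A) = wedgePow (g.comp (quatAct I₁ I₂ I₃ A)) (k + 1) := by
    rw [wedgePow_comp]
    congr 1
    ext u v
    exact h.quatAct_inv hA _ _
  conv_rhs => rw [← this]
  rfl

/-- The normalised sum R of A and B satisfies `BR = RA`, so pulling `ω_B` back by R gives `ω_A`.
Pulling back by R preserves top forms, hence the top powers agree. -/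
theorem wedgePow_eq_of_add_ne_zero {A B : Fin 3 → ℝ} (hA : A ⬝ᵥ A = 1) (hB : B ⬝ᵥ B = 1)
    (hAB : A + B ≠ 0) :
    wedgePow (g.comp (quatAct I₁ I₂ I₃ A)) (k + 1)
      = wedgePow (g.comp (quatAct I₁ I₂ I₃ B)) (k + 1) := by
  have hN : 0 < (A + B) ⬝ᵥ (A + B) := by
    have hnn : 0 ≤ (A + B) ⬝ᵥ (A + B) := by simpa using dotProduct_star_self_nonneg (A + B)
    exact lt_of_le_of_ne hnn (fun h0 => hAB (dotProduct_self_eq_zero.1 h0.symm))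
  set N := (A + B) ⬝ᵥ (A + B) with hNdef
  set R : Fin 3 → ℝ := (Real.sqrt N)⁻¹ • (A + B) with hR
  have hs : (Real.sqrt N)⁻¹ * (Real.sqrt N)⁻¹ * N = 1 := by
    rw [← mul_inv, Real.mul_self_sqrt hN.le, inv_mul_cancel₀ hN.ne']
  have hRR : R ⬝ᵥ R = 1 := by
    rw [hR, smul_dotProduct, dotProduct_smul, smul_eq_mul, smul_eq_mul, ← mul_assoc, ← hNdef, hs]
  have hconj : ∀ v, quatAct I₁ I₂ I₃ B (quatAct I₁ I₂ I₃ R v)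
      = quatAct I₁ I₂ I₃ R (quatAct I₁ I₂ I₃ A v) := fun v => by
    have e : ∀ v, quatAct I₁ I₂ I₃ R v
      = (Real.sqrt N)⁻¹ • (quatAct I₁ I₂ I₃ A v + quatAct I₁ I₂ I₃ B v) := fun v => by
        rw [hR, quatAct_smul, quatAct_add]; rfl
    rw [e, e, map_smul, map_add, h.quatAct_sq hA, h.quatAct_sq hB, add_comm]
  rw [← h.wedgePow_compContinuousLinearMap hE hRR
    (wedgePow (g.comp (quatAct I₁ I₂ I₃ B)) (k + 1)), wedgePow_comp]
  congr 1
  ext u v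
  change g (quatAct I₁ I₂ I₃ A u) v = g (quatAct I₁ I₂ I₃ B (quatAct I₁ I₂ I₃ R u)) _
  rw [hconj]
  exact (h.quatAct_inv hRR _ _).symm

/-- The top power of the fundamental form does not depend on the complex structure. -/
theorem wedgePow_eq {A B : Fin 3 → ℝ} (hA : A ⬝ᵥ A = 1) (hB : B ⬝ᵥ B = 1) :
    wedgePow (g.comp (quatAct I₁ I₂ I₃ A)) (k + 1)
      = wedgePow (g.comp (quatAct I₁ I₂ I₃ B)) (k + 1) := by
  by_cases hAB : A + B = 0
  -- For antipodal A and B the comparison passes through a third point C different from both: the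
  -- first basis vector, or the second one if A is plus or minus the first.
  · obtain ⟨C, hC, hAC⟩ : ∃ C : Fin 3 → ℝ, C ⬝ᵥ C = 1 ∧ A ⬝ᵥ C ≠ 1 ∧ A ⬝ᵥ C ≠ -1 := by
      by_cases h0 : A ⬝ᵥ ![1, 0, 0] ≠ 1 ∧ A ⬝ᵥ ![1, 0, 0] ≠ -1
      · exact ⟨_, by simp, h0⟩
      · refine ⟨![0, 1, 0], by simp, ?_⟩
        simp only [dotProduct_fin3, Matrix.cons_val] at h0 hA ⊢
        have h1 : A 0 ^ 2 = 1 := by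
          by_contra h1
          refine h0 ⟨fun h2 => h1 ?_, fun h2 => h1 ?_⟩ <;> nlinarith
        have h2 : A 1 = 0 := by nlinarith [sq_nonneg (A 1), sq_nonneg (A 2)]
        simp [h2]
    have hne : ∀ D : Fin 3 → ℝ, D ⬝ᵥ D = 1 → D ⬝ᵥ C ≠ -1 → D + C ≠ 0 := by
      intro D hD hDC h0
      rw [eq_neg_of_add_eq_zero_right h0] at hDC
      simp [hD] at hDC
    rw [h.wedgePow_eq_of_add_ne_zero hE hA hC (hne A hA hAC.2),
      h.wedgePow_eq_of_add_ne_zero hE hB hC (hne B hB ?_)]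
    rw [eq_neg_of_add_eq_zero_right hAB, neg_dotProduct]
    intro h1
    exact hAC.1 (neg_injective h1)
  · exact h.wedgePow_eq_of_add_ne_zero hE hA hB hAB

omit hE in
theorem fundamental_wedgeOne_wedgePow (A : Fin 3 → ℝ) (X : E) :
    (g.comp (quatAct I₁ I₂ I₃ A)) X ⋏ wedgePow (g.comp (quatAct I₁ I₂ I₃ A)) k
      = ((k : ℝ) + 1)⁻¹ • (wedgePow (g.comp (quatAct I₁ I₂ I₃ A)) (k + 1)).curryLeft X := by
  rw [curryLeft_wedgePow _ (h.fundamental_skew A), smul_smul, inv_mul_cancel₀ (by positivity),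
    one_smul]

-- The form `ξ ∧ ν` has degree above the dimension and vanishes; contracting it with X gives the
-- identity.
omit h in
theorem wedgeOne_curryLeft_top (ν : E [⋀^Fin (2 * (k + 1))]→L[ℝ] ℝ) (ξ : E →L[ℝ] ℝ) (X : E) :
    ξ ⋏ (ν.curryLeft X) = ξ X • ν := by
  have h1 := curryLeft_wedgeOne X ξ ν
  have h2 : ξ ⋏ ν = 0 := eq_zero_of_finrank_lt (by omega) _
  rw [h2] at h1
  exact (sub_eq_zero.1 (h1.symm.trans rfl)).symm

/-- The powers `ω_Aⁿ⁻¹` depend linearly on the point `A` of the unit sphere. -/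
theorem wedgePow_eq_sum {A : Fin 3 → ℝ} (hA : A ⬝ᵥ A = 1) :
    wedgePow (g.comp (quatAct I₁ I₂ I₃ A)) k
      = A 0 • wedgePow (g.comp I₁) k + A 1 • wedgePow (g.comp I₂) k
        + A 2 • wedgePow (g.comp I₃) k := by
  have e1 : quatAct I₁ I₂ I₃ ![1, 0, 0] = I₁ := by simp [quatAct]
  have e2 : quatAct I₁ I₂ I₃ ![0, 1, 0] = I₂ := by simp [quatAct]
  have e3 : quatAct I₁ I₂ I₃ ![0, 0, 1] = I₃ := by simp [quatAct]
  -- After wedging with two covectors ξ and `g Y`, the power `ω_Bᵏ` becomes `ξ(-BY)/(k+1)` times a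
  -- volume form independent of B. This is linear in B, and forms of codimension two are detected by
  -- such products.
  have key : ∀ B : Fin 3 → ℝ, B ⬝ᵥ B = 1 → ∀ (ξ : E →L[ℝ] ℝ) (Y : E),
      ξ ⋏ g Y ⋏ wedgePow (g.comp (quatAct I₁ I₂ I₃ B)) k
        = ξ (-quatAct I₁ I₂ I₃ B Y) • (((k : ℝ) + 1)⁻¹ •
          wedgePow (g.comp (quatAct I₁ I₂ I₃ A)) (k + 1)) := by
    intro B hB ξ Y
    have : g Y = (g.comp (quatAct I₁ I₂ I₃ B)) (-quatAct I₁ I₂ I₃ B Y) := by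
      change g Y = g (quatAct I₁ I₂ I₃ B (-quatAct I₁ I₂ I₃ B Y))
      rw [map_neg, h.quatAct_sq hB, neg_neg]
    rw [this, h.fundamental_wedgeOne_wedgePow, h.wedgePow_eq hE hA hB, wedgeOne_smul, smul_comm]
    congr 1
    exact wedgeOne_curryLeft_top hE _ _ _
  have k1 := key ![1, 0, 0] (by simp)
  have k2 := key ![0, 1, 0] (by simp)
  have k3 := key ![0, 0, 1] (by simp)
  rw [e1] at k1
  rw [e2] at k2
  rw [e3] at k3
  rw [← sub_eq_zero]
  refine eq_zero_of_wedgeOne_eq_zero (by omega) _ fun η => ?_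
  refine eq_zero_of_wedgeOne_eq_zero (by omega) _ fun ξ => ?_
  obtain ⟨Y, rfl⟩ := h.exists_metric_eq η
  simp only [wedgeOne_sub, wedgeOne_add, wedgeOne_smul, key A hA, k1, k2, k3, quatAct_apply,
    neg_add, map_add, map_neg, map_smul, smul_eq_mul]
  module

end IsQuaternionicHermitian

end QuaternionicAlgebra

/-! ### Pointwise computation of the power of the sheared Hermitian form. -/

section TwistorAlgebra

open ContinuousAlternatingMap (curryLeft_apply_apply compContinuousLinearMap_apply)
open scoped Matrix Nat

variable {E : Type*} [NormedAddCommGroup E] [NormedSpace ℝ E]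

/-- The linear combination of three vectors with given coefficients. -/
def combine (T : Fin 3 → E) (x : Fin 3 → ℝ) : E := x 0 • T 0 + x 1 • T 1 + x 2 • T 2

/-- The vector-valued form `v ↦ -T(A × v) - v T(A) - A T(v) + 2 ⟨A, v⟩ A T(A)` on `ℝ³`, which
vanishes at `A` and intertwines `v ↦ A × v` with the action of `A`. -/
def twistVector (I₁ I₂ I₃ : E →L[ℝ] E) (T : Fin 3 → E) (A v : Fin 3 → ℝ) : E :=
  -combine T (A ⨯₃ v) - quatAct I₁ I₂ I₃ v (combine T A) - quatAct I₁ I₂ I₃ A (combine T v)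
    + (2 * (A ⬝ᵥ v)) • quatAct I₁ I₂ I₃ A (combine T A)

theorem twistVector_sum (I₁ I₂ I₃ : E →L[ℝ] E) (T : Fin 3 → E) (A v : Fin 3 → ℝ) :
    twistVector I₁ I₂ I₃ T A v = v 0 • twistVector I₁ I₂ I₃ T A ![1, 0, 0]
      + v 1 • twistVector I₁ I₂ I₃ T A ![0, 1, 0] + v 2 • twistVector I₁ I₂ I₃ T A ![0, 0, 1] := by
  simp only [twistVector, combine, quatAct_apply, dotProduct_fin3, cross_apply, Matrix.cons_val,
    map_add, map_smul]
  module

/-- The three covectors `½ g(Φ(eᵢ), ·)`, where `Φ` is `twistVector`. -/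
def twistCovector (I₁ I₂ I₃ : E →L[ℝ] E) (g : E →L[ℝ] E →L[ℝ] ℝ) (T : Fin 3 → E) (A : Fin 3 → ℝ)
    (i : Fin 3) : E →L[ℝ] ℝ :=
  (2⁻¹ : ℝ) • g (twistVector I₁ I₂ I₃ T A (Pi.single i 1))

theorem single_fin3 : (Pi.single 0 1 : Fin 3 → ℝ) = ![1, 0, 0] ∧
    (Pi.single 1 1 : Fin 3 → ℝ) = ![0, 1, 0] ∧ (Pi.single 2 1 : Fin 3 → ℝ) = ![0, 0, 1] := by
  refine ⟨?_, ?_, ?_⟩ <;> (ext i; fin_cases i <;> rfl)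

theorem combine_twistCovector (I₁ I₂ I₃ : E →L[ℝ] E) (g : E →L[ℝ] E →L[ℝ] ℝ) (T : Fin 3 → E)
    (A v : Fin 3 → ℝ) :
    combine (twistCovector I₁ I₂ I₃ g T A) v
      = (2⁻¹ : ℝ) • g (twistVector I₁ I₂ I₃ T A v) := by
  rw [twistVector_sum I₁ I₂ I₃ T A v]
  simp only [combine, twistCovector, single_fin3, map_add, map_smul]
  module

/-- The completeness relation comes from the matrix with rows A, e, A × e: its rows are orthonormal,
so its columns are too. The frame serves to compute at a point; the final formulas do not contain
it. -/
theorem exists_oriented_frame {A : Fin 3 → ℝ} (hA : A ⬝ᵥ A = 1) :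
    ∃ e : Fin 3 → ℝ, e ⬝ᵥ e = 1 ∧ A ⬝ᵥ e = 0 ∧
      ∀ i j, A i * A j + e i * e j + (A ⨯₃ e) i * (A ⨯₃ e) j = if i = j then 1 else 0 := by
  -- An explicit nonzero vector orthogonal to A, to be normalised.
  obtain ⟨w, hw0, hw⟩ : ∃ w : Fin 3 → ℝ, w ≠ 0 ∧ A ⬝ᵥ w = 0 := by
    by_cases h : A 0 = 0
    · refine ⟨![1, 0, 0], fun h => ?_, by rw [dotProduct_fin3]; simp [h]⟩
      simpa using congrFun h 0
    · refine ⟨![A 1, -A 0, 0], fun h' => h ?_, by rw [dotProduct_fin3]; simp; ring⟩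
      simpa using congrFun h' 1
  have hN : 0 < w ⬝ᵥ w := by
    have hnn : 0 ≤ w ⬝ᵥ w := by
      rw [dotProduct_fin3]
      nlinarith [sq_nonneg (w 0), sq_nonneg (w 1), sq_nonneg (w 2)]
    exact lt_of_le_of_ne hnn (fun h0 => hw0 (dotProduct_self_eq_zero.1 h0.symm))
  set c := (Real.sqrt (w ⬝ᵥ w))⁻¹ with hc
  have hs : c * c * (w ⬝ᵥ w) = 1 := by
    rw [hc, ← mul_inv, Real.mul_self_sqrt hN.le, inv_mul_cancel₀ hN.ne']
  have he : (c • w) ⬝ᵥ (c • w) = 1 := by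
    rw [smul_dotProduct, dotProduct_smul, smul_eq_mul, smul_eq_mul, ← mul_assoc, hs]
  have hAe : A ⬝ᵥ (c • w) = 0 := by rw [dotProduct_smul, hw, smul_zero]
  refine ⟨c • w, he, hAe, ?_⟩
  generalize c • w = e at he hAe
  have h1 : (Matrix.of ![A, e, A ⨯₃ e]) * (Matrix.of ![A, e, A ⨯₃ e])ᵀ = 1 := by
    rw [dotProduct_fin3] at hA he hAe
    ext i j
    fin_cases i <;> fin_cases j <;>
      simp [Matrix.mul_apply, Fin.sum_univ_three, cross_apply] <;> try linarith only [hA, he, hAe]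
    · linear_combination (e 0 * e 0 + e 1 * e 1 + e 2 * e 2) * hA + he
        - (A 0 * e 0 + A 1 * e 1 + A 2 * e 2) * hAe
  have h2 := mul_eq_one_comm.1 h1
  intro i j
  have h3 := congrFun (congrFun h2 i) j
  rw [Matrix.mul_apply, Fin.sum_univ_three, Matrix.one_apply] at h3
  simpa using h3

theorem cross_frame {A e : Fin 3 → ℝ} (he : e ⬝ᵥ e = 1) (hAe : A ⬝ᵥ e = 0) :
    e ⨯₃ (A ⨯₃ e) = A := by
  rw [dotProduct_fin3] at he hAe
  ext i
  fin_cases i <;> simp [cross_apply]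
  · linear_combination A 0 * he - e 0 * hAe
  · linear_combination A 1 * he - e 1 * hAe
  · linear_combination A 2 * he - e 2 * hAe

theorem cross_cross_frame {A e : Fin 3 → ℝ} (hA : A ⬝ᵥ A = 1) (hAe : A ⬝ᵥ e = 0) :
    A ⨯₃ (A ⨯₃ e) = -e := by
  rw [dotProduct_fin3] at hA hAe
  ext i
  fin_cases i <;> simp [cross_apply]
  · linear_combination -e 0 * hA + A 0 * hAe
  · linear_combination -e 1 * hA + A 1 * hAe
  · linear_combination -e 2 * hA + A 2 * hAe

theorem twistVector_self (I₁ I₂ I₃ : E →L[ℝ] E) (T : Fin 3 → E) {A : Fin 3 → ℝ}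
    (hA : A ⬝ᵥ A = 1) : twistVector I₁ I₂ I₃ T A A = 0 := by
  have : combine T 0 = 0 := by simp [combine]
  rw [twistVector, hA, cross_self, this]
  module

section Twist

variable {I₁ I₂ I₃ : E →L[ℝ] E} {g : E →L[ℝ] E →L[ℝ] ℝ} (h : IsQuaternionicHermitian I₁ I₂ I₃ g)
include h

/-- For v orthogonal to A one has `Av = A × v` and `A × (A × v) = -v`, so A interchanges `-T(A × v)`
with `-A T(v)` at the rotated vector and commutes with the middle term. The last summand of
`twistVector` takes care of the component along A, where both sides vanish. -/
theorem IsQuaternionicHermitian.quatAct_twistVector (T : Fin 3 → E) {A : Fin 3 → ℝ}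
    (hA : A ⬝ᵥ A = 1) (v : Fin 3 → ℝ) :
    quatAct I₁ I₂ I₃ A (twistVector I₁ I₂ I₃ T A v) = twistVector I₁ I₂ I₃ T A (A ⨯₃ v) := by
  have hc : A ⨯₃ (A ⨯₃ v) = (A ⬝ᵥ v) • A - v := by
    rw [dotProduct_fin3] at hA ⊢
    ext i
    fin_cases i <;> simp [cross_apply]
    · linear_combination -v 0 * hA
    · linear_combination -v 1 * hA
    · linear_combination -v 2 * hA
  have hl : combine T ((A ⬝ᵥ v) • A - v) = (A ⬝ᵥ v) • combine T A - combine T v := by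
    simp only [combine, Pi.sub_apply, Pi.smul_apply, smul_eq_mul]; module
  have hd : A ⬝ᵥ (A ⨯₃ v) = 0 := by rw [dotProduct_fin3]; simp [cross_apply]; ring
  rw [twistVector, twistVector, hc, hl, hd]
  simp only [map_add, map_sub, map_neg, map_smul, h.quatAct_sq hA, h.quatAct_quatAct A v]
  module

/-- The sum of the squared lengths of the vectors `Φ(eᵢ)` in terms of a single one. -/
theorem IsQuaternionicHermitian.sum_twistVector (T : Fin 3 → E) {A e : Fin 3 → ℝ}
    (hA : A ⬝ᵥ A = 1)
    (hres : ∀ i j, A i * A j + e i * e j + (A ⨯₃ e) i * (A ⨯₃ e) j = if i = j then 1 else 0) :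
    ∑ i, g (twistVector I₁ I₂ I₃ T A (Pi.single i 1)) (twistVector I₁ I₂ I₃ T A (Pi.single i 1))
      = 2 * g (twistVector I₁ I₂ I₃ T A e) (twistVector I₁ I₂ I₃ T A e) := by
  set P : Fin 3 → E := fun i => twistVector I₁ I₂ I₃ T A (Pi.single i 1) with hP
  have hs : ∀ v, twistVector I₁ I₂ I₃ T A v = ∑ i, v i • P i := fun v => by
    rw [twistVector_sum, Fin.sum_univ_three]
    simp only [hP, single_fin3]
  have hg : ∀ v, g (twistVector I₁ I₂ I₃ T A v) (twistVector I₁ I₂ I₃ T A v)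
      = ∑ i, ∑ j, v i * v j * g (P i) (P j) := fun v => by
    rw [hs, map_sum]
    refine Finset.sum_congr rfl fun i _ => ?_
    rw [map_sum, sum_apply]
    exact Finset.sum_congr rfl fun j _ => by
      simp only [map_smul, smul_apply, smul_eq_mul]
      rw [h.symm (P i) (P j)]
      ring
  have h1 : ∑ i, g (P i) (P i) = ∑ i, ∑ j, (if i = j then 1 else 0) * g (P i) (P j) := by
    simp
  -- In the frame A, e, A × e the contribution of A is zero, and the other two agree because the
  -- action of A is an isometry.
  have h2 : g (twistVector I₁ I₂ I₃ T A (A ⨯₃ e)) (twistVector I₁ I₂ I₃ T A (A ⨯₃ e))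
      = g (twistVector I₁ I₂ I₃ T A e) (twistVector I₁ I₂ I₃ T A e) := by
    rw [← h.quatAct_twistVector T hA, h.quatAct_inv hA]
  have h3 : g (twistVector I₁ I₂ I₃ T A A) (twistVector I₁ I₂ I₃ T A A) = 0 := by
    rw [twistVector_self I₁ I₂ I₃ T hA]; simp
  rw [h1]
  simp only [← hres, add_mul, Finset.sum_add_distrib]
  rw [← hg, ← hg, ← hg, h2, h3]
  ring

end Twist

section Product

variable {E' : Type*} [NormedAddCommGroup E'] [NormedSpace ℝ E']

/-- The pullback of a form to a product along the first projection. -/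
def pullFst (E' : Type*) [NormedAddCommGroup E'] [NormedSpace ℝ E'] {k : ℕ}
    (α : E [⋀^Fin k]→L[ℝ] ℝ) : (E × E') [⋀^Fin k]→L[ℝ] ℝ :=
  α.compContinuousLinearMap (ContinuousLinearMap.fst ℝ E E')

theorem pullFst_wedgeOne {k : ℕ} (ξ : E →L[ℝ] ℝ) (α : E [⋀^Fin k]→L[ℝ] ℝ) :
    pullFst E' (ξ ⋏ α) = (ξ.comp (ContinuousLinearMap.fst ℝ E E')) ⋏ pullFst E' α :=
  wedgeOne_comp _ _ _

theorem pullFst_add {k : ℕ} (α β : E [⋀^Fin k]→L[ℝ] ℝ) :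
    pullFst E' (α + β) = pullFst E' α + pullFst E' β := rfl

theorem pullFst_smul {k : ℕ} (c : ℝ) (α : E [⋀^Fin k]→L[ℝ] ℝ) :
    pullFst E' (c • α) = c • pullFst E' α := rfl

/-- The 2-form `(w, w') ↦ a g(A X, X') + b ⟨A × v, v'⟩` on `E × E'`, where `w = (X, V)` and
`vᵢ = dxᵢ(V) + rᵢ(X)`. -/
def twistorForm (I₁ I₂ I₃ : E →L[ℝ] E) (g : E →L[ℝ] E →L[ℝ] ℝ) (r : Fin 3 → E →L[ℝ] ℝ)
    (A : Fin 3 → ℝ) (dx : Fin 3 → E' →L[ℝ] ℝ) (a b : ℝ) : (E × E') →L[ℝ] (E × E') →L[ℝ] ℝ :=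
  let ζ : Fin 3 → (E × E') →L[ℝ] ℝ := fun i =>
    (dx i).comp (ContinuousLinearMap.snd ℝ E E') + (r i).comp (ContinuousLinearMap.fst ℝ E E')
  a • (g.comp (quatAct I₁ I₂ I₃ A)).bilinearComp (ContinuousLinearMap.fst ℝ E E')
      (ContinuousLinearMap.fst ℝ E E')
    + b • (A 0 • wedgeBilin (ζ 1) (ζ 2) + A 1 • wedgeBilin (ζ 2) (ζ 0)
      + A 2 • wedgeBilin (ζ 0) (ζ 1))

/-- Expansion of a vector-valued triple in the frame, the component along A being zero by
hypothesis. It is used for covectors tangent to the sphere. -/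
theorem eq_combine_frame {A e : Fin 3 → ℝ}
    (hres : ∀ i j, A i * A j + e i * e j + (A ⨯₃ e) i * (A ⨯₃ e) j = if i = j then 1 else 0)
    {W : Type*} [AddCommGroup W] [Module ℝ W] (ζ : Fin 3 → W)
    (hζ : A 0 • ζ 0 + A 1 • ζ 1 + A 2 • ζ 2 = 0) (i : Fin 3) :
    ζ i = e i • (e 0 • ζ 0 + e 1 • ζ 1 + e 2 • ζ 2)
      + (A ⨯₃ e) i • ((A ⨯₃ e) 0 • ζ 0 + (A ⨯₃ e) 1 • ζ 1 + (A ⨯₃ e) 2 • ζ 2) := by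
  have h1 : ζ i = ∑ j, (if i = j then (1 : ℝ) else 0) • ζ j := by simp
  have h2 : e i • (e 0 • ζ 0 + e 1 • ζ 1 + e 2 • ζ 2)
      + (A ⨯₃ e) i • ((A ⨯₃ e) 0 • ζ 0 + (A ⨯₃ e) 1 • ζ 1 + (A ⨯₃ e) 2 • ζ 2)
      = A i • (A 0 • ζ 0 + A 1 • ζ 1 + A 2 • ζ 2) + (e i • (e 0 • ζ 0 + e 1 • ζ 1 + e 2 • ζ 2)
      + (A ⨯₃ e) i • ((A ⨯₃ e) 0 • ζ 0 + (A ⨯₃ e) 1 • ζ 1 + (A ⨯₃ e) 2 • ζ 2)) := by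
    rw [hζ, smul_zero, zero_add]
  rw [h1, h2]
  simp only [← hres, Fin.sum_univ_three]
  module

/-- Both sides are the area form of A^⊥ evaluated on ζ; the coefficients match since `e × (A × e) =
A`. -/
theorem sum_wedgeBilin_eq_frame {A e : Fin 3 → ℝ} (hA : A ⬝ᵥ A = 1) (he : e ⬝ᵥ e = 1)
    (hAe : A ⬝ᵥ e = 0)
    (hres : ∀ i j, A i * A j + e i * e j + (A ⨯₃ e) i * (A ⨯₃ e) j = if i = j then 1 else 0)
    {W : Type*} [NormedAddCommGroup W] [NormedSpace ℝ W] (ζ : Fin 3 → W →L[ℝ] ℝ)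
    (hζ : combine ζ A = 0) :
    A 0 • wedgeBilin (ζ 1) (ζ 2) + A 1 • wedgeBilin (ζ 2) (ζ 0) + A 2 • wedgeBilin (ζ 0) (ζ 1)
      = wedgeBilin (combine ζ e) (combine ζ (A ⨯₃ e)) := by
  have hf := cross_frame he hAe
  have hz := eq_combine_frame hres ζ hζ
  set f := A ⨯₃ e
  change ∀ i, ζ i = e i • combine ζ e + f i • combine ζ f at hz
  have f0 := congrFun hf 0
  have f1 := congrFun hf 1
  have f2 := congrFun hf 2
  simp only [cross_apply, Matrix.cons_val] at f0 f1 f2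
  rw [dotProduct_fin3] at hA
  ext u v
  generalize combine ζ e = Z₁ at *
  generalize combine ζ f = Z₂ at *
  simp only [hz, add_apply, smul_apply, wedgeBilin_apply, smul_eq_mul]
  linear_combination (Z₁ u * Z₂ v - Z₂ u * Z₁ v) * (hA + A 0 * f0 + A 1 * f1 + A 2 * f2)

variable [FiniteDimensional ℝ E] [FiniteDimensional ℝ E']

/-- The power `ωⁿ` of the Hermitian form of the twistor space, at a point. -/
theorem IsQuaternionicHermitian.wedgePow_twistorForm {I₁ I₂ I₃ : E →L[ℝ] E}
    {g : E →L[ℝ] E →L[ℝ] ℝ} (h : IsQuaternionicHermitian I₁ I₂ I₃ g) {k : ℕ}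
    (hE : Module.finrank ℝ E = 2 * (k + 1)) (T : Fin 3 → E) {A : Fin 3 → ℝ} (hA : A ⬝ᵥ A = 1)
    (dx : Fin 3 → E' →L[ℝ] ℝ) (hdx : combine dx A = 0) {a b : ℝ}
    (hab : ((k + 1)! : ℝ) * (a ^ k * b) = 2)
    (dX : Fin 3 → (E × E') →L[ℝ] ℝ)
    (hdX : ∀ i, dX i = (dx i).comp (ContinuousLinearMap.snd ℝ E E'))
    (ν : E [⋀^Fin (2 * k + 1 + 1)]→L[ℝ] ℝ) (hν : wedgePow (g.comp I₁) (k + 1) = ((k + 1)! : ℝ) • ν)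
    (θ : Fin 3 → E [⋀^Fin (2 * k)]→L[ℝ] ℝ)
    (hθ : ∀ i, wedgePow (g.comp ((![I₁, I₂, I₃] : Fin 3 → E →L[ℝ] E) i)) k = (k ! : ℝ) • θ i) :
    wedgePow (twistorForm I₁ I₂ I₃ g (twistCovector I₁ I₂ I₃ g T A) A dx a b) (k + 1)
      = (((k + 1)! : ℝ) * a ^ (k + 1) + 4⁻¹ * ∑ i, g (twistVector I₁ I₂ I₃ T A (Pi.single i 1))
          (twistVector I₁ I₂ I₃ T A (Pi.single i 1))) • pullFst E' ν
        + (2 : ℝ) • (dX 1 ⋏ dX 2 ⋏ pullFst E' (θ 0) + dX 2 ⋏ dX 0 ⋏ pullFst E' (θ 1)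
          + dX 0 ⋏ dX 1 ⋏ pullFst E' (θ 2))
        - ((A 1 • dX 2 - A 2 • dX 1) ⋏ pullFst E' (ν.curryLeft (T 0))
          + (A 2 • dX 0 - A 0 • dX 2) ⋏ pullFst E' (ν.curryLeft (T 1))
          + (A 0 • dX 1 - A 1 • dX 0) ⋏ pullFst E' (ν.curryLeft (T 2)))
        - ∑ i, ∑ j, (A i • dX j + A j • dX i) ⋏
            pullFst E' (ν.curryLeft ((![I₁, I₂, I₃] : Fin 3 → E →L[ℝ] E) i (T j))) := by
  obtain ⟨e, he, hAe, hres⟩ := exists_oriented_frame hA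
  have hfe := cross_frame he hAe
  have hff := cross_cross_frame hA hAe
  have hAf : A ⬝ᵥ (A ⨯₃ e) = 0 := by rw [dotProduct_fin3]; simp [cross_apply]; ring
  have hsum := h.sum_twistVector T hA hres
  have hfr := sum_wedgeBilin_eq_frame (W := E × E') hA he hAe hres
  have hQe := h.quatAct_twistVector T hA e
  have hQf := h.quatAct_twistVector T hA (A ⨯₃ e)
  have hc := combine_twistCovector I₁ I₂ I₃ g T A
  have hdXA : A 0 • dX 0 + A 1 • dX 1 + A 2 • dX 2 = 0 := by
    have : A 0 • dX 0 + A 1 • dX 1 + A 2 • dX 2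
      = (combine dx A).comp (ContinuousLinearMap.snd ℝ E E') := by
        simp only [hdX, combine]; rfl
    rw [this, hdx]; rfl
  have hz := eq_combine_frame hres dX hdXA
  set f := A ⨯₃ e with hfdef
  set Φ := twistVector I₁ I₂ I₃ T A with hΦ
  set Q := quatAct I₁ I₂ I₃ A with hQ
  set ε₁ := e 0 • dX 0 + e 1 • dX 1 + e 2 • dX 2 with hε₁
  set ε₂ := f 0 • dX 0 + f 1 • dX 1 + f 2 • dX 2 with hε₂
  set p := ContinuousLinearMap.fst ℝ E E' with hp
  set ρ₁ : E →L[ℝ] ℝ := (2⁻¹ : ℝ) • g (Φ e) with hρ₁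
  set ρ₂ : E →L[ℝ] ℝ := (2⁻¹ : ℝ) • g (Φ f) with hρ₂
  -- In the frame the form is `a ω_A` plus one decomposable 2-form, so the binomial formula applies.
  -- The shear `r` has no component along A because Φ vanishes at A.
  have hform : twistorForm I₁ I₂ I₃ g (twistCovector I₁ I₂ I₃ g T A) A dx a b
      = a • (g.comp Q).bilinearComp p p + b • wedgeBilin (ε₁ + ρ₁.comp p) (ε₂ + ρ₂.comp p) := by
    have h0 := hfr (fun i => (dx i).comp (ContinuousLinearMap.snd ℝ E E')
      + ((twistCovector I₁ I₂ I₃ g T A) i).comp p) ?_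
    · refine (congrArg (fun t => a • (g.comp Q).bilinearComp p p + b • t) h0).trans ?_
      congr 3
      · rw [hρ₁, ← hc e]
        simp only [combine, hε₁, hdX]
        refine ContinuousLinearMap.ext fun w => ?_
        simp
        ring
      · rw [hρ₂, ← hc f]
        simp only [combine, hε₂, hdX]
        refine ContinuousLinearMap.ext fun w => ?_
        simp
        ring
    · have h1 := hc A
      rw [hΦ, twistVector_self I₁ I₂ I₃ T hA, map_zero, smul_zero] at h1
      have : combine (fun i => (dx i).comp (ContinuousLinearMap.snd ℝ E E')
        + ((twistCovector I₁ I₂ I₃ g T A) i).comp p) A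
        = (combine dx A).comp (ContinuousLinearMap.snd ℝ E E')
          + (combine (twistCovector I₁ I₂ I₃ g T A) A).comp p := by
        simp only [combine]
        refine ContinuousLinearMap.ext fun w => ?_
        simp
        ring
      rw [this, hdx, h1]
      simp
  have hpull : ∀ j, wedgePow ((g.comp Q).bilinearComp p p) j = pullFst E' (wedgePow (g.comp Q) j) :=
    fun j => (wedgePow_comp p (g.comp Q) j).symm
  have e1 : quatAct I₁ I₂ I₃ ![1, 0, 0] = I₁ := by simp [quatAct]
  have hvol : wedgePow (g.comp Q) (k + 1) = ((k + 1)! : ℝ) • ν := by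
    rw [← hν, hQ, h.wedgePow_eq hE hA (B := ![1, 0, 0]) (by simp), e1]
  have hθA : wedgePow (g.comp Q) k = (k ! : ℝ) • (A 0 • θ 0 + A 1 • θ 1 + A 2 • θ 2) := by
    rw [hQ, h.wedgePow_eq_sum hE hA]
    have t0 := hθ 0
    have t1 := hθ 1
    have t2 := hθ 2
    simp only [Matrix.cons_val] at t0 t1 t2
    rw [t0, t1, t2]
    module
  have hfac : ((k + 1)! : ℝ) = ((k : ℝ) + 1) * (k ! : ℝ) := by
    rw [Nat.factorial_succ]; push_cast; ring
  have hk1 : ((k : ℝ) + 1) ≠ 0 := by positivity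
  -- Wedging `ω_A(X,·)` with `ω_Aᵏ` amounts to contracting the volume form, which converts the shear
  -- covectors into contractions of ν.
  have hιcov : ∀ X : E, (g.comp Q) X ⋏ wedgePow (g.comp Q) k = (k ! : ℝ) • ν.curryLeft X := by
    intro X
    rw [hQ, h.fundamental_wedgeOne_wedgePow, ← hQ, hvol, hfac]
    refine (congrArg _ (curryLeft_smul' (k := 2 * k + 1) _ ν X)).trans ?_
    rw [smul_smul, ← mul_assoc, inv_mul_cancel₀ hk1, one_mul]
  -- `Φ(f) = AΦ(e)` and `AΦ(f) = -Φ(e)` express the two shear covectors as contractions of `ω_A`.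
  have hρ₂X : ρ₂ = (g.comp Q) ((2⁻¹ : ℝ) • Φ e) := by
    rw [hρ₂, map_smul]; congr 1; change _ = g (Q (Φ e)); rw [hQe]
  have hρ₁X : ρ₁ = (g.comp Q) (-((2⁻¹ : ℝ) • Φ f)) := by
    have hQff : Q (Φ f) = -Φ e := by
      rw [hQf, hff, hΦ, twistVector_sum I₁ I₂ I₃ T A e, twistVector_sum I₁ I₂ I₃ T A (-e)]
      simp only [Pi.neg_apply]
      module
    rw [hρ₁]
    ext v
    change 2⁻¹ * g (Φ e) v = g (Q (-((2⁻¹ : ℝ) • Φ f))) v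
    rw [map_neg, map_smul, hQff]
    simp
  have w2 : ρ₂ ⋏ wedgePow (g.comp Q) k = (k ! : ℝ) • ν.curryLeft ((2⁻¹ : ℝ) • Φ e) := by
    rw [hρ₂X, hιcov]
  have w1 : ρ₁ ⋏ wedgePow (g.comp Q) k = (k ! : ℝ) • ν.curryLeft (-((2⁻¹ : ℝ) • Φ f)) := by
    rw [hρ₁X, hιcov]
  have w12 : ρ₁ ⋏ ρ₂ ⋏ wedgePow (g.comp Q) k
      = ((k ! : ℝ) * (4⁻¹ * g (Φ e) (Φ e))) • ν := by
    rw [w2, wedgeOne_smul]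
    have := wedgeOne_curryLeft_top hE ν ρ₁ ((2⁻¹ : ℝ) • Φ e)
    refine (congrArg _ this).trans ?_
    rw [smul_smul, hρ₁]
    simp only [map_smul, smul_apply, smul_eq_mul]
    congr 1
    ring
  -- The terms are sorted by degree along the sphere: two, one and zero.
  have hZ : (ε₁ + ρ₁.comp p) ⋏ (ε₂ + ρ₂.comp p) ⋏ pullFst E' (wedgePow (g.comp Q) k)
      = (k ! : ℝ) • (ε₁ ⋏ ε₂ ⋏ pullFst E' (A 0 • θ 0 + A 1 • θ 1 + A 2 • θ 2)
        + (2⁻¹ : ℝ) • ε₁ ⋏ pullFst E' (ν.curryLeft (Φ e))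
        + (2⁻¹ : ℝ) • ε₂ ⋏ pullFst E' (ν.curryLeft (Φ f))
        + (4⁻¹ * g (Φ e) (Φ e)) • pullFst E' ν) := by
    rw [add_wedgeOne ε₂, ← pullFst_wedgeOne, w2, wedgeOne_add, add_wedgeOne ε₁, add_wedgeOne ε₁,
      wedgeOne_anticomm (ρ₁.comp p) ε₂, ← pullFst_wedgeOne, ← pullFst_wedgeOne, w1, ← w2, w12, w2,
      hθA]
    simp only [pullFst_smul, pullFst_add, wedgeOne_smul, wedgeOne_add, map_smul, map_neg]
    have hn : pullFst E' (-((2⁻¹ : ℝ) • ν.curryLeft (Φ f)))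
      = -((2⁻¹ : ℝ) • pullFst E' (ν.curryLeft (Φ f))) := rfl
    rw [hn]
    simp only [wedgeOne_neg, wedgeOne_smul, smul_wedgeOne]
    have : ∀ (x₀ x₁ x₂ y z w : (E × E') [⋀^Fin (2 * k + 1 + 1)]→L[ℝ] ℝ) (c G : ℝ),
        c • (A 0 • x₀ + A 1 • x₁ + A 2 • x₂) + -(c • -((2⁻¹ : ℝ) • z))
          + (c • (2⁻¹ : ℝ) • y + (c * (4⁻¹ * G)) • w)
        = c • (A 0 • x₀ + A 1 • x₁ + A 2 • x₂ + (2⁻¹ : ℝ) • y + (2⁻¹ : ℝ) • z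
          + (4⁻¹ * G) • w) := by
      intros; module
    exact this _ _ _ _ _ _ _ _
  rw [hform, wedgePow_add_wedgeBilin, hpull, hpull, hZ, hvol, pullFst_smul, hsum]
  -- The normalisation 2 in `hab` matches the factor 2 in `d(xᵢ dxⱼ - xⱼ dxᵢ)`.
  have hcoef : ((k : ℝ) + 1) * a ^ k * b * (k ! : ℝ) = 2 := by
    rw [← hab, hfac]; ring
  -- Tangentially to the sphere all `dXᵢ ∧ dXⱼ` are multiples of `ε₁ ∧ ε₂`; the cyclic coefficients
  -- form the vector `e × f = A`.
  have hdd : ∀ i j, ∀ γ : (E × E') [⋀^Fin (2 * k)]→L[ℝ] ℝ,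
      dX i ⋏ dX j ⋏ γ = (e i * f j - e j * f i) • (ε₁ ⋏ ε₂ ⋏ γ) := by
    intro i j γ
    rw [hz i, hz j]
    simp only [add_wedgeOne, smul_wedgeOne, wedgeOne_add, wedgeOne_smul, wedgeOne_wedgeOne_self]
    rw [wedgeOne_anticomm ε₂ ε₁]
    module
  have f0 := congrFun hfe 0
  have f1 := congrFun hfe 1
  have f2 := congrFun hfe 2
  simp only [cross_apply, Matrix.cons_val] at f0 f1 f2
  -- The mixed terms are rewritten without the frame. On A^⊥ the last summand of Φ drops out,
  -- leaving the antisymmetric terms `T(A × v)` and the symmetric ones `vT(A) + AT(v)`.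
  have hmix : ε₁ ⋏ pullFst E' (ν.curryLeft (Φ e)) + ε₂ ⋏ pullFst E' (ν.curryLeft (Φ f))
      = -((A 1 • dX 2 - A 2 • dX 1) ⋏ pullFst E' (ν.curryLeft (T 0))
          + (A 2 • dX 0 - A 0 • dX 2) ⋏ pullFst E' (ν.curryLeft (T 1))
          + (A 0 • dX 1 - A 1 • dX 0) ⋏ pullFst E' (ν.curryLeft (T 2)))
        - ∑ i, ∑ j, (A i • dX j + A j • dX i) ⋏
            pullFst E' (ν.curryLeft ((![I₁, I₂, I₃] : Fin 3 → E →L[ℝ] E) i (T j))) := by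
    have hneg : ∀ α : E [⋀^Fin (2 * k + 1)]→L[ℝ] ℝ, pullFst E' (-α) = -pullFst E' α :=
      fun _ => rfl
    rw [hΦ]
    simp only [twistVector, hAe, hAf, hz, Fin.sum_univ_three, Matrix.cons_val, combine,
      quatAct_apply, cross_apply, map_add, map_smul, map_neg, mul_zero, zero_smul,
      add_zero, sub_eq_add_neg, neg_add]
    clear_value ε₁ ε₂ f
    simp only [add_wedgeOne, neg_wedgeOne, smul_wedgeOne, wedgeOne_add, wedgeOne_smul,
      wedgeOne_neg, pullFst_add, pullFst_smul, hneg]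
    module
  rw [hdd, hdd, hdd, f0, f1, f2]
  simp only [pullFst_add, pullFst_smul, wedgeOne_add, wedgeOne_smul, smul_wedgeOne]
  have : ∀ (x₀ x₁ x₂ y z w m n : (E × E') [⋀^Fin (2 * k + 1 + 1)]→L[ℝ] ℝ) (F G : ℝ),
      y + z = -m - n →
      a ^ (k + 1) • F • w + (((k : ℝ) + 1) * a ^ k * b) • (k ! : ℝ) • (A 0 • x₀ + A 1 • x₁ + A 2 • x₂
        + (2⁻¹ : ℝ) • y + (2⁻¹ : ℝ) • z + (4⁻¹ * G) • w)
      = (F * a ^ (k + 1) + 4⁻¹ * (2 * G)) • w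
        + (2 : ℝ) • (A 0 • x₀ + A 1 • x₁ + A 2 • x₂) - m - n := by
    intro x₀ x₁ x₂ y z w m n F G hyz
    have hn : n = -m - (y + z) := by rw [hyz]; abel
    rw [smul_smul _ (k ! : ℝ), hcoef, hn]
    module
  exact this _ _ _ _ _ _ _ _ _ _ hmix

end Product

end TwistorAlgebra

/-! ### Tensor fields in charts and their smoothness. -/

section ChartExpressions

variable {F : Type*} [NormedAddCommGroup F] [NormedSpace ℝ F]
  {H : Type*} [TopologicalSpace H] (I : ModelWithCorners ℝ F H)
  {X : Type*} [TopologicalSpace X] [ChartedSpace H X]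

/-- The differential at `y` of the inverse of the chart at `x₀`. -/
def chartFrame (x₀ : X) (y : F) : F →L[ℝ] F :=
  mfderivWithin 𝓘(ℝ, F) I (extChartAt I x₀).symm (range I) y

/-- The differential of the chart at `x₀`, at the point with coordinates `y`. -/
def chartCoframe (x₀ : X) (y : F) : F →L[ℝ] F :=
  mfderiv I 𝓘(ℝ, F) (extChartAt I x₀) ((extChartAt I x₀).symm y)

/-- The coordinate expression of a differential form. -/
def chartForm {k : ℕ} (α : Π x : X, TangentSpace I x [⋀^Fin k]→L[ℝ] ℝ) (x₀ : X) (y : F) :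
    F [⋀^Fin k]→L[ℝ] ℝ :=
  ContinuousAlternatingMap.compContinuousLinearMap (M := F) (M' := F)
    (α ((extChartAt I x₀).symm y)) (chartFrame I x₀ y)

/-- The coordinate expression of a field of endomorphisms of the tangent bundle. -/
def chartEnd (J : Π x : X, TangentSpace I x →L[ℝ] TangentSpace I x) (x₀ : X) (y : F) :
    F →L[ℝ] F :=
  (chartCoframe I x₀ y).comp
    (ContinuousLinearMap.comp (M₁ := F) (M₂ := F) (M₃ := F)
      (J ((extChartAt I x₀).symm y)) (chartFrame I x₀ y))

/-- The coordinate expression of a field of bilinear forms on the tangent bundle. -/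
def chartBilin (B : Π x : X, TangentSpace I x →L[ℝ] TangentSpace I x →L[ℝ] ℝ) (x₀ : X) (y : F) :
    F →L[ℝ] F →L[ℝ] ℝ :=
  ContinuousLinearMap.bilinearComp (E := F) (F := F) (B ((extChartAt I x₀).symm y))
    (chartFrame I x₀ y) (chartFrame I x₀ y)

theorem chartBilin_apply (B : Π x : X, TangentSpace I x →L[ℝ] TangentSpace I x →L[ℝ] ℝ) (x₀ : X)
    (y u v : F) :
    chartBilin I B x₀ y u v
      = B ((extChartAt I x₀).symm y) (chartFrame I x₀ y u) (chartFrame I x₀ y v) :=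
  rfl

theorem chartForm_apply {k : ℕ} (α : Π x : X, TangentSpace I x [⋀^Fin k]→L[ℝ] ℝ) (x₀ : X) (y : F)
    (v : Fin k → F) :
    chartForm I α x₀ y v = α ((extChartAt I x₀).symm y) (fun i => chartFrame I x₀ y (v i)) :=
  rfl

variable [IsManifold I ∞ X]

theorem chartCoframe_chartFrame {x₀ : X} {y : F} (hy : y ∈ (extChartAt I x₀).target) (v : F) :
    chartCoframe I x₀ y (chartFrame I x₀ y v) = v := by
  have : IsManifold I 1 X := .of_le (n := ∞) (by simp)
  exact DFunLike.congr_fun (mfderiv_extChartAt_comp_mfderivWithin_extChartAt_symm (I := I) hy) v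

theorem chartFrame_chartCoframe {x₀ : X} {y : F} (hy : y ∈ (extChartAt I x₀).target) (v : F) :
    chartFrame I x₀ y (chartCoframe I x₀ y v) = v := by
  have : IsManifold I 1 X := .of_le (n := ∞) (by simp)
  exact DFunLike.congr_fun (mfderivWithin_extChartAt_symm_comp_mfderiv_extChartAt (I := I) hy) v

theorem contMDiffOn_source_iff [I.Boundaryless] {G : Type*} [NormedAddCommGroup G] [NormedSpace ℝ G]
    (x₀ : X) {f : X → G} {f' : F → G}
    (h : ∀ x ∈ (chartAt H x₀).source, f x = f' (extChartAt I x₀ x)) :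
    ContMDiffOn I 𝓘(ℝ, G) ∞ f (chartAt H x₀).source ↔
      ContDiffOn ℝ ∞ f' (extChartAt I x₀).target := by
  constructor
  · intro hf
    rw [← contMDiffOn_iff_contDiffOn]
    have := hf.comp (contMDiffOn_extChartAt_symm (I := I) (n := ∞) x₀)
      (fun y hy => by simpa using (extChartAt I x₀).map_target hy)
    refine this.congr fun y hy => ?_
    have hy' := (extChartAt I x₀).map_target hy
    rw [extChartAt_source] at hy'
    simp only [Function.comp]
    rw [h _ hy', (extChartAt I x₀).right_inv hy]
  · intro hf
    rw [← contMDiffOn_iff_contDiffOn] at hf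
    have := hf.comp (contMDiffOn_extChartAt (I := I) (n := ∞) (x := x₀))
      (fun y hy => by
        rw [← extChartAt_source I] at hy
        exact (extChartAt I x₀).map_source hy)
    exact this.congr fun y hy => h y hy

omit [IsManifold I ∞ X] in
theorem contMDiff_iff_forall_source {N : Type*} [TopologicalSpace N] {H' : Type*}
    [TopologicalSpace H'] [ChartedSpace H' N] {F' : Type*} [NormedAddCommGroup F']
    [NormedSpace ℝ F'] {I' : ModelWithCorners ℝ F' H'} (f : X → N) :
    ContMDiff I I' ∞ f ↔ ∀ x₀ : X, ContMDiffOn I I' ∞ f (chartAt H x₀).source :=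
  ⟨fun h _ => h.contMDiffOn, fun h x₀ => (h x₀).contMDiffAt (chart_source_mem_nhds H x₀)⟩

/-- Smoothness of a bundle section becomes smoothness of a map between normed spaces on each chart
target, the form used in all computations below. -/
theorem contMDiff_end_iff [I.Boundaryless] (J : Π x : X, TangentSpace I x →L[ℝ] TangentSpace I x) :
    ContMDiff I (I.prod 𝓘(ℝ, F →L[ℝ] F)) ∞ (fun x => TotalSpace.mk' (F →L[ℝ] F)
      (E := fun x : X => TangentSpace I x →L[ℝ] TangentSpace I x) x (J x)) ↔
    ∀ x₀ : X, ContDiffOn ℝ ∞ (chartEnd I J x₀) (extChartAt I x₀).target := by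
  have : IsManifold I 1 X := .of_le (n := ∞) (by simp)
  rw [contMDiff_iff_forall_source]
  refine forall_congr' fun x₀ => ?_
  rw [← show (trivializationAt (F →L[ℝ] F)
      (fun x : X => TangentSpace I x →L[ℝ] TangentSpace I x) x₀).baseSet = (chartAt H x₀).source by
    simp, Bundle.Trivialization.contMDiffOn_section_baseSet_iff, show (trivializationAt (F →L[ℝ] F)
      (fun x : X => TangentSpace I x →L[ℝ] TangentSpace I x) x₀).baseSet = (chartAt H x₀).source by
    simp]
  refine contMDiffOn_source_iff I x₀ fun x hx => ?_
  rw [hom_trivializationAt_apply]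
  simp only [ContinuousLinearMap.inCoordinates]
  rw [TangentBundle.continuousLinearMapAt_trivializationAt hx,
    TangentBundle.symmL_trivializationAt hx]
  have hx' : x ∈ (extChartAt I x₀).source := by simpa using hx
  ext v
  simp only [chartEnd, chartCoframe, chartFrame]
  rw [(extChartAt I x₀).left_inv hx']
  rfl

set_option synthInstance.maxHeartbeats 400000 in
theorem contMDiffOn_bilin_iff [I.Boundaryless]
    (B : Π x : X, TangentSpace I x →L[ℝ] TangentSpace I x →L[ℝ] ℝ) (x₀ : X) :
    ContMDiffOn I (I.prod 𝓘(ℝ, F →L[ℝ] F →L[ℝ] ℝ)) ∞ (fun x => TotalSpace.mk' (F →L[ℝ] F →L[ℝ] ℝ)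
      (E := fun x : X => TangentSpace I x →L[ℝ] TangentSpace I x →L[ℝ] ℝ) x (B x))
      (chartAt H x₀).source ↔
    ContDiffOn ℝ ∞ (chartBilin I B x₀) (extChartAt I x₀).target := by
  have : IsManifold I 1 X := .of_le (n := ∞) (by simp)
  have hb : (trivializationAt (F →L[ℝ] F →L[ℝ] ℝ)
      (fun x : X => TangentSpace I x →L[ℝ] TangentSpace I x →L[ℝ] ℝ) x₀).baseSet
        = (chartAt H x₀).source := by simp
  rw [← hb, Bundle.Trivialization.contMDiffOn_section_baseSet_iff, hb]
  refine contMDiffOn_source_iff I x₀ fun x hx => ?_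
  have hx' : x ∈ (extChartAt I x₀).source := by simpa using hx
  rw [hom_trivializationAt_apply]
  ext u v
  rw [inCoordinates_apply_eq₂ (by simpa using hx) (by simpa using hx) (by simp)]
  have := TangentBundle.symmL_trivializationAt (I := I) hx
  rw [chartBilin_apply]
  simp only [chartFrame]
  rw [(extChartAt I x₀).left_inv hx', ← this]
  have hs : ∀ v, Trivialization.symmL ℝ (trivializationAt F (TangentSpace I) x₀) x v
      = (trivializationAt F (TangentSpace I) x₀).symm x v := fun v =>
    Trivialization.symmL_apply _ (by simpa using hx) v
  change _ = B x (Trivialization.symmL ℝ (trivializationAt F (TangentSpace I) x₀) x u)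
    (Trivialization.symmL ℝ (trivializationAt F (TangentSpace I) x₀) x v)
  rw [hs, hs]
  simp

theorem contMDiff_bilin_iff [I.Boundaryless]
    (B : Π x : X, TangentSpace I x →L[ℝ] TangentSpace I x →L[ℝ] ℝ) :
    ContMDiff I (I.prod 𝓘(ℝ, F →L[ℝ] F →L[ℝ] ℝ)) ∞ (fun x => TotalSpace.mk' (F →L[ℝ] F →L[ℝ] ℝ)
      (E := fun x : X => TangentSpace I x →L[ℝ] TangentSpace I x →L[ℝ] ℝ) x (B x)) ↔
    ∀ x₀ : X, ContDiffOn ℝ ∞ (chartBilin I B x₀) (extChartAt I x₀).target :=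
  (contMDiff_iff_forall_source I _).trans (forall_congr' fun x₀ => contMDiffOn_bilin_iff I B x₀)

end ChartExpressions

/-! ### Smoothness and exterior derivatives of forms on vector spaces. -/

section ExteriorCalculus

open ContinuousAlternatingMap (alternatizeUncurryFin alternatizeUncurryFinCLM curryLeft_apply_apply)

variable {V : Type*} [NormedAddCommGroup V] [NormedSpace ℝ V]
  {W : Type*} [NormedAddCommGroup W] [NormedSpace ℝ W] {n : ℕ∞ω} {s : Set W} {k : ℕ}

theorem contDiff_wedgeOneL : ContDiff ℝ n (wedgeOneL V k) := by
  fun_prop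

theorem contDiff_curryLeft :
    ContDiff ℝ n (fun α : V [⋀^Fin (k + 1)]→L[ℝ] ℝ => α.curryLeft) := by
  have := ContinuousLinearMap.contDiff (𝕜 := ℝ) (n := n) (E := V [⋀^Fin (k + 1)]→L[ℝ] ℝ)
    (F := V →L[ℝ] V [⋀^Fin k]→L[ℝ] ℝ) (ContinuousAlternatingMap.curryLeftLI (𝕜 := ℝ) (E := V)
      (F := ℝ) (n := k)).toContinuousLinearMap
  exact this

theorem ContDiffOn.wedgeOne {ξ : W → V →L[ℝ] ℝ} {α : W → V [⋀^Fin k]→L[ℝ] ℝ}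
    (hξ : ContDiffOn ℝ n ξ s) (hα : ContDiffOn ℝ n α s) :
    ContDiffOn ℝ n (fun y => ξ y ⋏ α y) s :=
  have h : ContDiffOn ℝ n (fun y => wedgeOneL V k (ξ y)) s :=
    contDiff_wedgeOneL.comp_contDiffOn hξ
  h.clm_apply hα

theorem ContDiffOn.curryLeft {α : W → V [⋀^Fin (k + 1)]→L[ℝ] ℝ} {T : W → V}
    (hα : ContDiffOn ℝ n α s) (hT : ContDiffOn ℝ n T s) :
    ContDiffOn ℝ n (fun y => (α y).curryLeft (T y)) s :=
  have h : ContDiffOn ℝ n (fun y => (α y).curryLeft) s :=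
    contDiff_curryLeft.comp_contDiffOn hα
  h.clm_apply hT

theorem ContDiffOn.alternating_apply {α : W → V [⋀^Fin k]→L[ℝ] ℝ} {v : W → Fin k → V}
    (hα : ContDiffOn ℝ n α s) (hv : ∀ i, ContDiffOn ℝ n (fun y => v y i) s) :
    ContDiffOn ℝ n (fun y => α y (v y)) s := by
  induction k with
  | zero =>
    have h : (fun y => α y (v y)) = fun y =>
        ContinuousAlternatingMap.apply ℝ V ℝ (0 : Fin 0 → V) (α y) := by
      funext y; simp [Subsingleton.elim (v y) 0]
    rw [h]
    exact (ContinuousLinearMap.contDiff _).comp_contDiffOn hα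
  | succ k ih =>
    have := ih (hα.curryLeft (hv 0)) (v := fun y i => v y i.succ) fun i => hv i.succ
    refine this.congr fun y _ => ?_
    rw [curryLeft_apply_apply]
    congr 1
    exact (Fin.cons_self_tail (v y)).symm

/-- Induction on the degree through `(k+1) α = ∑ eⁱ ∧ ι_{eᵢ} α`, which rebuilds a form from its
contractions. -/
theorem contDiffOn_of_forall_apply [FiniteDimensional ℝ V] {α : W → V [⋀^Fin k]→L[ℝ] ℝ}
    (h : ∀ v, ContDiffOn ℝ n (fun y => α y v) s) : ContDiffOn ℝ n α s := by
  induction k with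
  | zero =>
    have e : α = fun y => (ContinuousAlternatingMap.constOfIsEmptyLIE ℝ V ℝ (Fin 0)
        ).toContinuousLinearEquiv.toContinuousLinearMap (α y 0) := by
      funext y; ext v; simp [Subsingleton.elim v 0]
    rw [e]
    exact (ContinuousLinearMap.contDiff _).comp_contDiffOn (h 0)
  | succ k ih =>
    have e : α = fun y => ((k : ℝ) + 1)⁻¹ • ∑ i, coordL (Module.finBasis ℝ V) i ⋏
        ((α y).curryLeft (Module.finBasis ℝ V i)) := by
      funext y
      rw [sum_coordL_wedgeOne_curryLeft, smul_smul, inv_mul_cancel₀ (by positivity), one_smul]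
    rw [e]
    refine ContDiffOn.const_smul _ (ContDiffOn.sum fun i _ =>
      contDiffOn_const.wedgeOne (ih fun v => ?_))
    exact h _

theorem ContDiffOn.wedgePow [FiniteDimensional ℝ V] {B : W → V →L[ℝ] V →L[ℝ] ℝ}
    (hB : ContDiffOn ℝ n B s) (k : ℕ) : ContDiffOn ℝ n (fun y => wedgePow (B y) k) s := by
  refine contDiffOn_of_forall_apply fun v => ?_
  simp only [wedgePow_apply]
  refine contDiffOn_const.mul (ContDiffOn.sum fun σ _ => ?_)
  simp only [Units.smul_def]
  simp only [zsmul_eq_mul]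
  refine contDiffOn_const.mul ?_
  exact contDiffOn_prod fun i _ => (hB.clm_apply contDiffOn_const).clm_apply contDiffOn_const

theorem ContDiffOn.extDeriv {t : Set V} (ht : IsOpen t) {α : V → V [⋀^Fin k]→L[ℝ] ℝ}
    (hα : ContDiffOn ℝ ∞ α t) : ContDiffOn ℝ ∞ (extDeriv α) t :=
  (alternatizeUncurryFinCLM ℝ V ℝ).contDiff.comp_contDiffOn
    (hα.fderiv_of_isOpen ht (by simp))

theorem extDeriv_smul_function {f : V → ℝ} {α : V → V [⋀^Fin k]→L[ℝ] ℝ} {y : V}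
    (hf : DifferentiableAt ℝ f y) (hα : DifferentiableAt ℝ α y) :
    extDeriv (fun y => f y • α y) y = fderiv ℝ f y ⋏ α y + f y • extDeriv α y := by
  simp only [extDeriv, fderiv_fun_smul hf hα, wedgeOne_eq,
    ContinuousAlternatingMap.alternatizeUncurryFin_add,
    ContinuousAlternatingMap.alternatizeUncurryFin_smul]
  exact add_comm _ _

theorem minSmoothness_two_le_infty : minSmoothness ℝ 2 ≤ (∞ : ℕ∞ω) := by
  rw [minSmoothness_of_isRCLikeNormedField]
  exact WithTop.coe_le_coe.2 (OrderTop.le_top (2 : ℕ∞))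

/-- Obtained from `d(d(fα)) = 0` by the Leibniz rule for `fα`, applied once near the point and once
at it. -/
theorem extDeriv_fderiv_wedgeOne {f : V → ℝ} {α : V → V [⋀^Fin k]→L[ℝ] ℝ} {y : V}
    (hf : ContDiffAt ℝ ∞ f y) (hα : ContDiffAt ℝ ∞ α y) :
    extDeriv (fun y => fderiv ℝ f y ⋏ α y) y = -(fderiv ℝ f y ⋏ extDeriv α y) := by
  have h1 : ∀ᶠ z in nhds y, extDeriv (fun y => f y • α y) z
      = fderiv ℝ f z ⋏ α z + f z • extDeriv α z := by
    filter_upwards [(hf.of_le (m := 1) (by simp)).eventually (by simp),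
      (hα.of_le (m := 1) (by simp)).eventually (by simp)] with z hz hz'
    exact extDeriv_smul_function (hz.differentiableAt (by simp)) (hz'.differentiableAt (by simp))
  have hdf : ContDiffAt ℝ ∞ (fderiv ℝ f) y := hf.fderiv_right (by simp)
  have hdα : ContDiffAt ℝ ∞ (extDeriv α) y :=
    (alternatizeUncurryFinCLM ℝ V ℝ).contDiff.contDiffAt.comp y (hα.fderiv_right (by simp))
  have hL : ContDiffAt ℝ ∞ (fun y => wedgeOneL V k (fderiv ℝ f y)) y :=
    contDiff_wedgeOneL.contDiffAt.comp y hdf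
  have hw : ContDiffAt ℝ ∞ (fun y => fderiv ℝ f y ⋏ α y) y := hL.clm_apply hα
  have h2 := Filter.EventuallyEq.extDeriv_eq h1
  have h3 : extDeriv (extDeriv fun y => f y • α y) y = 0 :=
    extDeriv_extDeriv_apply (r := ∞) (hf.smul hα) minSmoothness_two_le_infty
  have h3' : extDeriv (fun z => extDeriv (fun y => f y • α y) z) y = 0 := h3
  rw [h2, extDeriv_fun_add (hw.differentiableAt (by simp))
    (show DifferentiableAt ℝ (fun y => f y • extDeriv α y) y from
      (hf.smul hdα).differentiableAt (by simp)),
    extDeriv_smul_function (hf.differentiableAt (by simp)) (hdα.differentiableAt (by simp))] at h3'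
  have h4 : extDeriv (extDeriv α) y = 0 :=
    extDeriv_extDeriv_apply (r := ∞) hα minSmoothness_two_le_infty
  rw [h4, smul_zero, add_zero] at h3'
  exact eq_neg_of_add_eq_zero_left h3'

theorem extDeriv_pullFst {α : V → V [⋀^Fin k]→L[ℝ] ℝ} {p : V × W}
    (hα : DifferentiableAt ℝ α p.1) :
    extDeriv (fun p : V × W => pullFst W (α p.1)) p = pullFst W (extDeriv α p.1) := by
  have : extDeriv (fun p : V × W => (α (Prod.fst p)).compContinuousLinearMap
      (fderiv ℝ (Prod.fst : V × W → V) p)) p = (extDeriv α (Prod.fst p)).compContinuousLinearMap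
      (fderiv ℝ (Prod.fst : V × W → V) p) :=
    extDeriv_pullback (r := ∞) hα contDiffAt_fst minSmoothness_two_le_infty
  simp only [fderiv_fst] at this
  exact this

theorem ContDiffOn.pullFst {α : V → V [⋀^Fin k]→L[ℝ] ℝ} {t : Set V} {t' : Set W}
    (hα : ContDiffOn ℝ n α t) :
    ContDiffOn ℝ n (fun p : V × W => pullFst W (α p.1)) (t ×ˢ t') := by
  have h : ContDiffOn ℝ n (fun p : V × W => α p.1) (t ×ˢ t') :=
    hα.comp contDiffOn_fst fun p hp => hp.1
  exact (ContinuousAlternatingMap.compContinuousLinearMapCLM (𝕜 := ℝ) (F := ℝ) (ι := Fin k)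
    (ContinuousLinearMap.fst ℝ V W)).contDiff.comp_contDiffOn h

end ExteriorCalculus

/-! ### Vectors as contractions of a volume form. -/

section ContractInverse

variable {V : Type*} [NormedAddCommGroup V] [NormedSpace ℝ V] [FiniteDimensional ℝ V] {m : ℕ}
  (b : Module.Basis (Fin (m + 1)) ℝ V)

/-- The vector whose contraction with the volume form `ν` is `τ`. -/
def contractInv (ν : V [⋀^Fin (m + 1)]→L[ℝ] ℝ) (τ : V [⋀^Fin m]→L[ℝ] ℝ) : V :=
  ∑ i, ((coordL b i ⋏ τ) b / ν b) • b i

include b in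
theorem wedgeOne_curryLeft_of_basis (ν : V [⋀^Fin (m + 1)]→L[ℝ] ℝ) (ξ : V →L[ℝ] ℝ) (T : V) :
    ξ ⋏ ν.curryLeft T = ξ T • ν := by
  have hd : Module.finrank ℝ V < m + 2 := by simp [Module.finrank_eq_card_basis b]
  have := curryLeft_wedgeOne T ξ ν
  rw [eq_zero_of_finrank_lt hd (ξ ⋏ ν)] at this
  have h0 : (0 : V [⋀^Fin (m + 2)]→L[ℝ] ℝ).curryLeft T = 0 := rfl
  rw [h0] at this
  exact (sub_eq_zero.1 this.symm).symm

omit [FiniteDimensional ℝ V] in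
theorem apply_basis_ne_zero {ν : V [⋀^Fin (m + 1)]→L[ℝ] ℝ} (hν : ν ≠ 0) : ν b ≠ 0 := by
  intro h
  apply hν
  ext v
  have := congrArg (fun δ => δ v) (ν.toAlternatingMap.eq_smul_basis_det b)
  simpa [h] using this

/-- In codimension one a form is determined by its products with covectors, and `ξ ∧ ι_T ν = ξ(T)
ν`. The coordinate formula for T makes its smooth dependence on ν and τ visible. -/
theorem curryLeft_contractInv {ν : V [⋀^Fin (m + 1)]→L[ℝ] ℝ} (hν : ν ≠ 0)
    (τ : V [⋀^Fin m]→L[ℝ] ℝ) : ν.curryLeft (contractInv b ν τ) = τ := by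
  have hb := apply_basis_ne_zero b hν
  have hd : Module.finrank ℝ V = m + 1 := by simp [Module.finrank_eq_card_basis b]
  rw [← sub_eq_zero]
  refine eq_zero_of_wedgeOne_eq_zero (by omega) _ fun ξ => ?_
  rw [wedgeOne_sub, wedgeOne_curryLeft_of_basis b]
  obtain ⟨c, hc⟩ := exists_eq_smul_of_ne_zero hd (ξ ⋏ τ) ν hν
  have : ξ (contractInv b ν τ) * ν b = (ξ ⋏ τ) b := by
    conv_rhs => rw [← sum_apply_smul_coordL b ξ, sum_wedgeOne]
    simp only [contractInv, map_sum, map_smul, smul_eq_mul, Finset.sum_mul,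
      ContinuousAlternatingMap.sum_apply, smul_wedgeOne, ContinuousAlternatingMap.smul_apply]
    refine Finset.sum_congr rfl fun i _ => ?_
    field_simp
  rw [hc] at this ⊢
  rw [ContinuousAlternatingMap.smul_apply, smul_eq_mul] at this
  rw [mul_right_cancel₀ hb this, sub_self]

theorem contractInv_curryLeft {ν : V [⋀^Fin (m + 1)]→L[ℝ] ℝ} (hν : ν ≠ 0) (T : V) :
    contractInv b ν (ν.curryLeft T) = T := by
  have hb := apply_basis_ne_zero b hν
  rw [contractInv]
  conv_rhs => rw [← sum_coordL_smul b T]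
  refine Finset.sum_congr rfl fun i _ => ?_
  rw [wedgeOne_curryLeft_of_basis b, ContinuousAlternatingMap.smul_apply, smul_eq_mul,
    mul_div_cancel_right₀ _ hb]

theorem ContDiffOn.contractInv {W : Type*} [NormedAddCommGroup W] [NormedSpace ℝ W] {n : ℕ∞ω}
    {s : Set W} {ν : W → V [⋀^Fin (m + 1)]→L[ℝ] ℝ} {τ : W → V [⋀^Fin m]→L[ℝ] ℝ}
    (hν : ContDiffOn ℝ n ν s) (hτ : ContDiffOn ℝ n τ s) (h0 : ∀ y ∈ s, ν y ≠ 0) :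
    ContDiffOn ℝ n (fun y => contractInv b (ν y) (τ y)) s := by
  refine ContDiffOn.sum fun i _ => (ContDiffOn.div ?_ ?_ fun y hy => apply_basis_ne_zero b (h0 y hy)
    ).smul contDiffOn_const
  · exact (contDiffOn_const.wedgeOne hτ).alternating_apply fun i => contDiffOn_const
  · exact hν.alternating_apply fun i => contDiffOn_const

omit [FiniteDimensional ℝ V] in
theorem compContinuousLinearMap_curryLeft {V' : Type*} [NormedAddCommGroup V'] [NormedSpace ℝ V']
    (ν : V [⋀^Fin (m + 1)]→L[ℝ] ℝ) (D : V' →L[ℝ] V) (T : V') :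
    (ν.compContinuousLinearMap D).curryLeft T = (ν.curryLeft (D T)).compContinuousLinearMap D := by
  ext v
  simp only [ContinuousAlternatingMap.curryLeft_apply_apply,
    ContinuousAlternatingMap.compContinuousLinearMap_apply]
  congr 1
  funext i
  refine Fin.cases ?_ (fun j => ?_) i <;> simp

end ContractInverse

/-! ### Exterior derivatives of forms on manifolds. -/

section ManifoldForms

variable {F : Type*} [NormedAddCommGroup F] [NormedSpace ℝ F]
  {H : Type*} [TopologicalSpace H] (I : ModelWithCorners ℝ F H)
  {X : Type*} [TopologicalSpace X] [ChartedSpace H X]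

/-- A differential form is smooth if its coordinate expressions are. -/
def IsSmoothForm {k : ℕ} (α : Π x : X, TangentSpace I x [⋀^Fin k]→L[ℝ] ℝ) : Prop :=
  ∀ x₀ : X, ContDiffOn ℝ ∞ (chartForm I α x₀) (extChartAt I x₀).target

/-- The exterior derivative of a differential form, computed at each point in the chart there. -/
def mextDeriv {k : ℕ} (α : Π x : X, TangentSpace I x [⋀^Fin k]→L[ℝ] ℝ) (x : X) :
    TangentSpace I x [⋀^Fin (k + 1)]→L[ℝ] ℝ :=
  extDeriv (E := F) (chartForm I α x) (extChartAt I x x)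

theorem isClosedForm_of_chartForm [I.Boundaryless] {k : ℕ}
    {α : Π x : X, TangentSpace I x [⋀^Fin k]→L[ℝ] ℝ}
    (h : ∀ x₀ : X, ∀ y ∈ (extChartAt I x₀).target, extDeriv (chartForm I α x₀) y = 0) :
    IsClosedForm I α := by
  intro x₀ y hy
  have := h x₀ y hy
  rw [← extDerivWithin_univ] at this
  have hr : range I = univ := I.range_eq_univ
  have h2 : (fun y : F =>
      ((α ((extChartAt I x₀).symm y)).compContinuousLinearMap
        (mfderivWithin 𝓘(ℝ, F) I (extChartAt I x₀).symm (range I) y) :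
          F [⋀^Fin k]→L[ℝ] ℝ)) = chartForm I α x₀ := rfl
  rw [h2, hr]
  exact this

variable [IsManifold I ∞ X]

/-- The tangent space at x is identified with the model space by the chart at x, so that chart has
the identity as its differential at x. -/
theorem chartCoframe_self (x : X) (v : F) : chartCoframe I x (extChartAt I x x) v = v := by
  have : IsManifold I 1 X := .of_le (n := ∞) (by simp)
  have h := mdifferentiableAt_extChartAt (I := I) (mem_chart_source H x)
  have h1 : chartCoframe I x (extChartAt I x x) = ContinuousLinearMap.id ℝ F := by
    rw [chartCoframe, extChartAt_to_inv x]
    refine h.mfderiv.trans ?_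
    exact fderivWithin_extChartAt_comp_extChartAt_symm_range (I := I)
  rw [h1]; rfl

theorem chartFrame_self (x : X) (v : F) : chartFrame I x (extChartAt I x x) v = v := by
  have := chartCoframe_chartFrame I (mem_extChartAt_target (I := I) x) v
  rwa [chartCoframe_self] at this

variable [I.Boundaryless]

omit [IsManifold I ∞ X] in
theorem eventually_chart_change {x₀ x : X} {y : F} (hy : y ∈ (extChartAt I x₀).target)
    (hx : (extChartAt I x₀).symm y ∈ (extChartAt I x).source) :
    ∀ᶠ z in nhds y, z ∈ (extChartAt I x₀).target ∧
      (extChartAt I x₀).symm z ∈ (extChartAt I x).source := by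
  have h1 := (isOpen_extChartAt_target (I := I) x₀).mem_nhds hy
  have h2 : (extChartAt I x₀).symm ⁻¹' (extChartAt I x).source ∈ nhds y :=
    (continuousAt_extChartAt_symm'' hy).preimage_mem_nhds
      ((isOpen_extChartAt_source x).mem_nhds hx)
  exact (Filter.eventually_of_mem h1 fun _ h => h).and (Filter.eventually_of_mem h2 fun _ h => h)

theorem contDiffAt_chart_change {x₀ x : X} {y : F} (hy : y ∈ (extChartAt I x₀).target)
    (hx : (extChartAt I x₀).symm y ∈ (extChartAt I x).source) :
    ContDiffAt ℝ ∞ (fun z => extChartAt I x ((extChartAt I x₀).symm z)) y := by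
  rw [← contMDiffAt_iff_contDiffAt]
  have h1 : ContMDiffAt I 𝓘(ℝ, F) ∞ (extChartAt I x) ((extChartAt I x₀).symm y) :=
    contMDiffAt_extChartAt' (by simpa using hx)
  have h2 : ContMDiffAt 𝓘(ℝ, F) I ∞ (extChartAt I x₀).symm y :=
    (contMDiffOn_extChartAt_symm (I := I) (n := ∞) x₀).contMDiffAt
      ((isOpen_extChartAt_target (I := I) x₀).mem_nhds hy)
  exact h1.comp y h2

theorem chartFrame_comp_fderiv {x₀ x : X} {y : F} (hy : y ∈ (extChartAt I x₀).target)
    (hx : (extChartAt I x₀).symm y ∈ (extChartAt I x).source) :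
    (chartFrame I x (extChartAt I x ((extChartAt I x₀).symm y))).comp
      (fderiv ℝ (fun z => extChartAt I x ((extChartAt I x₀).symm z)) y) = chartFrame I x₀ y := by
  have : IsManifold I 1 X := .of_le (n := ∞) (by simp)
  have hr : range I = univ := I.range_eq_univ
  simp only [chartFrame, hr, mfderivWithin_univ]
  have h1 : MDifferentiableAt 𝓘(ℝ, F) I (extChartAt I x).symm
      (extChartAt I x ((extChartAt I x₀).symm y)) := by
    have := mdifferentiableWithinAt_extChartAt_symm (I := I) ((extChartAt I x).map_source hx)
    rwa [hr, mdifferentiableWithinAt_univ] at this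
  have h2 : MDifferentiableAt 𝓘(ℝ, F) 𝓘(ℝ, F)
      (fun z => extChartAt I x ((extChartAt I x₀).symm z)) y :=
    ((contDiffAt_chart_change I hy hx).differentiableAt (by simp)).mdifferentiableAt
  have h3 := mfderiv_comp y h1 h2
  rw [mfderiv_eq_fderiv] at h3
  have h4 : (extChartAt I x).symm ∘ (fun z => extChartAt I x ((extChartAt I x₀).symm z))
      =ᶠ[nhds y] (extChartAt I x₀).symm := by
    filter_upwards [eventually_chart_change I hy hx] with z hz
    exact (extChartAt I x).left_inv hz.2
  rw [h4.mfderiv_eq] at h3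
  exact h3.symm

theorem chartForm_eq_pullback {k : ℕ} (α : Π x : X, TangentSpace I x [⋀^Fin k]→L[ℝ] ℝ)
    {x₀ x : X} {y : F} (hy : y ∈ (extChartAt I x₀).target)
    (hx : (extChartAt I x₀).symm y ∈ (extChartAt I x).source) :
    chartForm I α x₀ y = (chartForm I α x (extChartAt I x ((extChartAt I x₀).symm y))
      ).compContinuousLinearMap
        (fderiv ℝ (fun z => extChartAt I x ((extChartAt I x₀).symm z)) y) := by
  ext v
  rw [ContinuousAlternatingMap.compContinuousLinearMap_apply, chartForm_apply, chartForm_apply,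
    (extChartAt I x).left_inv hx, ← chartFrame_comp_fderiv I hy hx]
  rfl

/-- The derivative taken pointwise in varying charts agrees with the one in any fixed chart, because
d commutes with pullback along the chart change. -/
theorem chartForm_mextDeriv {k : ℕ} {α : Π x : X, TangentSpace I x [⋀^Fin k]→L[ℝ] ℝ}
    (hα : IsSmoothForm I α) {x₀ : X} {y : F} (hy : y ∈ (extChartAt I x₀).target) :
    chartForm I (mextDeriv I α) x₀ y = extDeriv (chartForm I α x₀) y := by
  set x := (extChartAt I x₀).symm y with hxdef
  have hx : (extChartAt I x₀).symm y ∈ (extChartAt I x).source := mem_extChartAt_source x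
  have h1 : extDeriv (chartForm I α x₀) y = (extDeriv (chartForm I α x) (extChartAt I x x)
      ).compContinuousLinearMap
        (fderiv ℝ (fun z => extChartAt I x ((extChartAt I x₀).symm z)) y) := by
    have h2 : chartForm I α x₀ =ᶠ[nhds y] fun z => (chartForm I α x
        (extChartAt I x ((extChartAt I x₀).symm z))).compContinuousLinearMap
          (fderiv ℝ (fun z => extChartAt I x ((extChartAt I x₀).symm z)) z) := by
      filter_upwards [eventually_chart_change I hy hx] with z hz
      exact chartForm_eq_pullback I α hz.1 hz.2
    rw [h2.extDeriv_eq]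
    refine extDeriv_pullback (r := ∞) ?_ (contDiffAt_chart_change I hy hx)
      minSmoothness_two_le_infty
    exact ((hα x).contDiffAt ((isOpen_extChartAt_target (I := I) x).mem_nhds
      (mem_extChartAt_target x))).differentiableAt (by simp)
  have h3 : chartFrame I x₀ y
      = fderiv ℝ (fun z => extChartAt I x ((extChartAt I x₀).symm z)) y := by
    rw [← chartFrame_comp_fderiv I hy hx]
    ext v : 1
    exact chartFrame_self I x _
  rw [h1, ← h3]
  rfl

theorem IsSmoothForm.mextDeriv {k : ℕ} {α : Π x : X, TangentSpace I x [⋀^Fin k]→L[ℝ] ℝ}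
    (hα : IsSmoothForm I α) : IsSmoothForm I (mextDeriv I α) := fun x₀ =>
  ((hα x₀).extDeriv (isOpen_extChartAt_target (I := I) x₀)).congr fun _ hy =>
    chartForm_mextDeriv I hα hy

end ManifoldForms

/-! ### Existence of hyperhermitian metrics. -/

section HyperhermitianMetrics

/-- The quadratic form has a positive minimum on the compact unit sphere. The bound is required in
the definition of a Riemannian metric on a bundle. -/
theorem isVonNBounded_of_pos {F : Type*} [NormedAddCommGroup F] [NormedSpace ℝ F]
    [FiniteDimensional ℝ F] (B : F →L[ℝ] F →L[ℝ] ℝ) (hB : ∀ v, v ≠ 0 → 0 < B v v) :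
    Bornology.IsVonNBounded ℝ {v : F | B v v < 1} := by
  rw [NormedSpace.isVonNBounded_iff]
  rcases subsingleton_or_nontrivial F with h | h
  · exact (Set.toFinite _).isBounded
  have : ProperSpace F := FiniteDimensional.proper ℝ F
  obtain ⟨v₀, hv₀, hmin⟩ := (isCompact_sphere (0 : F) 1).exists_isMinOn
    (NormedSpace.sphere_nonempty.2 zero_le_one)
    (f := fun v => B v v) (Continuous.continuousOn (by fun_prop))
  have hv₀' : v₀ ≠ 0 := by
    rintro rfl
    simp at hv₀
  have hc := hB v₀ hv₀'
  set c := B v₀ v₀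
  refine (isBounded_iff_forall_norm_le).2 ⟨Real.sqrt (1 / c), fun v hv => ?_⟩
  refine Real.le_sqrt_of_sq_le ?_
  rw [le_div_iff₀ hc]
  rcases eq_or_ne v 0 with rfl | hv0
  · simp
  have hn : ‖v‖ ≠ 0 := norm_ne_zero_iff.2 hv0
  have h1 := isMinOn_iff.1 hmin (‖v‖⁻¹ • v) (by simp [norm_smul, hn])
  simp only [map_smul, smul_apply, smul_eq_mul] at h1
  have h2 : B v v < 1 := hv
  have h3 : ‖v‖ ^ 2 * c ≤ ‖v‖ ^ 2 * (‖v‖⁻¹ * (‖v‖⁻¹ * B v v)) := by gcongr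
  have h4 : ‖v‖ ^ 2 * (‖v‖⁻¹ * (‖v‖⁻¹ * B v v)) = B v v := by field_simp
  linarith

variable {F : Type*} [NormedAddCommGroup F] [InnerProductSpace ℝ F] [FiniteDimensional ℝ F]
  {H : Type*} [TopologicalSpace H] {I : ModelWithCorners ℝ F H}
  {X : Type*} [TopologicalSpace X] [ChartedSpace H X]

theorem ContDiffOn.bilinearComp {F W : Type*} [NormedAddCommGroup F] [NormedSpace ℝ F]
    [FiniteDimensional ℝ F] [NormedAddCommGroup W] [NormedSpace ℝ W] {n : ℕ∞ω} {s : Set W}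
    {B : W → F →L[ℝ] F →L[ℝ] ℝ} {L L' : W → F →L[ℝ] F} (hB : ContDiffOn ℝ n B s)
    (hL : ContDiffOn ℝ n L s) (hL' : ContDiffOn ℝ n L' s) :
    ContDiffOn ℝ n (fun y => (B y).bilinearComp (L y) (L' y)) s := by
  rw [contDiffOn_clm_apply]
  intro u
  rw [contDiffOn_clm_apply]
  intro v
  exact (hB.clm_apply (hL.clm_apply contDiffOn_const)).clm_apply (hL'.clm_apply contDiffOn_const)

/-- A smooth metric, from a field of inner products whose coordinate expressions are smooth. -/
def SmoothMetric.ofChart {F : Type*} [NormedAddCommGroup F] [NormedSpace ℝ F]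
    [FiniteDimensional ℝ F] {I : ModelWithCorners ℝ F H} [I.Boundaryless] [IsManifold I ∞ X]
    (B : Π x : X, TangentSpace I x →L[ℝ] TangentSpace I x →L[ℝ] ℝ)
    (symm : ∀ x u v, B x u v = B x v u) (pos : ∀ x v, v ≠ 0 → 0 < B x v v)
    (smooth : ∀ x₀ : X, ContDiffOn ℝ ∞ (chartBilin I B x₀) (extChartAt I x₀).target) :
    SmoothMetric I X where
  inner := B
  symm := symm
  pos := pos
  isVonNBounded x := isVonNBounded_of_pos (F := F) (B x) (pos x)
  contMDiff := (contMDiff_bilin_iff I B).2 smooth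

/-- The inner products for which three endomorphisms are isometries. -/
def invariantInners {F : Type*} [NormedAddCommGroup F] [NormedSpace ℝ F] (I₁ I₂ I₃ : F →L[ℝ] F) :
    Set (F →L[ℝ] F →L[ℝ] ℝ) :=
  {B | (∀ u v, B u v = B v u) ∧ (∀ v, v ≠ 0 → 0 < B v v) ∧ (∀ u v, B (I₁ u) (I₁ v) = B u v) ∧
    (∀ u v, B (I₂ u) (I₂ v) = B u v) ∧ (∀ u v, B (I₃ u) (I₃ v) = B u v)}

theorem convex_invariantInners {F : Type*} [NormedAddCommGroup F] [NormedSpace ℝ F]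
    (I₁ I₂ I₃ : F →L[ℝ] F) : Convex ℝ (invariantInners I₁ I₂ I₃) := by
  have happ : ∀ (B C : F →L[ℝ] F →L[ℝ] ℝ) (a b : ℝ) u v,
      (a • B + b • C) u v = a * B u v + b * C u v := fun _ _ _ _ _ _ => rfl
  rintro B ⟨b1, b2, b3, b4, b5⟩ C ⟨c1, c2, c3, c4, c5⟩ p q hp hq hpq
  refine ⟨fun u v => by rw [happ, happ, b1, c1], fun v hv => ?_, fun u v => by
    rw [happ, happ, b3, c3], fun u v => by rw [happ, happ, b4, c4], fun u v => by
    rw [happ, happ, b5, c5]⟩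
  rw [happ]
  have h1 := b2 v hv
  have h2 := c2 v hv
  rcases hp.eq_or_lt with rfl | hp
  · have : q = 1 := by linarith
    subst this; simpa using h2
  · have := mul_pos hp h1
    have := mul_nonneg hq h2.le
    linarith

/-- The average over the quaternion units of the pull back of the inner product by `D`. -/
def averagedInner (I₁ I₂ I₃ D : F →L[ℝ] F) : F →L[ℝ] F →L[ℝ] ℝ :=
  (innerSL ℝ).bilinearComp D D + (innerSL ℝ).bilinearComp (D.comp I₁) (D.comp I₁)
    + (innerSL ℝ).bilinearComp (D.comp I₂) (D.comp I₂)
    + (innerSL ℝ).bilinearComp (D.comp I₃) (D.comp I₃)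

omit [FiniteDimensional ℝ F] in
theorem averagedInner_apply (I₁ I₂ I₃ D : F →L[ℝ] F) (u v : F) :
    averagedInner I₁ I₂ I₃ D u v = inner ℝ (D u) (D v) + inner ℝ (D (I₁ u)) (D (I₁ v))
      + inner ℝ (D (I₂ u)) (D (I₂ v)) + inner ℝ (D (I₃ u)) (D (I₃ v)) := rfl

-- With D the differential of a chart and f that of its inverse, the coordinate expression depends
-- only on the coordinate expressions of the three structures, hence is smooth.
omit [FiniteDimensional ℝ F] in
theorem averagedInner_bilinearComp (I₁ I₂ I₃ D f : F →L[ℝ] F) (h : ∀ v, D (f v) = v) :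
    (averagedInner I₁ I₂ I₃ D).bilinearComp f f
      = averagedInner (D.comp (I₁.comp f)) (D.comp (I₂.comp f)) (D.comp (I₃.comp f))
        (ContinuousLinearMap.id ℝ F) := by
  ext u v
  simp [averagedInner_apply, h]

theorem ContDiffOn.averagedInner {W : Type*} [NormedAddCommGroup W] [NormedSpace ℝ W] {s : Set W}
    {n : ℕ∞ω} {I₁ I₂ I₃ : W → F →L[ℝ] F} (h1 : ContDiffOn ℝ n I₁ s) (h2 : ContDiffOn ℝ n I₂ s)
    (h3 : ContDiffOn ℝ n I₃ s) :
    ContDiffOn ℝ n (fun y => averagedInner (I₁ y) (I₂ y) (I₃ y) (ContinuousLinearMap.id ℝ F)) s := by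
  have hc : ContDiffOn ℝ n (fun _ : W => innerSL ℝ (E := F)) s := contDiffOn_const
  have hi : ContDiffOn ℝ n (fun _ : W => ContinuousLinearMap.id ℝ F) s := contDiffOn_const
  exact (((hc.bilinearComp hi hi).add (hc.bilinearComp h1 h1)).add (hc.bilinearComp h2 h2)).add
    (hc.bilinearComp h3 h3)

-- Right multiplication by a quaternion unit permutes the four summands up to signs, which the inner
-- product does not see.
omit [FiniteDimensional ℝ F] in
theorem averagedInner_mem {I₁ I₂ I₃ D : F →L[ℝ] F} (h11 : ∀ v, I₁ (I₁ v) = -v)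
    (h22 : ∀ v, I₂ (I₂ v) = -v) (h12 : ∀ v, I₁ (I₂ v) = I₃ v) (h21 : ∀ v, I₂ (I₁ v) = -I₃ v)
    (hD : Function.Injective D) : averagedInner I₁ I₂ I₃ D ∈ invariantInners I₁ I₂ I₃ := by
  have h13 : ∀ v, I₁ (I₃ v) = -I₂ v := fun v => by rw [← h12, h11]
  have h23 : ∀ v, I₂ (I₃ v) = I₁ v := fun v => by
    rw [← neg_eq_iff_eq_neg.2 (h21 v), map_neg, h22, neg_neg]
  have h31 : ∀ v, I₃ (I₁ v) = I₂ v := fun v => by rw [← h12, h21, map_neg, h13, neg_neg]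
  have h32 : ∀ v, I₃ (I₂ v) = -I₁ v := fun v => by rw [← h12, h22, map_neg]
  have h33 : ∀ v, I₃ (I₃ v) = -v := fun v => by rw [← h12, h23, h11]
  refine ⟨fun u v => ?_, fun v hv => ?_, fun u v => ?_, fun u v => ?_, fun u v => ?_⟩
  · simp only [averagedInner_apply, real_inner_comm]
  · rw [averagedInner_apply]
    have h0 : (0 : ℝ) < inner ℝ (D v) (D v) :=
      real_inner_self_pos.2 fun h0 => hv (hD (by simpa using h0))
    have h1 : (0 : ℝ) ≤ inner ℝ (D (I₁ v)) (D (I₁ v)) := real_inner_self_nonneg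
    have h2 : (0 : ℝ) ≤ inner ℝ (D (I₂ v)) (D (I₂ v)) := real_inner_self_nonneg
    have h3 : (0 : ℝ) ≤ inner ℝ (D (I₃ v)) (D (I₃ v)) := real_inner_self_nonneg
    linarith
  · simp only [averagedInner_apply, h11, h21, h31, map_neg, inner_neg_neg]
    ring
  · simp only [averagedInner_apply, h12, h22, h32, map_neg, inner_neg_neg]
    ring
  · simp only [averagedInner_apply, h13, h23, h33, map_neg, inner_neg_neg]
    ring

variable [IsManifold I ∞ X] [I.Boundaryless]

theorem mfderiv_extChartAt_injective {F : Type*} [NormedAddCommGroup F] [NormedSpace ℝ F]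
    {I : ModelWithCorners ℝ F H} [IsManifold I ∞ X] {x₀ x : X}
    (hx : x ∈ (chartAt H x₀).source) :
    Function.Injective (mfderiv I 𝓘(ℝ, F) (extChartAt I x₀) x) := by
  have : IsManifold I 1 X := .of_le (n := ∞) (by simp)
  exact (isInvertible_mfderiv_extChartAt (I := I) (by simpa using hx)).injective

theorem IsHypercomplex.contDiffOn_averagedInner
    {I₁ I₂ I₃ : Π x : X, TangentSpace I x →L[ℝ] TangentSpace I x}
    (h : IsHypercomplex I₁ I₂ I₃) (x₀ : X) :
    ContDiffOn ℝ ∞ (chartBilin I (fun x => averagedInner (F := F) (I₁ x) (I₂ x) (I₃ x)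
      (mfderiv I 𝓘(ℝ, F) (extChartAt I x₀) x)) x₀) (extChartAt I x₀).target := by
  have h1 := (contMDiff_end_iff I I₁).1 h.fst.smooth x₀
  have h2 := (contMDiff_end_iff I I₂).1 h.snd.smooth x₀
  have h3 := (contMDiff_end_iff I I₃).1 h.trd.smooth x₀
  refine (ContDiffOn.averagedInner h1 h2 h3).congr fun y hy => ?_
  exact averagedInner_bilinearComp _ _ _ _ _ (chartCoframe_chartFrame I hy)

variable [T2Space X] [SigmaCompactSpace X]

-- Chartwise averages give local sections of a convex condition; a partition of unity glues them.
set_option synthInstance.maxHeartbeats 400000 in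
set_option maxHeartbeats 2000000 in
theorem IsHypercomplex.exists_contMDiff_mem_invariantInners
    {I₁ I₂ I₃ : Π x : X, TangentSpace I x →L[ℝ] TangentSpace I x}
    (h : IsHypercomplex I₁ I₂ I₃) :
    ∃ B : Π x : X, TangentSpace I x →L[ℝ] TangentSpace I x →L[ℝ] ℝ,
      (∀ x₀ : X, ContDiffOn ℝ ∞ (chartBilin I B x₀) (extChartAt I x₀).target) ∧
      ∀ x, B x ∈ invariantInners (F := F) (I₁ x) (I₂ x) (I₃ x) := by
  have hloc : ∀ x₀ : X, ∃ U ∈ nhds x₀,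
      ∃ s : Π x : X, TangentSpace I x →L[ℝ] TangentSpace I x →L[ℝ] ℝ,
      ContMDiffOn I (I.prod 𝓘(ℝ, F →L[ℝ] F →L[ℝ] ℝ)) ∞ (fun x => TotalSpace.mk'
        (F →L[ℝ] F →L[ℝ] ℝ) (E := fun x : X => TangentSpace I x →L[ℝ] TangentSpace I x →L[ℝ] ℝ)
        x (s x)) U ∧ ∀ y ∈ U, s y ∈ invariantInners (F := F) (I₁ y) (I₂ y) (I₃ y) := fun x₀ =>
    ⟨(chartAt H x₀).source, chart_source_mem_nhds H x₀, _,
      (contMDiffOn_bilin_iff I _ x₀).2 (h.contDiffOn_averagedInner x₀), fun x hx =>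
        averagedInner_mem (F := F) (h.fst.sq x) (h.snd.sq x) (h.mul x) (h.anti x)
          (mfderiv_extChartAt_injective hx)⟩
  have hconv : ∀ x : X, ∀ B ∈ invariantInners (F := F) (I₁ x) (I₂ x) (I₃ x),
      ∀ C ∈ invariantInners (F := F) (I₁ x) (I₂ x) (I₃ x), ∀ a b : ℝ, 0 ≤ a → 0 ≤ b → a + b = 1 →
        a • B + b • C ∈ invariantInners (F := F) (I₁ x) (I₂ x) (I₃ x) :=
    fun x B hB C hC a b ha hb hab =>
      convex_invariantInners (F := F) (I₁ x) (I₂ x) (I₃ x) hB hC ha hb hab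
  obtain ⟨s, hs⟩ := exists_contMDiffSection_forall_mem_convex_of_local (n := (⊤ : ℕ∞)) I
    (F_fiber := F →L[ℝ] F →L[ℝ] ℝ)
    (fun x : X => TangentSpace I x →L[ℝ] TangentSpace I x →L[ℝ] ℝ)
    (fun x => invariantInners (F := F) (I₁ x) (I₂ x) (I₃ x))
    (fun x B hB C hC a b ha hb hab => hconv x B hB C hC a b ha hb hab) hloc
  exact ⟨fun x => s x, (contMDiff_bilin_iff I _).1 s.contMDiff, hs⟩

theorem IsHypercomplex.exists_isHyperhermitian
    {I₁ I₂ I₃ : Π x : X, TangentSpace I x →L[ℝ] TangentSpace I x}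
    (h : IsHypercomplex I₁ I₂ I₃) : ∃ g : SmoothMetric I X, IsHyperhermitian I₁ I₂ I₃ g := by
  obtain ⟨B, hB, hs⟩ := h.exists_contMDiff_mem_invariantInners
  exact ⟨SmoothMetric.ofChart B (fun x => (hs x).1) (fun x => (hs x).2.1) hB,
    fun x => (hs x).2.2.1, fun x => (hs x).2.2.2.1, fun x => (hs x).2.2.2.2⟩

end HyperhermitianMetrics

/-! ### The Nijenhuis tensor on a vector space. -/

section LocalNijenhuis

variable {E : Type*} [NormedAddCommGroup E] [NormedSpace ℝ E]

/-- The Nijenhuis expression of an endomorphism `j` with derivative `a`. -/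
def nijenhuisAlg (j : E →L[ℝ] E) (a : E →L[ℝ] E →L[ℝ] E) (u w : E) : E :=
  a (j u) w - a (j w) u + j (a w u) - j (a u w)

/-- The Nijenhuis tensor of a field of endomorphisms of a vector space. -/
def localNijenhuis (J : E → E →L[ℝ] E) (y u w : E) : E :=
  nijenhuisAlg (J y) (fderiv ℝ J y) u w

/-- The derivatives of U and W cancel by `J² = -1`, leaving an expression tensorial in U and W. -/
theorem localNijenhuis_eq_lieBracket {J : E → E →L[ℝ] E} {U W : E → E} {y : E}
    (hJ : DifferentiableAt ℝ J y) (hU : DifferentiableAt ℝ U y) (hW : DifferentiableAt ℝ W y)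
    (hJ2 : ∀ v, J y (J y v) = -v) :
    lieBracket ℝ (fun z => J z (U z)) (fun z => J z (W z)) y
      - J y (lieBracket ℝ (fun z => J z (U z)) W y) - J y (lieBracket ℝ U (fun z => J z (W z)) y)
      - lieBracket ℝ U W y = localNijenhuis J y (U y) (W y) := by
  have h1 : ∀ {V : E → E}, DifferentiableAt ℝ V y → ∀ v, fderiv ℝ (fun z => J z (V z)) y v
      = J y (fderiv ℝ V y v) + fderiv ℝ J y v (V y) := fun hV v => by
    rw [fderiv_clm_apply hJ hV]; rfl
  simp only [lieBracket, h1 hU, h1 hW, localNijenhuis, nijenhuisAlg, map_sub, map_add, hJ2]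
  abel

theorem nijenhuisAlg_apply_self {j : E →L[ℝ] E} {a : E →L[ℝ] E →L[ℝ] E} (hj : ∀ v, j (j v) = -v)
    (ha : ∀ ξ v, a ξ (j v) = -j (a ξ v)) (u : E) : nijenhuisAlg j a u (j u) = 0 := by
  simp only [nijenhuisAlg, ha, hj, map_neg, neg_apply]
  abel

/-- In real dimension two u and `ju` form a basis, and the expression vanishes at (u, u) and at (u,
ju). -/
theorem nijenhuisAlg_eq_zero_of_finrank_eq_two {j : E →L[ℝ] E} {a : E →L[ℝ] E →L[ℝ] E}
    (hE : Module.finrank ℝ E = 2) (hj : ∀ v, j (j v) = -v)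
    (ha : ∀ ξ v, a ξ (j v) = -j (a ξ v)) (u w : E) : nijenhuisAlg j a u w = 0 := by
  rcases eq_or_ne u 0 with rfl | hu
  · simp [nijenhuisAlg]
  have hli : LinearIndependent ℝ ![u, j u] := by
    rw [LinearIndependent.pair_iff]
    intro s t hst
    have h2 : s • j u - t • u = 0 := by
      have := congrArg j hst
      simpa [hj, sub_eq_add_neg] using this
    have h3 : (s ^ 2 + t ^ 2) • u = 0 := by
      have : s • (s • u + t • j u) - t • (s • j u - t • u) = 0 := by rw [hst, h2]; simp
      rw [← this]; module
    have h4 := (smul_eq_zero.1 h3).resolve_right hu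
    constructor <;> nlinarith [sq_nonneg s, sq_nonneg t]
  have hspan := hli.span_eq_top_of_card_eq_finrank (by simp [hE])
  have hw : w ∈ Submodule.span ℝ (Set.range ![u, j u]) := by rw [hspan]; trivial
  simp only [Matrix.range_cons, Matrix.range_empty, Set.union_empty, Set.singleton_union] at hw
  obtain ⟨s, t, rfl⟩ := Submodule.mem_span_pair.1 hw
  have h1 := nijenhuisAlg_apply_self hj ha u
  have h2 : nijenhuisAlg j a u (s • u + t • j u)
      = s • nijenhuisAlg j a u u + t • nijenhuisAlg j a u (j u) := by
    simp only [nijenhuisAlg, map_add, map_smul, add_apply, smul_apply]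
    module
  have h3 : nijenhuisAlg j a u u = 0 := by simp [nijenhuisAlg]
  rw [h2, h1, h3, smul_zero, smul_zero, add_zero]

/-- The polarization of the Nijenhuis expression vanishes on anticommuting complex structures with
vanishing Nijenhuis expression. -/
theorem nijenhuisAlg_mixed_eq_zero {i j : E →L[ℝ] E} {a b : E →L[ℝ] E →L[ℝ] E}
    (hi : ∀ v, i (i v) = -v) (hj : ∀ v, j (j v) = -v) (hij : ∀ v, j (i v) = -i (j v))
    (ha : ∀ ξ v, a ξ (i v) = -i (a ξ v)) (hb : ∀ ξ v, b ξ (j v) = -j (b ξ v))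
    (hab : ∀ ξ v, b ξ (i v) = -j (a ξ v) - a ξ (j v) - i (b ξ v))
    (hNi : ∀ u w, nijenhuisAlg i a u w = 0) (hNj : ∀ u w, nijenhuisAlg j b u w = 0) (u w : E) :
    (a (j u) w - a (j w) u + j (a w u) - j (a u w))
      + (b (i u) w - b (i w) u + i (b w u) - i (b u w)) = 0 := by
  -- The two vanishing expressions are evaluated at four pairs each, obtained from (u, w) by
  -- applying i and j. After the commutation rules, half of their signed sum is the mixed
  -- expression.
  have e1 := hNi u (i (j w))
  have e2 := hNi (j u) (i w)
  have e3 := congrArg j (hNi u (i w))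
  have e4 := congrArg j (hNi (j u) (i (j w)))
  have f1 := hNj u (i (j w))
  have f2 := hNj (i u) (j w)
  have f3 := congrArg i (hNj u (j w))
  have f4 := congrArg i (hNj (i u) (i (j w)))
  simp only [nijenhuisAlg, hi, hj, hij, ha, hb, hab, map_neg, map_add, map_sub, neg_apply, neg_neg,
    map_zero] at e1 e2 e3 e4 f1 f2 f3 f4
  linear_combination (norm := module) (-1 / 2 : ℝ) • e1 - (1 / 2 : ℝ) • e2 + (1 / 2 : ℝ) • e3
    - (1 / 2 : ℝ) • e4 + (1 / 2 : ℝ) • f1 - (1 / 2 : ℝ) • f2 + (1 / 2 : ℝ) • f3 + (1 / 2 : ℝ) • f4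

end LocalNijenhuis

/-! ### Integrability of almost complex structures in charts. -/

section ChartNijenhuis

variable {F : Type*} [NormedAddCommGroup F] [NormedSpace ℝ F]
  {H : Type*} [TopologicalSpace H] (I : ModelWithCorners ℝ F H)
  {X : Type*} [TopologicalSpace X] [ChartedSpace H X]

/-- The coordinate expression of a vector field. -/
def chartVector (U : Π x : X, TangentSpace I x) (x₀ : X) (y : F) : F :=
  chartCoframe I x₀ y (U ((extChartAt I x₀).symm y))

variable [IsManifold I ∞ X] [I.Boundaryless]

omit [I.Boundaryless] in
theorem inverse_chartFrame {x₀ : X} {y : F} (hy : y ∈ (extChartAt I x₀).target) :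
    (chartFrame I x₀ y).inverse = chartCoframe I x₀ y :=
  ContinuousLinearMap.inverse_eq (ContinuousLinearMap.ext fun v => chartFrame_chartCoframe I hy v)
    (ContinuousLinearMap.ext fun v => chartCoframe_chartFrame I hy v)

theorem mlieBracket_eq_lieBracket (U W : Π x : X, TangentSpace I x) (x : X) :
    mlieBracket I U W x
      = lieBracket ℝ (chartVector I U x) (chartVector I W x) (extChartAt I x x) := by
  have hr : range I = univ := I.range_eq_univ
  have hV : ∀ V : Π x : X, TangentSpace I x,
      (mpullbackWithin 𝓘(ℝ, F) I (extChartAt I x).symm V (range I) : F → F)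
        =ᶠ[nhds (extChartAt I x x)] chartVector I V x := fun V => by
    filter_upwards [(isOpen_extChartAt_target (I := I) x).mem_nhds (mem_extChartAt_target x)]
      with y hy
    exact congrFun (congrArg DFunLike.coe (inverse_chartFrame I hy)) _
  have h1 : mlieBracket I U W x = (mfderiv I 𝓘(ℝ, F) (extChartAt I x) x).inverse
      (lieBracketWithin ℝ (E := F) (mpullbackWithin 𝓘(ℝ, F) I (extChartAt I x).symm U (range I) : F → F)
        (mpullbackWithin 𝓘(ℝ, F) I (extChartAt I x).symm W (range I) : F → F)
        ((extChartAt I x).symm ⁻¹' univ ∩ range I) (extChartAt I x x)) := rfl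
  have h2 : (extChartAt I x).symm ⁻¹' univ ∩ range I = univ := by simp [hr]
  have hlie : ∀ A B : F → F, A =ᶠ[nhds (extChartAt I x x)] chartVector I U x →
      B =ᶠ[nhds (extChartAt I x x)] chartVector I W x →
      lieBracketWithin ℝ A B ((extChartAt I x).symm ⁻¹' univ ∩ range I) (extChartAt I x x)
        = lieBracket ℝ (chartVector I U x) (chartVector I W x) (extChartAt I x x) :=
    fun A B hA hB => by rw [h2, lieBracketWithin_univ, hA.lieBracket_vectorField_eq hB]
  have h3 : (mfderiv I 𝓘(ℝ, F) (extChartAt I x) x : F →L[ℝ] F) = ContinuousLinearMap.id ℝ F := by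
    ext v
    have := chartCoframe_self I x v
    rw [chartCoframe, extChartAt_to_inv x] at this
    exact this
  have h4 := (congrArg ContinuousLinearMap.inverse h3).trans
    (ContinuousLinearMap.inverse_id (R := ℝ) (M := F))
  exact h1.trans ((congrFun (congrArg DFunLike.coe h4) _).trans (hlie _ _ (hV U) (hV W)))

theorem contMDiffAt_vectorField_iff (U : Π x : X, TangentSpace I x) (x : X) :
    ContMDiffAt I I.tangent ∞ (fun y => (⟨y, U y⟩ : TangentBundle I X)) x ↔
      ContDiffAt ℝ ∞ (chartVector I U x) (extChartAt I x x) := by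
  have : IsManifold I 1 X := .of_le (n := ∞) (by simp)
  have h1 := contMDiffAt_section (IB := I) (F := F) (n := ∞) (s := U) x
  refine h1.trans ?_
  have h2 : (fun z => (trivializationAt F (TangentSpace I) x ⟨z, U z⟩).2)
      =ᶠ[nhds x] fun z => chartVector I U x (extChartAt I x z) := by
    filter_upwards [chart_source_mem_nhds H x] with z hz
    have hz' : z ∈ (extChartAt I x).source := by simpa using hz
    have h3 := TangentBundle.continuousLinearMapAt_trivializationAt (I := I) hz
    have h4 : (trivializationAt F (TangentSpace I) x ⟨z, U z⟩).2
        = (trivializationAt F (TangentSpace I) x).continuousLinearMapAt ℝ z (U z) := by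
      rw [Trivialization.continuousLinearMapAt_apply, Trivialization.linearMapAt_apply,
        if_pos (by simpa using hz)]
    rw [h4, h3, chartVector, chartCoframe]
    rw [(extChartAt I x).left_inv hz']
    rfl
  rw [Filter.EventuallyEq.contMDiffAt_iff h2]
  constructor
  · intro h
    rw [← contMDiffAt_iff_contDiffAt]
    have h5 : ContMDiffAt 𝓘(ℝ, F) I ∞ (extChartAt I x).symm (extChartAt I x x) :=
      (contMDiffOn_extChartAt_symm (I := I) (n := ∞) x).contMDiffAt
        ((isOpen_extChartAt_target (I := I) x).mem_nhds (mem_extChartAt_target x))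
    have h6 := h.comp_of_eq h5 (extChartAt_to_inv x)
    refine h6.congr_of_eventuallyEq ?_
    filter_upwards [(isOpen_extChartAt_target (I := I) x).mem_nhds (mem_extChartAt_target x)]
      with y hy
    simp only [Function.comp, (extChartAt I x).right_inv hy]
  · intro h
    rw [← contMDiffAt_iff_contDiffAt] at h
    exact h.comp x contMDiffAt_extChartAt

omit [I.Boundaryless] in
theorem chartEnd_self (J : Π x : X, TangentSpace I x →L[ℝ] TangentSpace I x) (x : X) :
    chartEnd I J x (extChartAt I x x) = J x := by
  ext v
  have h : ∀ x', x' = x → ∀ w : F, (J x' w : F) = J x w := by rintro x' rfl w; rfl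
  exact (chartCoframe_self I x _).trans ((congrArg (J _) (chartFrame_self I x v)).trans
    (h _ (extChartAt_to_inv x) v))

theorem nijenhuis_eq_localNijenhuis {J : Π x : X, TangentSpace I x →L[ℝ] TangentSpace I x}
    {U W : Π x : X, TangentSpace I x} {x : X}
    (hJ : DifferentiableAt ℝ (chartEnd I J x) (extChartAt I x x))
    (hU : DifferentiableAt ℝ (chartVector I U x) (extChartAt I x x))
    (hW : DifferentiableAt ℝ (chartVector I W x) (extChartAt I x x))
    (hJ2 : ∀ v, J x (J x v) = -v) :
    nijenhuis I J U W x = localNijenhuis (chartEnd I J x) (extChartAt I x x)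
      (chartVector I U x (extChartAt I x x)) (chartVector I W x (extChartAt I x x)) := by
  rw [← localNijenhuis_eq_lieBracket hJ hU hW (by rw [chartEnd_self]; exact hJ2)]
  have h1 : ∀ V : Π x : X, TangentSpace I x, chartVector I (fun z => J z (V z)) x
      =ᶠ[nhds (extChartAt I x x)] fun y => chartEnd I J x y (chartVector I V x y) := fun V => by
    filter_upwards [(isOpen_extChartAt_target (I := I) x).mem_nhds (mem_extChartAt_target x)]
      with y hy
    exact congrArg (fun w : F => chartCoframe I x y (J ((extChartAt I x).symm y) w))
      (chartFrame_chartCoframe I hy (V ((extChartAt I x).symm y))).symm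
  have hr := fun V : Π x : X, TangentSpace I x => Filter.EventuallyEq.refl
    (nhds (extChartAt I x x)) (chartVector I V x)
  simp only [nijenhuis, mlieBracket_eq_lieBracket]
  rw [(h1 U).lieBracket_vectorField_eq (h1 W), (h1 U).lieBracket_vectorField_eq (hr W),
    (hr U).lieBracket_vectorField_eq (h1 W), chartEnd_self]
  rfl

/-- The vanishing on vector fields is tested on fields constant in the chart. -/
theorem IsComplexStructure.localNijenhuis_eq_zero
    {J : Π x : X, TangentSpace I x →L[ℝ] TangentSpace I x} (hJ : IsComplexStructure I J) (x : X)
    (u w : F) : localNijenhuis (chartEnd I J x) (extChartAt I x x) u w = 0 := by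
  have hmem := (isOpen_extChartAt_target (I := I) x).mem_nhds (mem_extChartAt_target x)
  set C : F → Π x : X, TangentSpace I x := fun u z => chartFrame I x (extChartAt I x z) u
  have hC : ∀ u, chartVector I (C u) x =ᶠ[nhds (extChartAt I x x)] fun _ => u := fun u => by
    filter_upwards [hmem] with y hy
    simp only [chartVector, C]
    rw [(extChartAt I x).right_inv hy]
    exact chartCoframe_chartFrame I hy u
  have hCd : ∀ u, ContDiffAt ℝ ∞ (chartVector I (C u) x) (extChartAt I x x) := fun u =>
    contDiffAt_const.congr_of_eventuallyEq (hC u)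
  have h := nijenhuis_eq_localNijenhuis I (J := J) (U := C u) (W := C w) (x := x)
    ((((contMDiff_end_iff I J).1 hJ.smooth x).contDiffAt hmem).differentiableAt (by simp))
    ((hCd u).differentiableAt (by simp)) ((hCd w).differentiableAt (by simp)) (hJ.sq x)
  rw [(hC u).self_of_nhds, (hC w).self_of_nhds] at h
  rw [← h]
  exact hJ.integrable x _ _ ((contMDiffAt_vectorField_iff I _ x).2 (hCd u))
    ((contMDiffAt_vectorField_iff I _ x).2 (hCd w))

theorem isComplexStructure_of_chart {J : Π x : X, TangentSpace I x →L[ℝ] TangentSpace I x}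
    (hs : ∀ x₀ : X, ContDiffOn ℝ ∞ (chartEnd I J x₀) (extChartAt I x₀).target)
    (hJ2 : ∀ x v, J x (J x v) = -v)
    (hN : ∀ x u w, localNijenhuis (chartEnd I J x) (extChartAt I x x) u w = 0) :
    IsComplexStructure I J where
  smooth := (contMDiff_end_iff I J).2 hs
  sq := hJ2
  integrable x U W hU hW := by
    have hmem := (isOpen_extChartAt_target (I := I) x).mem_nhds (mem_extChartAt_target x)
    rw [nijenhuis_eq_localNijenhuis I (((hs x).contDiffAt hmem).differentiableAt (by simp))
      (((contMDiffAt_vectorField_iff I U x).1 hU).differentiableAt (by simp))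
      (((contMDiffAt_vectorField_iff I W x).1 hW).differentiableAt (by simp)) (hJ2 x)]
    exact hN x _ _

end ChartNijenhuis

/-! ### Differentials of charts on products. -/

section ProductCharts

variable {F : Type*} [NormedAddCommGroup F] [NormedSpace ℝ F]
  {H : Type*} [TopologicalSpace H] (I : ModelWithCorners ℝ F H)
  {X : Type*} [TopologicalSpace X] [ChartedSpace H X] [IsManifold I ∞ X] [I.Boundaryless]
  {F' : Type*} [NormedAddCommGroup F'] [NormedSpace ℝ F']
  {H' : Type*} [TopologicalSpace H'] (I' : ModelWithCorners ℝ F' H')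
  {X' : Type*} [TopologicalSpace X'] [ChartedSpace H' X'] [IsManifold I' ∞ X'] [I'.Boundaryless]

theorem chartFrame_prod {z₀ : X × X'} {p : F × F'} (hp : p ∈ (extChartAt (I.prod I') z₀).target) :
    chartFrame (I.prod I') z₀ p
      = (chartFrame I z₀.1 p.1).prodMap (chartFrame I' z₀.2 p.2) := by
  have : IsManifold I 1 X := .of_le (n := ∞) (by simp)
  have : IsManifold I' 1 X' := .of_le (n := ∞) (by simp)
  rw [extChartAt_prod] at hp
  have hr1 : range I = univ := I.range_eq_univ
  have hr2 : range I' = univ := I'.range_eq_univ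
  have hr : range (I.prod I') = univ := (I.prod I').range_eq_univ
  have h1 := mdifferentiableWithinAt_extChartAt_symm (I := I) (x := z₀.1) hp.1
  have h2 := mdifferentiableWithinAt_extChartAt_symm (I := I') (x := z₀.2) hp.2
  simp only [chartFrame, hr1, hr2, hr, mfderivWithin_univ, mdifferentiableWithinAt_univ] at h1 h2 ⊢
  rw [extChartAt_prod]
  have h3 := (h1.hasMFDerivAt.prodMap h2.hasMFDerivAt).mfderiv
  rw [modelWithCornersSelf_prod, ← chartedSpaceSelf_prod]
  exact h3

theorem chartCoframe_prod {z₀ : X × X'} {p : F × F'}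
    (hp : p ∈ (extChartAt (I.prod I') z₀).target) :
    chartCoframe (I.prod I') z₀ p
      = (chartCoframe I z₀.1 p.1).prodMap (chartCoframe I' z₀.2 p.2) := by
  have hp' := hp
  rw [extChartAt_prod] at hp'
  refine ContinuousLinearMap.ext fun v => ?_
  have h1 := chartFrame_chartCoframe (I.prod I') hp v
  have h2 : chartFrame (I.prod I') z₀ p
      ((chartCoframe I z₀.1 p.1).prodMap (chartCoframe I' z₀.2 p.2) v) = v := by
    rw [chartFrame_prod I I' hp]
    exact Prod.ext (chartFrame_chartCoframe I hp'.1 v.1) (chartFrame_chartCoframe I' hp'.2 v.2)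
  rw [← chartCoframe_chartFrame (I.prod I') hp (chartCoframe (I.prod I') z₀ p v), h1]
  conv_lhs => rw [← h2]
  exact chartCoframe_chartFrame (I.prod I') hp _

end ProductCharts

/-! ### The sphere and its complex structure in charts. -/

section SphereCharts

/-- With `Lᵗ` the transpose of L, injectivity makes `LᵗL` invertible, and `j = (LᵗL)⁻¹ Lᵗ (L j)`. It
is used with L the differential of a parametrisation of the sphere in ℝ³. -/
theorem contDiffOn_of_injective_comp {E E' W : Type*} [NormedAddCommGroup E]
    [InnerProductSpace ℝ E] [FiniteDimensional ℝ E] [NormedAddCommGroup E'] [InnerProductSpace ℝ E']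
    [NormedAddCommGroup W] [NormedSpace ℝ W] {n : ℕ∞ω} {s : Set W} {L : W → E →L[ℝ] E'}
    {j : W → E →L[ℝ] E} (hL : ContDiffOn ℝ n L s) (hinj : ∀ y ∈ s, Function.Injective (L y))
    (hLj : ContDiffOn ℝ n (fun y => (L y).comp (j y)) s) : ContDiffOn ℝ n j s := by
  have : CompleteSpace E := FiniteDimensional.complete ℝ E
  set b := stdOrthonormalBasis ℝ E
  set Lt : W → E' →L[ℝ] E := fun y => ∑ k, (innerSL ℝ (L y (b k))).smulRight (b k)
  have hLt : ContDiffOn ℝ n Lt s := by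
    refine ContDiffOn.sum fun k _ => ?_
    have h1 : ContDiffOn ℝ n (fun y => innerSL ℝ (L y (b k))) s :=
      (innerSL ℝ (E := E')).contDiff.comp_contDiffOn (hL.clm_apply contDiffOn_const)
    exact h1.smulRight contDiffOn_const
  have hG : ContDiffOn ℝ n (fun y => (Lt y).comp (L y)) s := hLt.clm_comp hL
  have hinv : ∀ y ∈ s, ((Lt y).comp (L y)).IsInvertible := by
    intro y hy
    have hi : Function.Injective ((Lt y).comp (L y)).toLinearMap := by
      rw [← LinearMap.ker_eq_bot, LinearMap.ker_eq_bot']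
      intro v hv
      have h1 : ∀ w, inner ℝ ((Lt y).comp (L y) v) w = inner ℝ (L y v) (L y w) := by
        intro w
        have h2 : L y w = ∑ k, inner ℝ (b k) w • L y (b k) := by
          conv_lhs => rw [← b.sum_repr' w]
          simp
        rw [h2]
        simp [Lt, sum_inner, inner_sum, inner_smul_left, inner_smul_right, mul_comm,
          real_inner_comm]
      have h3 := h1 v
      have hv' : (Lt y).comp (L y) v = 0 := hv
      rw [hv', inner_zero_left] at h3
      have h4 : L y v = 0 := inner_self_eq_zero.1 h3.symm
      exact hinj y hy (by rw [h4, map_zero])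
    exact ⟨(LinearEquiv.ofInjectiveEndo _ hi).toContinuousLinearEquiv, by ext v; rfl⟩
  have hGinv : ContDiffOn ℝ n (fun y => ((Lt y).comp (L y)).inverse) s := fun y hy =>
    ContDiffAt.comp_contDiffWithinAt (f := fun y => (Lt y).comp (L y)) y
      (hinv y hy).contDiffAt_map_inverse (hG y hy)
  refine ((hGinv.clm_comp (hLt.clm_comp hLj))).congr fun y hy => ?_
  obtain ⟨e, he⟩ := hinv y hy
  have h5 : (Lt y).comp ((L y).comp (j y)) = ((Lt y).comp (L y)).comp (j y) := rfl
  rw [h5, ← he, ContinuousLinearMap.inverse_equiv]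
  ext v; simp

instance : Fact (Module.finrank ℝ (EuclideanSpace ℝ (Fin 3)) = 2 + 1) := ⟨by simp⟩

/-- The inverse of the chart of the sphere at `A₀`, as a map to `ℝ³`. -/
def sphParam (A₀ : Sph) (s : EuclideanSpace ℝ (Fin 2)) : EuclideanSpace ℝ (Fin 3) :=
  ((extChartAt (𝓡 2) A₀).symm s : Sph)

theorem contDiffOn_sphParam (A₀ : Sph) :
    ContDiffOn ℝ ∞ (sphParam A₀) (extChartAt (𝓡 2) A₀).target := by
  rw [← contMDiffOn_iff_contDiffOn]
  exact (contMDiff_coe_sphere (m := ∞) (n := 2) (E := EuclideanSpace ℝ (Fin 3))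
    ).comp_contMDiffOn (contMDiffOn_extChartAt_symm A₀)

theorem fderiv_sphParam {A₀ : Sph} {s : EuclideanSpace ℝ (Fin 2)}
    (hs : s ∈ (extChartAt (𝓡 2) A₀).target) (v : EuclideanSpace ℝ (Fin 2)) :
    fderiv ℝ (sphParam A₀) s v
      = sphIncl ((extChartAt (𝓡 2) A₀).symm s) (chartFrame (𝓡 2) A₀ s v) := by
  have : IsManifold (𝓡 2) 1 Sph := .of_le (n := ∞) (by simp)
  have h1 := mdifferentiableWithinAt_extChartAt_symm (I := 𝓡 2) (x := A₀) hs
  have hr : range (𝓡 2) = univ := (𝓡 2).range_eq_univ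
  rw [hr, mdifferentiableWithinAt_univ] at h1
  have h2 : MDifferentiableAt (𝓡 2) 𝓘(ℝ, EuclideanSpace ℝ (Fin 3))
      (Subtype.val : Sph → EuclideanSpace ℝ (Fin 3)) ((extChartAt (𝓡 2) A₀).symm s) :=
    (contMDiff_coe_sphere (m := ∞) (n := 2) (E := EuclideanSpace ℝ (Fin 3)) _).mdifferentiableAt
      (by simp)
  have h3 := mfderiv_comp s h2 h1
  have h4 : fderiv ℝ (sphParam A₀) s = mfderiv 𝓘(ℝ, EuclideanSpace ℝ (Fin 2))
      𝓘(ℝ, EuclideanSpace ℝ (Fin 3)) (Subtype.val ∘ (extChartAt (𝓡 2) A₀).symm) s :=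
    (mfderiv_eq_fderiv).symm
  rw [h4, h3]
  simp only [chartFrame, hr, mfderivWithin_univ, sphIncl]
  rfl

theorem sphIncl_sphJ (A : Sph) (v : TangentSpace (𝓡 2) A) :
    sphIncl A (sphJ A v) = crossLeft A (sphIncl A v) := by
  have := LinearEquiv.apply_symm_apply
    (LinearEquiv.ofInjective (sphIncl A).toLinearMap (sphIncl_injective A))
    (LinearMap.codRestrict _ (crossLeft A) (crossLeft_mem_range A) (sphIncl A v))
  exact congrArg Subtype.val this

theorem fderiv_sphParam_injective {A₀ : Sph} {s : EuclideanSpace ℝ (Fin 2)}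
    (hs : s ∈ (extChartAt (𝓡 2) A₀).target) : Function.Injective (fderiv ℝ (sphParam A₀) s) := by
  intro u v huv
  rw [fderiv_sphParam hs, fderiv_sphParam hs] at huv
  have := sphIncl_injective _ huv
  rw [← chartCoframe_chartFrame (𝓡 2) hs u, ← chartCoframe_chartFrame (𝓡 2) hs v]
  exact congrArg _ this

/-- The parametrisation intertwines the complex structure with the cross product. This characterises
the coordinate expression of `sphJ`, and it gives both its smoothness and the relation `dx(jσ) = x ×
dx(σ)`. -/
theorem fderiv_sphParam_chartEnd {A₀ : Sph} {s : EuclideanSpace ℝ (Fin 2)}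
    (hs : s ∈ (extChartAt (𝓡 2) A₀).target) (v : EuclideanSpace ℝ (Fin 2)) :
    fderiv ℝ (sphParam A₀) s (chartEnd (𝓡 2) sphJ A₀ s v)
      = crossLeft (sphParam A₀ s) (fderiv ℝ (sphParam A₀) s v) := by
  rw [fderiv_sphParam hs, fderiv_sphParam hs]
  have h1 : chartFrame (𝓡 2) A₀ s (chartEnd (𝓡 2) sphJ A₀ s v)
      = sphJ ((extChartAt (𝓡 2) A₀).symm s) (chartFrame (𝓡 2) A₀ s v) :=
    chartFrame_chartCoframe (𝓡 2) hs _
  rw [h1]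
  exact sphIncl_sphJ _ _

theorem crossLeft_apply (A v : EuclideanSpace ℝ (Fin 3)) (i : Fin 3) :
    crossLeft A v i = (crossProduct (WithLp.ofLp A) (WithLp.ofLp v)) i := rfl

theorem contDiffOn_chartEnd_sphJ (A₀ : Sph) :
    ContDiffOn ℝ ∞ (chartEnd (𝓡 2) sphJ A₀) (extChartAt (𝓡 2) A₀).target := by
  have hopen := isOpen_extChartAt_target (I := 𝓡 2) A₀
  have hx := contDiffOn_sphParam A₀
  have hL : ContDiffOn ℝ ∞ (fderiv ℝ (sphParam A₀)) (extChartAt (𝓡 2) A₀).target :=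
    hx.fderiv_of_isOpen hopen (by simp)
  refine contDiffOn_of_injective_comp hL (fun s hs => fderiv_sphParam_injective hs) ?_
  rw [contDiffOn_clm_apply]
  intro v
  have h1 : ContDiffOn ℝ ∞ (fun s => crossLeft (sphParam A₀ s) (fderiv ℝ (sphParam A₀) s v))
      (extChartAt (𝓡 2) A₀).target := by
    have hLv : ContDiffOn ℝ ∞ (fun s => fderiv ℝ (sphParam A₀) s v) (extChartAt (𝓡 2) A₀).target :=
      hL.clm_apply contDiffOn_const
    rw [contDiffOn_euclidean] at hx hLv ⊢
    intro i
    simp only [crossLeft_apply, cross_apply]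
    fin_cases i
    · exact ((hx 1).mul (hLv 2)).sub ((hx 2).mul (hLv 1))
    · exact ((hx 2).mul (hLv 0)).sub ((hx 0).mul (hLv 2))
    · exact ((hx 0).mul (hLv 1)).sub ((hx 1).mul (hLv 0))
  exact h1.congr fun s hs => fderiv_sphParam_chartEnd hs v

theorem sphParam_dotProduct_self (A₀ : Sph) (s : EuclideanSpace ℝ (Fin 2)) :
    WithLp.ofLp (sphParam A₀ s) ⬝ᵥ WithLp.ofLp (sphParam A₀ s) = 1 := by
  have h : ‖sphParam A₀ s‖ = 1 := by
    have := ((extChartAt (𝓡 2) A₀).symm s : Sph).2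
    rwa [mem_sphere_zero_iff_norm] at this
  have h2 := EuclideanSpace.real_norm_sq_eq (sphParam A₀ s)
  rw [h, Fin.sum_univ_three] at h2
  rw [dotProduct_fin3]
  linarith

/-- The differentials of the three coordinates of `ℝ³` in the chart of the sphere at `A₀`. -/
def sphCovector (A₀ : Sph) (s : EuclideanSpace ℝ (Fin 2)) (i : Fin 3) :
    EuclideanSpace ℝ (Fin 2) →L[ℝ] ℝ :=
  (EuclideanSpace.proj i).comp (fderiv ℝ (sphParam A₀) s)

theorem hasFDerivAt_sphParam {A₀ : Sph} {s : EuclideanSpace ℝ (Fin 2)}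
    (hs : s ∈ (extChartAt (𝓡 2) A₀).target) (i : Fin 3) :
    HasFDerivAt (fun s => sphParam A₀ s i) (sphCovector A₀ s i) s := by
  have h1 := (((contDiffOn_sphParam A₀).contDiffAt ((isOpen_extChartAt_target (I := 𝓡 2) A₀
    ).mem_nhds hs)).differentiableAt (by simp)).hasFDerivAt
  exact (EuclideanSpace.proj (𝕜 := ℝ) i).hasFDerivAt.comp s h1

/-- The derivative of `|x|² = 1`. -/
theorem combine_sphCovector {A₀ : Sph} {s : EuclideanSpace ℝ (Fin 2)}
    (hs : s ∈ (extChartAt (𝓡 2) A₀).target) :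
    combine (sphCovector A₀ s) (sphParam A₀ s) = 0 := by
  have h := fun i => hasFDerivAt_sphParam hs i
  have h1 := (((h 0).mul (h 0)).add ((h 1).mul (h 1))).add ((h 2).mul (h 2))
  have h2 : (fun s => sphParam A₀ s 0 * sphParam A₀ s 0 + sphParam A₀ s 1 * sphParam A₀ s 1
      + sphParam A₀ s 2 * sphParam A₀ s 2) = fun _ => (1 : ℝ) := by
    funext t
    rw [← dotProduct_fin3, sphParam_dotProduct_self]
  have h3 := h1.congr_of_eventuallyEq (Filter.EventuallyEq.of_eq h2.symm)
  have h4 := h3.unique (hasFDerivAt_const 1 s)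
  have h5 : (2 : ℝ) • combine (sphCovector A₀ s) (sphParam A₀ s) = 0 := by
    rw [← h4, combine]; module
  exact (smul_eq_zero.1 h5).resolve_left (by norm_num)

end SphereCharts

/-! ### Integrability of the twistor structure on a product of vector spaces. -/

section LocalTwistor

open scoped Matrix

variable {E : Type*} [NormedAddCommGroup E] [NormedSpace ℝ E]
  {W : Type*} [NormedAddCommGroup W] [NormedSpace ℝ W]

/-- Differentiating the relation `j i = -k` between fields of endomorphisms. -/
theorem fderiv_apply_of_comp_eq {i j k : E → E →L[ℝ] E} {y : E} (hi : DifferentiableAt ℝ i y)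
    (hj : DifferentiableAt ℝ j y) (h : ∀ᶠ z in nhds y, ∀ v, j z (i z v) = k z v) (ξ v : E) :
    fderiv ℝ j y ξ (i y v) + j y (fderiv ℝ i y ξ v) = fderiv ℝ k y ξ v := by
  have h1 : (fun z => (j z).comp (i z)) =ᶠ[nhds y] k := by
    filter_upwards [h] with z hz
    ext v
    exact hz v
  rw [← h1.fderiv_eq, fderiv_clm_comp hj hi]
  simp [add_comm]

theorem fderiv_apply_of_sq {j : E → E →L[ℝ] E} {y : E} (hj : DifferentiableAt ℝ j y)
    (h : ∀ᶠ z in nhds y, ∀ v, j z (j z v) = -v) (ξ v : E) :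
    fderiv ℝ j y ξ (j y v) = -j y (fderiv ℝ j y ξ v) := by
  have := fderiv_apply_of_comp_eq (k := fun _ => -ContinuousLinearMap.id ℝ E) hj hj
    (by filter_upwards [h] with z hz v; simp [hz]) ξ v
  rw [fderiv_fun_const] at this
  exact eq_neg_of_add_eq_zero_left this

theorem fderiv_apply_of_anticomm {i j : E → E →L[ℝ] E} {y : E} (hi : DifferentiableAt ℝ i y)
    (hj : DifferentiableAt ℝ j y) (h : ∀ᶠ z in nhds y, ∀ v, j z (i z v) = -i z (j z v)) (ξ v : E) :
    fderiv ℝ j y ξ (i y v) = -j y (fderiv ℝ i y ξ v) - fderiv ℝ i y ξ (j y v)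
      - i y (fderiv ℝ j y ξ v) := by
  have h1 := fderiv_apply_of_comp_eq (k := fun z => -(i z).comp (j z)) hi hj
    (by filter_upwards [h] with z hz v; simp [hz]) ξ v
  rw [fderiv_fun_neg, fderiv_clm_comp hi hj] at h1
  simp only [add_apply, neg_apply, ContinuousLinearMap.comp_apply, ContinuousLinearMap.compL_apply,
    ContinuousLinearMap.flip_apply] at h1
  rw [eq_sub_of_add_eq h1]
  abel

/-- The twistor structure on the product of two vector spaces. -/
def twistorField (i₁ i₂ i₃ : E → E →L[ℝ] E) (x : W → Fin 3 → ℝ) (j : W → W →L[ℝ] W) (p : E × W) :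
    E × W →L[ℝ] E × W :=
  (quatAct (i₁ p.1) (i₂ p.1) (i₃ p.1) (x p.2)).prodMap (j p.2)

theorem twistorField_apply (i₁ i₂ i₃ : E → E →L[ℝ] E) (x : W → Fin 3 → ℝ) (j : W → W →L[ℝ] W)
    (p v : E × W) : twistorField i₁ i₂ i₃ x j p v
      = (quatAct (i₁ p.1) (i₂ p.1) (i₃ p.1) (x p.2) v.1, j p.2 v.2) := rfl

theorem fderiv_twistorField {i₁ i₂ i₃ : E → E →L[ℝ] E} {x : W → Fin 3 → ℝ} {j : W → W →L[ℝ] W}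
    {y : E} {s : W} {dx : Fin 3 → W →L[ℝ] ℝ}
    (h₁ : DifferentiableAt ℝ i₁ y) (h₂ : DifferentiableAt ℝ i₂ y) (h₃ : DifferentiableAt ℝ i₃ y)
    (hj : DifferentiableAt ℝ j s) (hx : ∀ i, HasFDerivAt (fun s => x s i) (dx i) s) (ξ v : E × W) :
    fderiv ℝ (twistorField i₁ i₂ i₃ x j) (y, s) ξ v
      = (quatAct (i₁ y) (i₂ y) (i₃ y) (fun i => dx i ξ.2) v.1
          + quatAct (fderiv ℝ i₁ y ξ.1) (fderiv ℝ i₂ y ξ.1) (fderiv ℝ i₃ y ξ.1) (x s) v.1,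
        fderiv ℝ j s ξ.2 v.2) := by
  have hfst : HasFDerivAt (Prod.fst : E × W → E) (ContinuousLinearMap.fst ℝ E W) (y, s) :=
    hasFDerivAt_fst
  have hsnd : HasFDerivAt (Prod.snd : E × W → W) (ContinuousLinearMap.snd ℝ E W) (y, s) :=
    hasFDerivAt_snd
  have g₁ := (h₁.hasFDerivAt (x := y)).comp (y, s) hfst
  have g₂ := (h₂.hasFDerivAt (x := y)).comp (y, s) hfst
  have g₃ := (h₃.hasFDerivAt (x := y)).comp (y, s) hfst
  have gj := (hj.hasFDerivAt (x := s)).comp (y, s) hsnd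
  have gx := fun i => (hx i).comp (y, s) hsnd
  have hQ := (((gx 0).smul g₁).add ((gx 1).smul g₂)).add ((gx 2).smul g₃)
  have hP := (ContinuousLinearMap.prodMapL ℝ E E W W).hasFDerivAt.comp (y, s) (hQ.prodMk gj)
  have hF : fderiv ℝ (twistorField i₁ i₂ i₃ x j) (y, s) = _ := hP.fderiv
  rw [hF]
  refine Prod.ext ?_ ?_
  · simp [quatAct_apply]
    abel
  · simp

/-- The twistor structure of a local hypercomplex structure satisfies the integrability condition. -/
theorem localNijenhuis_twistorField {i₁ i₂ i₃ : E → E →L[ℝ] E} {x : W → Fin 3 → ℝ}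
    {j : W → W →L[ℝ] W} {g : E → E →L[ℝ] E →L[ℝ] ℝ} {y : E} {s : W} {dx : Fin 3 → W →L[ℝ] ℝ}
    (h₁ : DifferentiableAt ℝ i₁ y) (h₂ : DifferentiableAt ℝ i₂ y) (h₃ : DifferentiableAt ℝ i₃ y)
    (hj : DifferentiableAt ℝ j s) (hx : ∀ i, HasFDerivAt (fun s => x s i) (dx i) s)
    (hq : ∀ᶠ z in nhds y, IsQuaternionicHermitian (i₁ z) (i₂ z) (i₃ z) (g z))
    (hN₁ : ∀ u w, localNijenhuis i₁ y u w = 0) (hN₂ : ∀ u w, localNijenhuis i₂ y u w = 0)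
    (hN₃ : ∀ u w, localNijenhuis i₃ y u w = 0)
    (hj2 : ∀ᶠ t in nhds s, ∀ v, j t (j t v) = -v) (hW : Module.finrank ℝ W = 2)
    (hdx : combine dx (x s) = 0)
    (hdj : ∀ v, (fun i => dx i (j s v)) = (x s) ⨯₃ (fun i => dx i v)) (u w : E × W) :
    localNijenhuis (twistorField i₁ i₂ i₃ x j) (y, s) u w = 0 := by
  have q := hq.self_of_nhds
  have e1 := fun ξ v => fderiv_apply_of_sq h₁ (hq.mono fun z hz => hz.sq₁) ξ v
  have e2 := fun ξ v => fderiv_apply_of_sq h₂ (hq.mono fun z hz => hz.sq₂) ξ v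
  have sq₃ : ∀ z, IsQuaternionicHermitian (i₁ z) (i₂ z) (i₃ z) (g z) →
      ∀ v, i₃ z (i₃ z v) = -v := fun z hz v => by
    have := hz.quatAct_sq (A := ![0, 0, 1]) (by simp) v
    simpa [quatAct_apply] using this
  have e3 := fun ξ v => fderiv_apply_of_sq h₃ (hq.mono sq₃) ξ v
  have a12 : ∀ z, IsQuaternionicHermitian (i₁ z) (i₂ z) (i₃ z) (g z) →
      ∀ v, i₂ z (i₁ z v) = -i₁ z (i₂ z v) := fun z hz v => by rw [hz.mul, hz.anti]
  have a13 : ∀ z, IsQuaternionicHermitian (i₁ z) (i₂ z) (i₃ z) (g z) →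
      ∀ v, i₃ z (i₁ z v) = -i₁ z (i₃ z v) := fun z hz v => by
    rw [← hz.mul, ← hz.mul, a12 z hz, map_neg]
  have a23 : ∀ z, IsQuaternionicHermitian (i₁ z) (i₂ z) (i₃ z) (g z) →
      ∀ v, i₃ z (i₂ z v) = -i₂ z (i₃ z v) := fun z hz v => by
    rw [← hz.mul, ← hz.mul, a12 z hz, neg_neg]
  have m12 := nijenhuisAlg_mixed_eq_zero q.sq₁ q.sq₂ (a12 y q) e1 e2
    (fun ξ v => fderiv_apply_of_anticomm h₁ h₂ (hq.mono a12) ξ v) hN₁ hN₂ u.1 w.1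
  have m13 := nijenhuisAlg_mixed_eq_zero q.sq₁ (sq₃ y q) (a13 y q) e1 e3
    (fun ξ v => fderiv_apply_of_anticomm h₁ h₃ (hq.mono a13) ξ v) hN₁ hN₃ u.1 w.1
  have m23 := nijenhuisAlg_mixed_eq_zero q.sq₂ (sq₃ y q) (a23 y q) e2 e3
    (fun ξ v => fderiv_apply_of_anticomm h₂ h₃ (hq.mono a23) ξ v) hN₂ hN₃ u.1 w.1
  have n1 := hN₁ u.1 w.1
  have n2 := hN₂ u.1 w.1
  have n3 := hN₃ u.1 w.1
  -- Since `dx(σ)` is orthogonal to x, the quaternion product of x and `dx(σ)` is `x × dx(σ) =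
  -- dx(jσ)`.
  have hB : ∀ (σ : W) (v : E), quatAct (i₁ y) (i₂ y) (i₃ y) (fun i => dx i (j s σ)) v
      = quatAct (i₁ y) (i₂ y) (i₃ y) (x s)
        (quatAct (i₁ y) (i₂ y) (i₃ y) (fun i => dx i σ) v) := fun σ v => by
    have h0 : x s ⬝ᵥ (fun i => dx i σ) = 0 := by
      have := DFunLike.congr_fun hdx σ
      rw [dotProduct_fin3]
      simpa [combine] using this
    rw [q.quatAct_quatAct, h0, hdj]
    simp
  -- The component along the sphere vanishes for dimension reasons.
  have hS := nijenhuisAlg_eq_zero_of_finrank_eq_two hW hj2.self_of_nhds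
    (fun ξ v => fderiv_apply_of_sq hj hj2 ξ v) u.2 w.2
  simp only [localNijenhuis, nijenhuisAlg] at n1 n2 n3 hS ⊢
  simp only [fderiv_twistorField h₁ h₂ h₃ hj hx, twistorField_apply]
  refine Prod.ext ?_ (by simpa using hS)
  simp only [Prod.fst_sub, Prod.fst_add, Prod.fst_zero, map_add, hB]
  -- By `hB` all terms with derivatives of x are, up to sign, A applied to one of these two vectors,
  -- and they cancel in pairs. What is left is the quadratic form in x with the Nijenhuis tensors
  -- and their polarisations as coefficients.
  generalize hbu : quatAct (i₁ y) (i₂ y) (i₃ y) (fun i => dx i u.2) w.1 = bu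
  generalize hbw : quatAct (i₁ y) (i₂ y) (i₃ y) (fun i => dx i w.2) u.1 = bw
  clear hbu hbw
  simp only [quatAct_apply, map_add, map_smul, add_apply, smul_apply]
  linear_combination (norm := module) (x s 0 * x s 0) • n1 + (x s 1 * x s 1) • n2
    + (x s 2 * x s 2) • n3 + (x s 0 * x s 1) • m12 + (x s 0 * x s 2) • m13
    + (x s 1 * x s 2) • m23

end LocalTwistor

theorem ContDiffOn.clm_prodMap {A E W : Type*} [NormedAddCommGroup A] [NormedSpace ℝ A]
    [NormedAddCommGroup E] [NormedSpace ℝ E] [NormedAddCommGroup W] [NormedSpace ℝ W] {n : ℕ∞ω}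
    {f : A → E →L[ℝ] E} {h : A → W →L[ℝ] W} {s : Set A} (hf : ContDiffOn ℝ n f s)
    (hh : ContDiffOn ℝ n h s) : ContDiffOn ℝ n (fun a => (f a).prodMap (h a)) s := by
  have h1 : ContDiff ℝ n (fun q : (E →L[ℝ] E) × (W →L[ℝ] W) => q.1.prodMap q.2) :=
    (ContinuousLinearMap.prodMapL ℝ E E W W).contDiff
  exact h1.comp_contDiffOn (hf.prodMk hh)

/-- Transports the quaternionic structure of a tangent space to its coordinate expression. -/
theorem IsQuaternionicHermitian.conj {E : Type*} [NormedAddCommGroup E] [NormedSpace ℝ E]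
    {I₁ I₂ I₃ : E →L[ℝ] E} {g : E →L[ℝ] E →L[ℝ] ℝ} (h : IsQuaternionicHermitian I₁ I₂ I₃ g)
    {P Q : E →L[ℝ] E} (hPQ : ∀ v, P (Q v) = v) (hQP : ∀ v, Q (P v) = v) :
    IsQuaternionicHermitian (Q.comp (I₁.comp P)) (Q.comp (I₂.comp P)) (Q.comp (I₃.comp P))
      (g.bilinearComp P P) where
  sq₁ v := by simp [hPQ, hQP, h.sq₁]
  sq₂ v := by simp [hPQ, hQP, h.sq₂]
  mul v := by simp [hPQ, h.mul]
  anti v := by simp [hPQ, h.anti]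
  inv₁ u v := by simp [hPQ, h.inv₁]
  inv₂ u v := by simp [hPQ, h.inv₂]
  symm u v := h.symm _ _
  pos v hv := h.pos _ fun h0 => hv (by
    have h1 : P v = 0 := h0
    rw [← hQP v, h1, map_zero])

/-! ### Integrability of the twistor structure on the manifold. -/

section TwistorIntegrability

open scoped Matrix

variable {F : Type*} [NormedAddCommGroup F] [InnerProductSpace ℝ F] [FiniteDimensional ℝ F]
  {H : Type*} [TopologicalSpace H] {I : ModelWithCorners ℝ F H} [I.Boundaryless]
  {M : Type*} [TopologicalSpace M] [ChartedSpace H M] [IsManifold I ∞ M]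
  {I₁ I₂ I₃ : Π x : M, TangentSpace I x →L[ℝ] TangentSpace I x}

omit [FiniteDimensional ℝ F] [I.Boundaryless] in
theorem IsHypercomplex.isQuaternionicHermitian {g : SmoothMetric I M}
    (hI : IsHypercomplex I₁ I₂ I₃) (hg : IsHyperhermitian I₁ I₂ I₃ g) (x : M) :
    IsQuaternionicHermitian (E := F) (I₁ x) (I₂ x) (I₃ x) (g.inner x) where
  sq₁ := hI.fst.sq x
  sq₂ := hI.snd.sq x
  mul := hI.mul x
  anti := hI.anti x
  inv₁ := hg.fst x
  inv₂ := hg.snd x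
  symm := g.symm x
  pos := g.pos x

omit [FiniteDimensional ℝ F] [I.Boundaryless] in
theorem IsHypercomplex.isQuaternionicHermitian_chart {g : SmoothMetric I M}
    (hI : IsHypercomplex I₁ I₂ I₃) (hg : IsHyperhermitian I₁ I₂ I₃ g) {x₀ : M} {y : F}
    (hy : y ∈ (extChartAt I x₀).target) :
    IsQuaternionicHermitian (chartEnd I I₁ x₀ y) (chartEnd I I₂ x₀ y) (chartEnd I I₃ x₀ y)
      (chartBilin I g.inner x₀ y) :=
  (hI.isQuaternionicHermitian hg ((extChartAt I x₀).symm y)).conj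
    (chartFrame_chartCoframe I hy) (chartCoframe_chartFrame I hy)

omit [FiniteDimensional ℝ F] in
theorem chartEnd_twistorJ (I₁ I₂ I₃ : Π x : M, TangentSpace I x →L[ℝ] TangentSpace I x)
    {z₀ : M × Sph} {p : F × EuclideanSpace ℝ (Fin 2)}
    (hp : p ∈ (extChartAt (I.prod (𝓡 2)) z₀).target) :
    chartEnd (I.prod (𝓡 2)) (twistorJ I₁ I₂ I₃) z₀ p
      = twistorField (chartEnd I I₁ z₀.1) (chartEnd I I₂ z₀.1) (chartEnd I I₃ z₀.1)
        (fun s => WithLp.ofLp (sphParam z₀.2 s)) (chartEnd (𝓡 2) sphJ z₀.2) p := by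
  refine ContinuousLinearMap.ext fun v => ?_
  rw [chartEnd, chartCoframe_prod I (𝓡 2) hp, chartFrame_prod I (𝓡 2) hp, twistorField_apply]
  refine Prod.ext ?_ rfl
  rw [quatAct_apply]
  have h := fun a b c : F => map_add (chartCoframe I z₀.1 p.1) (a + b) c
  have h' := fun a b : F => map_add (chartCoframe I z₀.1 p.1) a b
  have h'' := fun (a : ℝ) (b : F) => map_smul (chartCoframe I z₀.1 p.1) a b
  refine (h _ _ _).trans ?_
  refine congrArg₂ (· + ·) ((h' _ _).trans (congrArg₂ (· + ·) (h'' _ _) (h'' _ _))) (h'' _ _)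

theorem sph_dotProduct_self (A : Sph) : WithLp.ofLp (A : EuclideanSpace ℝ (Fin 3)) ⬝ᵥ
    WithLp.ofLp (A : EuclideanSpace ℝ (Fin 3)) = 1 := by
  have h2 := EuclideanSpace.real_norm_sq_eq (A : EuclideanSpace ℝ (Fin 3))
  rw [mem_sphere_zero_iff_norm.1 A.2, Fin.sum_univ_three] at h2
  rw [dotProduct_fin3]
  linarith

theorem sph_dotProduct_sphIncl (A : Sph) (v : TangentSpace (𝓡 2) A) :
    WithLp.ofLp (A : EuclideanSpace ℝ (Fin 3)) ⬝ᵥ WithLp.ofLp (sphIncl A v) = 0 := by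
  have h : sphIncl A v ∈ LinearMap.range (sphIncl A).toLinearMap := ⟨v, rfl⟩
  have h' : LinearMap.range (sphIncl A).toLinearMap
      = (Submodule.span ℝ {(A : EuclideanSpace ℝ (Fin 3))})ᗮ := range_mvfderiv_subtypeVal A
  rw [h', Submodule.mem_orthogonal_singleton_iff_inner_right] at h
  rw [dotProduct_fin3]
  simp [PiLp.inner_apply, Fin.sum_univ_three] at h
  linarith

theorem sphJ_sphJ (A : Sph) (v : TangentSpace (𝓡 2) A) : sphJ A (sphJ A v) = -v := by
  refine sphIncl_injective A ?_
  have h0 := sph_dotProduct_sphIncl A v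
  have h1 := sph_dotProduct_self A
  change sphIncl A (sphJ A (sphJ A v)) = sphIncl A (-v)
  rw [map_neg, sphIncl_sphJ, sphIncl_sphJ]
  generalize sphIncl A v = w at h0
  rw [dotProduct_fin3] at h0 h1
  ext i
  simp only [crossLeft_apply, PiLp.neg_apply, cross_apply]
  fin_cases i <;> simp
  · linear_combination (A : EuclideanSpace ℝ (Fin 3)) 0 * h0 - w 0 * h1
  · linear_combination (A : EuclideanSpace ℝ (Fin 3)) 1 * h0 - w 1 * h1
  · linear_combination (A : EuclideanSpace ℝ (Fin 3)) 2 * h0 - w 2 * h1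

omit [FiniteDimensional ℝ F] in
set_option synthInstance.maxHeartbeats 400000 in
theorem IsHypercomplex.isComplexStructure_twistorJ {g : SmoothMetric I M}
    (hI : IsHypercomplex I₁ I₂ I₃) (hg : IsHyperhermitian I₁ I₂ I₃ g) :
    IsComplexStructure (I.prod (𝓡 2)) (twistorJ I₁ I₂ I₃) := by
  have hs : ∀ (J : Π x : M, TangentSpace I x →L[ℝ] TangentSpace I x), IsComplexStructure I J →
      ∀ x₀, ContDiffOn ℝ ∞ (chartEnd I J x₀) (extChartAt I x₀).target :=
    fun J hJ => (contMDiff_end_iff I J).1 hJ.smooth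
  refine isComplexStructure_of_chart _ (fun z₀ => ?_) (fun z v => ?_) fun z u w => ?_
  · refine ContDiffOn.congr ?_ fun p hp => chartEnd_twistorJ I₁ I₂ I₃ hp
    rw [extChartAt_prod]
    have hf : MapsTo (Prod.fst : F × EuclideanSpace ℝ (Fin 2) → F)
        ((extChartAt I z₀.1).prod (extChartAt (𝓡 2) z₀.2)).target (extChartAt I z₀.1).target :=
      fun p hp => hp.1
    have hf' : MapsTo (Prod.snd : F × EuclideanSpace ℝ (Fin 2) → EuclideanSpace ℝ (Fin 2))
        ((extChartAt I z₀.1).prod (extChartAt (𝓡 2) z₀.2)).target (extChartAt (𝓡 2) z₀.2).target :=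
      fun p hp => hp.2
    have g₁ := (hs I₁ hI.fst z₀.1).comp contDiffOn_fst hf
    have g₂ := (hs I₂ hI.snd z₀.1).comp contDiffOn_fst hf
    have g₃ := (hs I₃ hI.trd z₀.1).comp contDiffOn_fst hf
    have gj := (contDiffOn_chartEnd_sphJ z₀.2).comp contDiffOn_snd hf'
    have gx := fun i => (((contDiffOn_euclidean (n := ∞)).1 (contDiffOn_sphParam z₀.2)) i).comp
      contDiffOn_snd hf'
    have hQ := (((gx 0).smul g₁).add ((gx 1).smul g₂)).add ((gx 2).smul g₃)
    exact hQ.clm_prodMap gj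
  · exact Prod.ext ((hI.isQuaternionicHermitian hg z.1).quatAct_sq (sph_dotProduct_self z.2) v.1) (sphJ_sphJ z.2 v.2)
  · have hmem := (isOpen_extChartAt_target (I := I.prod (𝓡 2)) z).mem_nhds (mem_extChartAt_target z)
    have h0 := mem_extChartAt_target (I := I) z.1
    have h0' := mem_extChartAt_target (I := 𝓡 2) z.2
    have hm := (isOpen_extChartAt_target (I := I) z.1).mem_nhds h0
    have hm' := (isOpen_extChartAt_target (I := 𝓡 2) z.2).mem_nhds h0'
    have heq : chartEnd (I.prod (𝓡 2)) (twistorJ I₁ I₂ I₃) z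
        =ᶠ[nhds (extChartAt (I.prod (𝓡 2)) z z)] twistorField (chartEnd I I₁ z.1)
          (chartEnd I I₂ z.1) (chartEnd I I₃ z.1) (fun s => WithLp.ofLp (sphParam z.2 s))
          (chartEnd (𝓡 2) sphJ z.2) := by
      filter_upwards [hmem] with p hp using chartEnd_twistorJ I₁ I₂ I₃ hp
    have hd : ∀ (J : Π x : M, TangentSpace I x →L[ℝ] TangentSpace I x), IsComplexStructure I J →
        DifferentiableAt ℝ (chartEnd I J z.1) (extChartAt I z.1 z.1) :=
      fun J hJ => ((hs J hJ z.1).contDiffAt hm).differentiableAt (by simp)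
    have hfin := localNijenhuis_twistorField (g := chartBilin I g.inner z.1)
      (x := fun s => WithLp.ofLp (sphParam z.2 s)) (hd I₁ hI.fst) (hd I₂ hI.snd) (hd I₃ hI.trd)
      (((contDiffOn_chartEnd_sphJ z.2).contDiffAt hm').differentiableAt (by simp))
      (hasFDerivAt_sphParam h0')
      (by filter_upwards [hm] with y hy using hI.isQuaternionicHermitian_chart hg hy)
      (hI.fst.localNijenhuis_eq_zero I z.1) (hI.snd.localNijenhuis_eq_zero I z.1)
      (hI.trd.localNijenhuis_eq_zero I z.1)
      (by
        filter_upwards [hm'] with t ht v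
        refine (congrArg (fun w : EuclideanSpace ℝ (Fin 2) => chartCoframe (𝓡 2) z.2 t
          (sphJ ((extChartAt (𝓡 2) z.2).symm t) w)) (chartFrame_chartCoframe (𝓡 2) ht _)).trans ?_
        refine (congrArg (chartCoframe (𝓡 2) z.2 t) (sphJ_sphJ _ _)).trans ?_
        exact (map_neg (chartCoframe (𝓡 2) z.2 t) _).trans
          (congrArg _ (chartCoframe_chartFrame (𝓡 2) ht v)))
      (by simp) (combine_sphCovector h0')
      (fun v => funext fun i => congrArg (fun w : EuclideanSpace ℝ (Fin 3) => w i)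
        (fderiv_sphParam_chartEnd h0' v)) u w
    rw [localNijenhuis, heq.fderiv_eq, heq.self_of_nhds]
    exact hfin

end TwistorIntegrability

/-! ### Leibniz rules for the primitive β. -/

section ExteriorDerivativeRules

variable {V : Type*} [NormedAddCommGroup V] [NormedSpace ℝ V] {k : ℕ}

theorem extDeriv_finset_sum {ι : Type*} (s : Finset ι) {α : ι → V → V [⋀^Fin k]→L[ℝ] ℝ} {p : V}
    (h : ∀ i ∈ s, DifferentiableAt ℝ (α i) p) :
    extDeriv (fun y => ∑ i ∈ s, α i y) p = ∑ i ∈ s, extDeriv (α i) p := by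
  simp only [extDeriv]
  rw [fderiv_fun_sum h]
  exact map_sum (ContinuousAlternatingMap.alternatizeUncurryFinCLM ℝ V ℝ) _ s

theorem extDeriv_fun_sub {α β : V → V [⋀^Fin k]→L[ℝ] ℝ} {p : V} (hα : DifferentiableAt ℝ α p)
    (hβ : DifferentiableAt ℝ β p) :
    extDeriv (fun y => α y - β y) p = extDeriv α p - extDeriv β p := by
  simp only [extDeriv]
  rw [fderiv_fun_sub hα hβ]
  exact map_sub (ContinuousAlternatingMap.alternatizeUncurryFinCLM ℝ V ℝ) _ _

theorem ContDiffAt.fderiv_wedgeOne {f : V → ℝ} {α : V → V [⋀^Fin k]→L[ℝ] ℝ} {p : V}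
    (hf : ContDiffAt ℝ ∞ f p) (hα : ContDiffAt ℝ ∞ α p) :
    ContDiffAt ℝ ∞ (fun y => fderiv ℝ f y ⋏ α y) p :=
  have hdf : ContDiffAt ℝ ∞ (fderiv ℝ f) p := hf.fderiv_right (by simp)
  have h : ContDiffAt ℝ ∞ (fun y => wedgeOneL V k (fderiv ℝ f y)) p :=
    contDiff_wedgeOneL.contDiffAt.comp p hdf
  h.clm_apply hα

theorem extDeriv_sub_smul_fderiv_wedgeOne {f h : V → ℝ} {α : V → V [⋀^Fin k]→L[ℝ] ℝ} {p : V}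
    (hf : ContDiffAt ℝ ∞ f p) (hh : ContDiffAt ℝ ∞ h p) (hα : ContDiffAt ℝ ∞ α p) :
    extDeriv (fun y => f y • (fderiv ℝ h y ⋏ α y) - h y • (fderiv ℝ f y ⋏ α y)) p
      = (2 : ℝ) • (fderiv ℝ f p ⋏ fderiv ℝ h p ⋏ α p)
        - (f p • fderiv ℝ h p - h p • fderiv ℝ f p) ⋏ extDeriv α p := by
  have h1 := hf.differentiableAt (by simp)
  have h2 := hh.differentiableAt (by simp)
  have h3 := (hh.fderiv_wedgeOne hα).differentiableAt (by simp)
  have h4 := (hf.fderiv_wedgeOne hα).differentiableAt (by simp)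
  rw [extDeriv_fun_sub (h1.fun_smul h3) (h2.fun_smul h4), extDeriv_smul_function h1 h3,
    extDeriv_smul_function h2 h4, extDeriv_fderiv_wedgeOne hf hα, extDeriv_fderiv_wedgeOne hh hα,
    wedgeOne_anticomm (fderiv ℝ h p), sub_wedgeOne, smul_wedgeOne, smul_wedgeOne]
  module

theorem extDeriv_mul_smul {f h : V → ℝ} {α : V → V [⋀^Fin k]→L[ℝ] ℝ} {p : V}
    (hf : DifferentiableAt ℝ f p) (hh : DifferentiableAt ℝ h p) (hα : DifferentiableAt ℝ α p) :
    extDeriv (fun y => (f y * h y) • α y) p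
      = (f p • fderiv ℝ h p + h p • fderiv ℝ f p) ⋏ α p + (f p * h p) • extDeriv α p := by
  rw [extDeriv_smul_function (hf.fun_mul hh) hα, fderiv_fun_mul hf hh]

end ExteriorDerivativeRules

/-! ### Closedness of the power of the Hermitian form in a product chart. -/

section LocalClosedness

open scoped Matrix Nat

variable {E : Type*} [NormedAddCommGroup E] [NormedSpace ℝ E] [FiniteDimensional ℝ E]
  {W : Type*} [NormedAddCommGroup W] [NormedSpace ℝ W] [FiniteDimensional ℝ W]

/-- The power equals `Cν + dβ`, with β the cyclic sum of `(xᵢ dxⱼ - xⱼ dxᵢ) ∧ θₘ` minus `∑ xᵢxⱼ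
lᵢⱼ`. Both terms are closed: ν because it comes from a top form on E, and dβ because `d² = 0`. -/
theorem extDeriv_wedgePow_twistorForm {i₁ i₂ i₃ : E → E →L[ℝ] E} {g : E → E →L[ℝ] E →L[ℝ] ℝ}
    {k : ℕ} (hE : Module.finrank ℝ E = 2 * (k + 1)) {t : Set E} (ht : IsOpen t) {t' : Set W}
    (ht' : IsOpen t') (hq : ∀ y ∈ t, IsQuaternionicHermitian (i₁ y) (i₂ y) (i₃ y) (g y))
    {ν : E → E [⋀^Fin (2 * k + 1 + 1)]→L[ℝ] ℝ} (hνs : ContDiffOn ℝ ∞ ν t)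
    (hν : ∀ y ∈ t, wedgePow ((g y).comp (i₁ y)) (k + 1) = ((k + 1)! : ℝ) • ν y)
    {θ : Fin 3 → E → E [⋀^Fin (2 * k)]→L[ℝ] ℝ} (hθs : ∀ i, ContDiffOn ℝ ∞ (θ i) t)
    (hθ : ∀ y ∈ t, ∀ i, wedgePow ((g y).comp ((![i₁ y, i₂ y, i₃ y] : Fin 3 → E →L[ℝ] E) i)) k
      = (k ! : ℝ) • θ i y)
    {T : Fin 3 → E → E} (hT : ∀ y ∈ t, ∀ j, extDeriv (θ j) y = (ν y).curryLeft (T j y))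
    {l : Fin 3 → Fin 3 → E → E [⋀^Fin (2 * k + 1)]→L[ℝ] ℝ}
    (hls : ∀ i j, ContDiffOn ℝ ∞ (l i j) t)
    (hl : ∀ y ∈ t, ∀ i j, l i j y
      = (ν y).curryLeft ((![i₁ y, i₂ y, i₃ y] : Fin 3 → E →L[ℝ] E) i (T j y)))
    {δ : Fin 3 → Fin 3 → E → ℝ} (hδ : ∀ y ∈ t, ∀ i j, extDeriv (l i j) y = δ i j y • ν y)
    {x : W → Fin 3 → ℝ} (hxs : ∀ i, ContDiffOn ℝ ∞ (fun s => x s i) t')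
    (hx : ∀ s, x s ⬝ᵥ x s = 1) {dx : W → Fin 3 → W →L[ℝ] ℝ}
    (hdx : ∀ s ∈ t', ∀ i, HasFDerivAt (fun s => x s i) (dx s i) s)
    (hdx0 : ∀ s ∈ t', combine (dx s) (x s) = 0) {a b : E × W → ℝ} {C : ℝ}
    (hab : ∀ p ∈ t ×ˢ t', ((k + 1)! : ℝ) * (a p ^ k * b p) = 2)
    (hC : ∀ p ∈ t ×ˢ t', ((k + 1)! : ℝ) * a p ^ (k + 1) + 4⁻¹ * ∑ i, g p.1
      (twistVector (i₁ p.1) (i₂ p.1) (i₃ p.1) (fun j => T j p.1) (x p.2) (Pi.single i 1))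
      (twistVector (i₁ p.1) (i₂ p.1) (i₃ p.1) (fun j => T j p.1) (x p.2) (Pi.single i 1))
      = C - ∑ i, ∑ j, x p.2 i * x p.2 j * δ i j p.1) :
    ∀ p ∈ t ×ˢ t', extDeriv (fun p => wedgePow (twistorForm (i₁ p.1) (i₂ p.1) (i₃ p.1) (g p.1)
      (twistCovector (i₁ p.1) (i₂ p.1) (i₃ p.1) (g p.1) (fun j => T j p.1) (x p.2)) (x p.2)
      (dx p.2) (a p) (b p)) (k + 1)) p = 0 := by
  set X : Fin 3 → E × W → ℝ := fun i p => x p.2 i with hXdef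
  have hX : ∀ i, ContDiffOn ℝ ∞ (X i) (t ×ˢ t') := fun i =>
    (hxs i).comp contDiffOn_snd fun p hp => hp.2
  have hdX : ∀ p ∈ t ×ˢ t', ∀ i, fderiv ℝ (X i) p
      = (dx p.2 i).comp (ContinuousLinearMap.snd ℝ E W) := fun p hp i =>
    ((hdx p.2 hp.2 i).comp p hasFDerivAt_snd).fderiv
  have hopen : IsOpen (t ×ˢ t') := ht.prod ht'
  have hnhds : ∀ p ∈ t ×ˢ t', t ×ˢ t' ∈ nhds p := fun p hp => hopen.mem_nhds hp
  have hνp := hνs.pullFst (t' := t')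
  have hθp := fun i => (hθs i).pullFst (t' := t')
  have hlp := fun i j => (hls i j).pullFst (t' := t')
  set γ : (i j m : Fin 3) → E × W → (E × W) [⋀^Fin (2 * k + 1)]→L[ℝ] ℝ := fun i j m p =>
    X i p • (fderiv ℝ (X j) p ⋏ pullFst W (θ m p.1))
      - X j p • (fderiv ℝ (X i) p ⋏ pullFst W (θ m p.1)) with hγ
  have hγs : ∀ i j m, ∀ p ∈ t ×ˢ t', ContDiffAt ℝ ∞ (γ i j m) p := fun i j m p hp => by
    have hi := (hX i).contDiffAt (hnhds p hp)
    have hj := (hX j).contDiffAt (hnhds p hp)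
    have hm := (hθp m).contDiffAt (hnhds p hp)
    exact (hi.smul (hj.fderiv_wedgeOne hm)).sub (hj.smul (hi.fderiv_wedgeOne hm))
  set κ : E × W → (E × W) [⋀^Fin (2 * k + 1)]→L[ℝ] ℝ := fun p =>
    ∑ i, ∑ j, (X i p * X j p) • pullFst W (l i j p.1) with hκ
  have hκt : ∀ i j, ∀ p ∈ t ×ˢ t',
      ContDiffAt ℝ ∞ (fun p => (X i p * X j p) • pullFst W (l i j p.1)) p := fun i j p hp =>
    (((hX i).contDiffAt (hnhds p hp)).mul ((hX j).contDiffAt (hnhds p hp))).smul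
      ((hlp i j).contDiffAt (hnhds p hp))
  have hκs : ∀ p ∈ t ×ˢ t', ContDiffAt ℝ ∞ κ p := fun p hp =>
    ContDiffAt.sum fun i _ => ContDiffAt.sum fun j _ => hκt i j p hp
  set β : E × W → (E × W) [⋀^Fin (2 * k + 1)]→L[ℝ] ℝ := fun p =>
    γ 1 2 0 p + γ 2 0 1 p + γ 0 1 2 p - κ p with hβ
  have hβs : ∀ p ∈ t ×ˢ t', ContDiffAt ℝ ∞ β p := fun p hp =>
    (((hγs 1 2 0 p hp).add (hγs 2 0 1 p hp)).add (hγs 0 1 2 p hp)).sub (hκs p hp)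
  have hdγ : ∀ i j m, ∀ p ∈ t ×ˢ t', extDeriv (γ i j m) p
      = (2 : ℝ) • (fderiv ℝ (X i) p ⋏ fderiv ℝ (X j) p ⋏ pullFst W (θ m p.1))
        - (X i p • fderiv ℝ (X j) p - X j p • fderiv ℝ (X i) p)
          ⋏ pullFst W ((ν p.1).curryLeft (T m p.1)) := fun i j m p hp => by
    rw [hγ, extDeriv_sub_smul_fderiv_wedgeOne ((hX i).contDiffAt (hnhds p hp))
      ((hX j).contDiffAt (hnhds p hp)) ((hθp m).contDiffAt (hnhds p hp)),
      extDeriv_pullFst (((hθs m).contDiffAt (ht.mem_nhds hp.1)).differentiableAt (by simp)),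
      hT p.1 hp.1]
  have hdκ : ∀ p ∈ t ×ˢ t', extDeriv κ p
      = ∑ i, ∑ j, ((X i p • fderiv ℝ (X j) p + X j p • fderiv ℝ (X i) p) ⋏ pullFst W
          ((ν p.1).curryLeft ((![i₁ p.1, i₂ p.1, i₃ p.1] : Fin 3 → E →L[ℝ] E) i (T j p.1)))
        + (X i p * X j p * δ i j p.1) • pullFst W (ν p.1)) := fun p hp => by
    rw [hκ, extDeriv_finset_sum _ fun i _ =>
      DifferentiableAt.fun_sum fun j _ => (hκt i j p hp).differentiableAt (by simp)]
    refine Finset.sum_congr rfl fun i _ => ?_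
    rw [extDeriv_finset_sum _ fun j _ => (hκt i j p hp).differentiableAt (by simp)]
    refine Finset.sum_congr rfl fun j _ => ?_
    rw [extDeriv_mul_smul (((hX i).contDiffAt (hnhds p hp)).differentiableAt (by simp))
      (((hX j).contDiffAt (hnhds p hp)).differentiableAt (by simp))
      (((hlp i j).contDiffAt (hnhds p hp)).differentiableAt (by simp)),
      extDeriv_pullFst (((hls i j).contDiffAt (ht.mem_nhds hp.1)).differentiableAt (by simp)),
      hδ p.1 hp.1, hl p.1 hp.1, pullFst_smul, smul_smul]
  -- `hab` matches the terms quadratic in dx, the choice of Φ matches the mixed terms, and `hC`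
  -- absorbs the functions δ, leaving the constant C in front of ν.
  have hdβ : ∀ p ∈ t ×ˢ t', wedgePow (twistorForm (i₁ p.1) (i₂ p.1) (i₃ p.1) (g p.1)
      (twistCovector (i₁ p.1) (i₂ p.1) (i₃ p.1) (g p.1) (fun j => T j p.1) (x p.2)) (x p.2)
      (dx p.2) (a p) (b p)) (k + 1) = C • pullFst W (ν p.1) + extDeriv β p := fun p hp => by
    have hγd := fun i j m => (hγs i j m p hp).differentiableAt (by simp)
    have e1 : extDeriv β p = extDeriv (γ 1 2 0) p + extDeriv (γ 2 0 1) p + extDeriv (γ 0 1 2) p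
        - extDeriv κ p := by
      rw [hβ, extDeriv_fun_sub (((hγd 1 2 0).fun_add (hγd 2 0 1)).fun_add (hγd 0 1 2))
        ((hκs p hp).differentiableAt (by simp)),
        extDeriv_fun_add ((hγd 1 2 0).fun_add (hγd 2 0 1)) (hγd 0 1 2),
        extDeriv_fun_add (hγd 1 2 0) (hγd 2 0 1)]
    rw [e1, hdγ _ _ _ p hp, hdγ _ _ _ p hp, hdγ _ _ _ p hp, hdκ p hp]
    refine ((hq p.1 hp.1).wedgePow_twistorForm hE (fun j => T j p.1) (hx p.2) (dx p.2)
      (hdx0 p.2 hp.2) (hab p hp) (fun i => fderiv ℝ (X i) p) (hdX p hp) (ν p.1) (hν p.1 hp.1)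
      (fun i => θ i p.1) (hθ p.1 hp.1)).trans ?_
    rw [hC p hp]
    simp only [Finset.sum_add_distrib, ← Finset.sum_smul]
    have key : ∀ (n x₀ x₁ x₂ y₀ y₁ y₂ z : (E × W) [⋀^Fin (2 * k + 1 + 1)]→L[ℝ] ℝ) (S : ℝ),
        (C - S) • n + (2 : ℝ) • (x₀ + x₁ + x₂) - (y₀ + y₁ + y₂) - z
        = C • n + ((2 : ℝ) • x₀ - y₀ + ((2 : ℝ) • x₁ - y₁) + ((2 : ℝ) • x₂ - y₂) - (z + S • n)) := by
      intros; module
    exact key _ _ _ _ _ _ _ _ _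
  intro p hp
  have heq : (fun p => wedgePow (twistorForm (i₁ p.1) (i₂ p.1) (i₃ p.1) (g p.1)
      (twistCovector (i₁ p.1) (i₂ p.1) (i₃ p.1) (g p.1) (fun j => T j p.1) (x p.2)) (x p.2)
      (dx p.2) (a p) (b p)) (k + 1)) =ᶠ[nhds p] fun p => C • pullFst W (ν p.1) + extDeriv β p :=
    Filter.eventually_of_mem (hnhds p hp) hdβ
  have hνd : DifferentiableAt ℝ (fun p : E × W => pullFst W (ν p.1)) p :=
    (hνp.contDiffAt (hnhds p hp)).differentiableAt (by simp)
  have hdβs : DifferentiableAt ℝ (extDeriv β) p := by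
    have hβo : ContDiffOn ℝ ∞ β (t ×ˢ t') := fun p hp => (hβs p hp).contDiffWithinAt
    exact ((hβo.extDeriv hopen).contDiffAt (hnhds p hp)).differentiableAt (by simp)
  refine (heq.extDeriv_eq).trans ?_
  rw [extDeriv_fun_add (hνd.fun_const_smul C) hdβs,
    extDeriv_extDeriv_apply (hβs p hp) minSmoothness_two_le_infty, add_zero]
  refine (extDeriv_smul C _).trans ?_
  rw [extDeriv_pullFst ((hνs.contDiffAt (ht.mem_nhds hp.1)).differentiableAt (by simp)),
    eq_zero_of_finrank_lt (by omega) (extDeriv ν p.1)]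
  exact smul_zero C

end LocalClosedness

/-! ### The sheared inner product on a product of vector spaces. -/

section TwistorInner

open scoped Matrix

variable {E : Type*} [NormedAddCommGroup E] [NormedSpace ℝ E]
  {W : Type*} [NormedAddCommGroup W] [NormedSpace ℝ W]

/-- The bilinear form `a g(X, X') + b ⟨v, v'⟩` on `E × W`, where `vᵢ = dxᵢ(V) + rᵢ(X)` for
`w = (X, V)`. -/
def twistorInner (g : E →L[ℝ] E →L[ℝ] ℝ) (r : Fin 3 → E →L[ℝ] ℝ) (dx : Fin 3 → W →L[ℝ] ℝ)
    (a b : ℝ) : (E × W) →L[ℝ] (E × W) →L[ℝ] ℝ :=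
  a • g.bilinearComp (ContinuousLinearMap.fst ℝ E W) (ContinuousLinearMap.fst ℝ E W)
    + b • ∑ i, ((dx i).comp (ContinuousLinearMap.snd ℝ E W)
        + (r i).comp (ContinuousLinearMap.fst ℝ E W)).smulRight
      ((dx i).comp (ContinuousLinearMap.snd ℝ E W) + (r i).comp (ContinuousLinearMap.fst ℝ E W))

theorem twistorInner_apply (g : E →L[ℝ] E →L[ℝ] ℝ) (r : Fin 3 → E →L[ℝ] ℝ)
    (dx : Fin 3 → W →L[ℝ] ℝ) (a b : ℝ) (u v : E × W) :
    twistorInner g r dx a b u v = a * g u.1 v.1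
      + b * ∑ i, (dx i u.2 + r i u.1) * (dx i v.2 + r i v.1) := by
  simp [twistorInner, mul_add]

theorem twistorInner_symm {g : E →L[ℝ] E →L[ℝ] ℝ} (hg : ∀ u v, g u v = g v u)
    (r : Fin 3 → E →L[ℝ] ℝ) (dx : Fin 3 → W →L[ℝ] ℝ) (a b : ℝ) (u v : E × W) :
    twistorInner g r dx a b u v = twistorInner g r dx a b v u := by
  rw [twistorInner_apply, twistorInner_apply, hg]
  simp only [mul_comm]

/-- If X is nonzero the first summand is positive. If X is zero the shear disappears and the `dxᵢ`
separate the vectors V. -/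
theorem twistorInner_pos {g : E →L[ℝ] E →L[ℝ] ℝ} (hg : ∀ v, v ≠ 0 → 0 < g v v)
    (r : Fin 3 → E →L[ℝ] ℝ) {dx : Fin 3 → W →L[ℝ] ℝ} (hdx : ∀ v, (∀ i, dx i v = 0) → v = 0)
    {a b : ℝ} (ha : 0 < a) (hb : 0 < b) {u : E × W} (hu : u ≠ 0) :
    0 < twistorInner g r dx a b u u := by
  rw [twistorInner_apply]
  by_cases h1 : u.1 = 0
  · have h2 : ∃ i, dx i u.2 ≠ 0 := by
      by_contra! h
      exact hu (Prod.ext h1 (hdx u.2 h))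
    obtain ⟨i, hi⟩ := h2
    have h3 : 0 < ∑ i, (dx i u.2 + r i u.1) * (dx i u.2 + r i u.1) := by
      refine Finset.sum_pos' (fun i _ => mul_self_nonneg _) ⟨i, Finset.mem_univ i, ?_⟩
      rw [h1, map_zero, add_zero]
      exact mul_self_pos.2 hi
    rw [h1, map_zero, mul_zero, zero_add]
    rw [h1] at h3
    exact mul_pos hb h3
  · exact add_pos_of_pos_of_nonneg (mul_pos ha (hg _ h1))
      (mul_nonneg hb.le (Finset.sum_nonneg fun i _ => mul_self_nonneg _))

theorem twistorInner_bilinearComp (g : E →L[ℝ] E →L[ℝ] ℝ) (r : Fin 3 → E →L[ℝ] ℝ)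
    (dx : Fin 3 → W →L[ℝ] ℝ) (a b : ℝ) (P : E →L[ℝ] E) (P' : W →L[ℝ] W) :
    (twistorInner g r dx a b).bilinearComp (P.prodMap P') (P.prodMap P')
      = twistorInner (g.bilinearComp P P) (fun i => (r i).comp P) (fun i => (dx i).comp P') a b := by
  refine ContinuousLinearMap.ext fun u => ContinuousLinearMap.ext fun v => ?_
  rw [ContinuousLinearMap.bilinearComp_apply, twistorInner_apply, twistorInner_apply]
  rfl

theorem twistorForm_apply (I₁ I₂ I₃ : E →L[ℝ] E) (g : E →L[ℝ] E →L[ℝ] ℝ) (r : Fin 3 → E →L[ℝ] ℝ)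
    (A : Fin 3 → ℝ) (dx : Fin 3 → W →L[ℝ] ℝ) (a b : ℝ) (u v : E × W) :
    twistorForm I₁ I₂ I₃ g r A dx a b u v = a * g (quatAct I₁ I₂ I₃ A u.1) v.1
      + b * ((A ⨯₃ (fun i => dx i u.2 + r i u.1)) ⬝ᵥ (fun i => dx i v.2 + r i v.1)) := by
  simp only [twistorForm, add_apply, smul_apply, wedgeBilin_apply, smul_eq_mul, dotProduct_fin3,
    ContinuousLinearMap.bilinearComp_apply, ContinuousLinearMap.comp_apply,
    ContinuousLinearMap.coe_fst', ContinuousLinearMap.coe_snd', cross_apply, Matrix.cons_val]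
  ring

theorem twistVector_conj (I₁ I₂ I₃ : E →L[ℝ] E) (T : Fin 3 → E) {P Q : E →L[ℝ] E}
    (hPQ : ∀ v, P (Q v) = v) (A v : Fin 3 → ℝ) :
    P (twistVector (Q.comp (I₁.comp P)) (Q.comp (I₂.comp P)) (Q.comp (I₃.comp P))
      (fun j => Q (T j)) A v) = twistVector I₁ I₂ I₃ T A v := by
  simp only [twistVector, combine, quatAct_apply, map_add, map_sub, map_neg, map_smul, hPQ,
    ContinuousLinearMap.comp_apply]

theorem twistCovector_conj (I₁ I₂ I₃ : E →L[ℝ] E) (g : E →L[ℝ] E →L[ℝ] ℝ) (T : Fin 3 → E)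
    {P Q : E →L[ℝ] E} (hPQ : ∀ v, P (Q v) = v) (A : Fin 3 → ℝ) (i : Fin 3) :
    (twistCovector I₁ I₂ I₃ g T A i).comp P
      = twistCovector (Q.comp (I₁.comp P)) (Q.comp (I₂.comp P)) (Q.comp (I₃.comp P))
        (g.bilinearComp P P) (fun j => Q (T j)) A i := by
  ext v
  have h := twistVector_conj I₁ I₂ I₃ T hPQ A (Pi.single i 1)
  change 2⁻¹ * g _ (P v) = 2⁻¹ * g (P _) (P v)
  rw [h]

/-- The relation `Φ(A × v) = AΦ(v)` in dual form: the shear is complex linear. This makes the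
sheared inner product Hermitian, since both `dx` and `r` turn the complex structures into `A × ·`.
-/
theorem IsQuaternionicHermitian.twistCovector_quatAct {I₁ I₂ I₃ : E →L[ℝ] E}
    {g : E →L[ℝ] E →L[ℝ] ℝ} (h : IsQuaternionicHermitian I₁ I₂ I₃ g) (T : Fin 3 → E)
    {A : Fin 3 → ℝ} (hA : A ⬝ᵥ A = 1) (X : E) :
    (fun i => twistCovector I₁ I₂ I₃ g T A i (quatAct I₁ I₂ I₃ A X))
      = A ⨯₃ (fun i => twistCovector I₁ I₂ I₃ g T A i X) := by
  have h1 : ∀ i, twistCovector I₁ I₂ I₃ g T A i (quatAct I₁ I₂ I₃ A X)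
      = -combine (twistCovector I₁ I₂ I₃ g T A) (A ⨯₃ Pi.single i 1) X := fun i => by
    rw [combine_twistCovector, ← h.quatAct_twistVector T hA]
    simp only [twistCovector, smul_apply, h.skew A, smul_eq_mul]
    ring
  obtain ⟨s0, s1, s2⟩ := single_fin3
  funext i
  rw [h1]
  fin_cases i <;> simp [s0, s1, s2, combine, cross_apply] <;> ring

variable {I₁ I₂ I₃ : E →L[ℝ] E} {g : E →L[ℝ] E →L[ℝ] ℝ}
  (h : IsQuaternionicHermitian I₁ I₂ I₃ g) (T : Fin 3 → E) {A : Fin 3 → ℝ} (hA : A ⬝ᵥ A = 1)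
  {dx : Fin 3 → W →L[ℝ] ℝ} {j : W →L[ℝ] W}
  (hj : ∀ v, (fun i => dx i (j v)) = A ⨯₃ (fun i => dx i v))
include h hA hj

theorem IsQuaternionicHermitian.twistorInner_comp (a b : ℝ) :
    (twistorInner g (twistCovector I₁ I₂ I₃ g T A) dx a b).comp ((quatAct I₁ I₂ I₃ A).prodMap j)
      = twistorForm I₁ I₂ I₃ g (twistCovector I₁ I₂ I₃ g T A) A dx a b := by
  refine ContinuousLinearMap.ext fun u => ContinuousLinearMap.ext fun v => ?_
  rw [ContinuousLinearMap.comp_apply, twistorInner_apply, twistorForm_apply]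
  have h1 : (fun i => dx i u.2 + twistCovector I₁ I₂ I₃ g T A i u.1)
    = (fun i => dx i u.2) + (fun i => twistCovector I₁ I₂ I₃ g T A i u.1) := rfl
  rw [h1, map_add, ← h.twistCovector_quatAct T hA u.1, ← hj]
  rfl

theorem IsQuaternionicHermitian.twistorInner_invariant (hdx : combine dx A = 0) (a b : ℝ)
    (u v : E × W) :
    twistorInner g (twistCovector I₁ I₂ I₃ g T A) dx a b
      (quatAct I₁ I₂ I₃ A u.1, j u.2) (quatAct I₁ I₂ I₃ A v.1, j v.2)
      = twistorInner g (twistCovector I₁ I₂ I₃ g T A) dx a b u v := by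
  rw [twistorInner_apply, twistorInner_apply]
  simp only
  rw [h.quatAct_inv hA]
  congr 2
  have h0 : combine (twistCovector I₁ I₂ I₃ g T A) A = 0 := by
    rw [combine_twistCovector, twistVector_self I₁ I₂ I₃ T hA, map_zero, smul_zero]
  have h1 := fun X => h.twistCovector_quatAct T hA X
  generalize twistCovector I₁ I₂ I₃ g T A = r at h0 h1
  -- The sheared vector stays orthogonal to A, so `A × ·` acts on it as an isometry.
  have key : ∀ w : E × W, (A 0 * (dx 0 w.2 + r 0 w.1) + A 1 * (dx 1 w.2 + r 1 w.1)
      + A 2 * (dx 2 w.2 + r 2 w.1)) = 0 := fun w => by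
    have e1 := DFunLike.congr_fun hdx w.2
    have e2 := DFunLike.congr_fun h0 w.1
    simp only [combine, add_apply, smul_apply, smul_eq_mul, zero_apply] at e1 e2
    linear_combination e1 + e2
  have hz : ∀ w : E × W, ∀ i, dx i (j w.2) + r i (quatAct I₁ I₂ I₃ A w.1)
      = (A ⨯₃ (fun i => dx i w.2 + r i w.1)) i := fun w i => by
    rw [congrFun (hj w.2) i, congrFun (h1 w.1) i]
    fin_cases i <;> simp [cross_apply] <;> ring
  simp only [hz]
  have ku := key u
  rw [dotProduct_fin3] at hA
  simp only [Fin.sum_univ_three, cross_apply, Matrix.cons_val]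
  generalize dx 0 u.2 + r 0 u.1 = p0 at *
  generalize dx 1 u.2 + r 1 u.1 = p1 at *
  generalize dx 2 u.2 + r 2 u.1 = p2 at *
  generalize dx 0 v.2 + r 0 v.1 = q0 at *
  generalize dx 1 v.2 + r 1 v.1 = q1 at *
  generalize dx 2 v.2 + r 2 v.1 = q2 at *
  linear_combination (p0 * q0 + p1 * q1 + p2 * q2) * hA - (A 0 * q0 + A 1 * q1 + A 2 * q2) * ku

end TwistorInner

/-! ### The sheared metric on the twistor space. -/

section TwistorMetric

open scoped Matrix

section Smoothness

variable {E : Type*} [NormedAddCommGroup E] [NormedSpace ℝ E]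
  {W : Type*} [NormedAddCommGroup W] [NormedSpace ℝ W]
  {Y : Type*} [NormedAddCommGroup Y] [NormedSpace ℝ Y] {n : ℕ∞ω} {s : Set Y}

theorem ContDiffOn.twistVector {i₁ i₂ i₃ : Y → E →L[ℝ] E} {T : Fin 3 → Y → E} {A : Y → Fin 3 → ℝ}
    (h₁ : ContDiffOn ℝ n i₁ s) (h₂ : ContDiffOn ℝ n i₂ s) (h₃ : ContDiffOn ℝ n i₃ s)
    (hT : ∀ j, ContDiffOn ℝ n (T j) s) (hA : ∀ i, ContDiffOn ℝ n (fun y => A y i) s)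
    (v : Fin 3 → ℝ) :
    ContDiffOn ℝ n (fun y => twistVector (i₁ y) (i₂ y) (i₃ y) (fun j => T j y) (A y) v) s := by
  have hq : ∀ (B : Y → Fin 3 → ℝ) (w : Y → E), (∀ i, ContDiffOn ℝ n (fun y => B y i) s) →
      ContDiffOn ℝ n w s →
      ContDiffOn ℝ n (fun y => quatAct (i₁ y) (i₂ y) (i₃ y) (B y) (w y)) s := fun B w hB hw =>
    (((hB 0).smul (h₁.clm_apply hw)).add ((hB 1).smul (h₂.clm_apply hw))).add
      ((hB 2).smul (h₃.clm_apply hw))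
  have hc : ∀ B : Y → Fin 3 → ℝ, (∀ i, ContDiffOn ℝ n (fun y => B y i) s) →
      ContDiffOn ℝ n (fun y => combine (fun j => T j y) (B y)) s := fun B hB =>
    (((hB 0).smul (hT 0)).add ((hB 1).smul (hT 1))).add ((hB 2).smul (hT 2))
  have hv : ∀ i, ContDiffOn ℝ n (fun _ : Y => v i) s := fun i => contDiffOn_const
  have hx : ∀ i, ContDiffOn ℝ n (fun y => (A y ⨯₃ v) i) s := fun i => by
    simp only [cross_apply]
    fin_cases i
    · exact ((hA 1).mul (hv 2)).sub ((hA 2).mul (hv 1))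
    · exact ((hA 2).mul (hv 0)).sub ((hA 0).mul (hv 2))
    · exact ((hA 0).mul (hv 1)).sub ((hA 1).mul (hv 0))
  have hd : ContDiffOn ℝ n (fun y => 2 * (A y ⬝ᵥ v)) s := by
    simp only [dotProduct_fin3]
    exact contDiffOn_const.mul ((((hA 0).mul (hv 0)).add ((hA 1).mul (hv 1))).add
      ((hA 2).mul (hv 2)))
  exact (((hc _ hx).neg.sub (hq _ _ hv (hc _ hA))).sub (hq _ _ hA (hc _ hv))).add
    (hd.smul (hq _ _ hA (hc _ hA)))

theorem ContDiffOn.twistCovector {i₁ i₂ i₃ : Y → E →L[ℝ] E} {g : Y → E →L[ℝ] E →L[ℝ] ℝ}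
    {T : Fin 3 → Y → E} {A : Y → Fin 3 → ℝ}
    (h₁ : ContDiffOn ℝ n i₁ s) (h₂ : ContDiffOn ℝ n i₂ s) (h₃ : ContDiffOn ℝ n i₃ s)
    (hg : ContDiffOn ℝ n g s) (hT : ∀ j, ContDiffOn ℝ n (T j) s)
    (hA : ∀ i, ContDiffOn ℝ n (fun y => A y i) s) (i : Fin 3) :
    ContDiffOn ℝ n (fun y => twistCovector (i₁ y) (i₂ y) (i₃ y) (g y) (fun j => T j y) (A y) i) s :=
  ContDiffOn.const_smul (2⁻¹ : ℝ) (hg.clm_apply (h₁.twistVector h₂ h₃ hT hA (Pi.single i 1)))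

theorem ContDiffOn.twistorInner [FiniteDimensional ℝ E] [FiniteDimensional ℝ W]
    {g : Y → E →L[ℝ] E →L[ℝ] ℝ} {r : Y → Fin 3 → E →L[ℝ] ℝ}
    {dx : Y → Fin 3 → W →L[ℝ] ℝ} {a b : Y → ℝ} (hg : ContDiffOn ℝ n g s)
    (hr : ∀ i, ContDiffOn ℝ n (fun y => r y i) s) (hdx : ∀ i, ContDiffOn ℝ n (fun y => dx y i) s)
    (ha : ContDiffOn ℝ n a s) (hb : ContDiffOn ℝ n b s) :
    ContDiffOn ℝ n (fun y => twistorInner (g y) (r y) (dx y) (a y) (b y)) s := by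
  rw [contDiffOn_clm_apply]
  intro u
  rw [contDiffOn_clm_apply]
  intro v
  simp only [twistorInner_apply]
  have hζ : ∀ (w : E × W) (i : Fin 3), ContDiffOn ℝ n (fun y => dx y i w.2 + r y i w.1) s :=
    fun w i => ((hdx i).clm_apply contDiffOn_const).add ((hr i).clm_apply contDiffOn_const)
  exact (ha.mul ((hg.clm_apply contDiffOn_const).clm_apply contDiffOn_const)).add
    (hb.mul (ContDiffOn.sum fun i _ => (hζ u i).mul (hζ v i)))

end Smoothness

theorem chartForm_hermitianFormPow {F : Type*} [NormedAddCommGroup F] [NormedSpace ℝ F]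
    {H : Type*} [TopologicalSpace H] {I : ModelWithCorners ℝ F H}
    {M : Type*} [TopologicalSpace M] [ChartedSpace H M] [IsManifold I ∞ M] (J : Π x : M, TangentSpace I x →L[ℝ] TangentSpace I x)
    (g : SmoothMetric I M) (k : ℕ) {x₀ : M} {y : F} (hy : y ∈ (extChartAt I x₀).target) :
    chartForm I (hermitianFormPow J g k) x₀ y
      = wedgePow ((chartBilin I g.inner x₀ y).comp (chartEnd I J x₀ y)) k := by
  refine (wedgePow_comp (V := F) (chartFrame I x₀ y)
    (hermitianForm J g ((extChartAt I x₀).symm y)) k).trans (congrArg (fun B => wedgePow B k) ?_)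
  refine ContinuousLinearMap.ext fun u => ContinuousLinearMap.ext fun v => ?_
  exact congrArg (fun w : F => g.inner ((extChartAt I x₀).symm y) w (chartFrame I x₀ y v))
    (chartFrame_chartCoframe I hy (J ((extChartAt I x₀).symm y) (chartFrame I x₀ y u))).symm

variable {F : Type*} [NormedAddCommGroup F] [InnerProductSpace ℝ F] [FiniteDimensional ℝ F]
  {H : Type*} [TopologicalSpace H] {I : ModelWithCorners ℝ F H} [I.Boundaryless]
  {M : Type*} [TopologicalSpace M] [ChartedSpace H M] [IsManifold I ∞ M]
  {I₁ I₂ I₃ : Π x : M, TangentSpace I x →L[ℝ] TangentSpace I x}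

/-- The inner product `a g(X, X') + b ⟨V + r X, V' + r X'⟩` on the twistor space. -/
def twistorMetricInner (I₁ I₂ I₃ : Π x : M, TangentSpace I x →L[ℝ] TangentSpace I x)
    (g : SmoothMetric I M) (T : Fin 3 → Π x : M, TangentSpace I x) (a b : M × Sph → ℝ)
    (z : M × Sph) :
    TangentSpace (I.prod (𝓡 2)) z →L[ℝ] TangentSpace (I.prod (𝓡 2)) z →L[ℝ] ℝ :=
  twistorInner (E := F) (W := EuclideanSpace ℝ (Fin 2)) (g.inner z.1)
    (twistCovector (E := F) (I₁ z.1) (I₂ z.1) (I₃ z.1) (g.inner z.1) (fun j => T j z.1)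
      (WithLp.ofLp (z.2 : EuclideanSpace ℝ (Fin 3))))
    (fun i => (EuclideanSpace.proj i).comp (sphIncl z.2)) (a z) (b z)

omit [FiniteDimensional ℝ F] in
theorem chartBilin_twistorMetricInner (g : SmoothMetric I M)
    (T : Fin 3 → Π x : M, TangentSpace I x) (a b : M × Sph → ℝ) {z₀ : M × Sph}
    {p : F × EuclideanSpace ℝ (Fin 2)} (hp : p ∈ (extChartAt (I.prod (𝓡 2)) z₀).target) :
    chartBilin (I.prod (𝓡 2)) (twistorMetricInner I₁ I₂ I₃ g T a b) z₀ p
      = twistorInner (chartBilin I g.inner z₀.1 p.1)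
        (twistCovector (chartEnd I I₁ z₀.1 p.1) (chartEnd I I₂ z₀.1 p.1) (chartEnd I I₃ z₀.1 p.1)
          (chartBilin I g.inner z₀.1 p.1) (fun j => chartVector I (T j) z₀.1 p.1)
          (WithLp.ofLp (sphParam z₀.2 p.2)))
        (sphCovector z₀.2 p.2) (a ((extChartAt (I.prod (𝓡 2)) z₀).symm p))
        (b ((extChartAt (I.prod (𝓡 2)) z₀).symm p)) := by
  have hp' := hp
  rw [extChartAt_prod] at hp'
  rw [chartBilin, chartFrame_prod I (𝓡 2) hp]
  refine (twistorInner_bilinearComp (E := F) (W := EuclideanSpace ℝ (Fin 2)) _ _ _ _ _ _ _).trans ?_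
  have h1 : ∀ i, (twistCovector (E := F) (I₁ ((extChartAt I z₀.1).symm p.1))
      (I₂ ((extChartAt I z₀.1).symm p.1)) (I₃ ((extChartAt I z₀.1).symm p.1))
      (g.inner ((extChartAt I z₀.1).symm p.1)) (fun j => T j ((extChartAt I z₀.1).symm p.1))
      (WithLp.ofLp (sphParam z₀.2 p.2)) i).comp (chartFrame I z₀.1 p.1)
      = twistCovector (chartEnd I I₁ z₀.1 p.1) (chartEnd I I₂ z₀.1 p.1) (chartEnd I I₃ z₀.1 p.1)
          (chartBilin I g.inner z₀.1 p.1) (fun j => chartVector I (T j) z₀.1 p.1)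
          (WithLp.ofLp (sphParam z₀.2 p.2)) i := fun i =>
    twistCovector_conj (E := F) _ _ _ _ _ (chartFrame_chartCoframe I hp'.1) _ i
  have h2 : ∀ i, ((EuclideanSpace.proj i).comp (sphIncl ((extChartAt (𝓡 2) z₀.2).symm p.2))
      : EuclideanSpace ℝ (Fin 2) →L[ℝ] ℝ).comp (chartFrame (𝓡 2) z₀.2 p.2)
      = sphCovector z₀.2 p.2 i := fun i => by
    ext v
    exact congrArg (fun w : EuclideanSpace ℝ (Fin 3) => w i) (fderiv_sphParam hp'.2 v).symm
  exact congrArg₂ (fun r dx => twistorInner (chartBilin I g.inner z₀.1 p.1) r dx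
    (a ((extChartAt (I.prod (𝓡 2)) z₀).symm p)) (b ((extChartAt (I.prod (𝓡 2)) z₀).symm p)))
    (funext h1) (funext h2)

omit [FiniteDimensional ℝ F] [I.Boundaryless] in
theorem twistorMetricInner_twistorJ {g : SmoothMetric I M} (hI : IsHypercomplex I₁ I₂ I₃)
    (hg : IsHyperhermitian I₁ I₂ I₃ g) (T : Fin 3 → Π x : M, TangentSpace I x)
    (a b : M × Sph → ℝ) (z : M × Sph) (u v : TangentSpace (I.prod (𝓡 2)) z) :
    twistorMetricInner I₁ I₂ I₃ g T a b z (twistorJ I₁ I₂ I₃ z u) (twistorJ I₁ I₂ I₃ z v)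
      = twistorMetricInner I₁ I₂ I₃ g T a b z u v := by
  have hj : ∀ w : EuclideanSpace ℝ (Fin 2),
      (fun i => ((EuclideanSpace.proj i).comp (sphIncl z.2) : EuclideanSpace ℝ (Fin 2) →L[ℝ] ℝ)
        (sphJ z.2 w)) = WithLp.ofLp (z.2 : EuclideanSpace ℝ (Fin 3)) ⨯₃
      (fun i => ((EuclideanSpace.proj i).comp (sphIncl z.2) : EuclideanSpace ℝ (Fin 2) →L[ℝ] ℝ)
        w) := fun w => funext fun i => congrArg (fun w : EuclideanSpace ℝ (Fin 3) => w i)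
        (sphIncl_sphJ z.2 w)
  have hc : combine (fun i => ((EuclideanSpace.proj i).comp (sphIncl z.2) :
      EuclideanSpace ℝ (Fin 2) →L[ℝ] ℝ)) (WithLp.ofLp (z.2 : EuclideanSpace ℝ (Fin 3))) = 0 := by
    refine ContinuousLinearMap.ext fun w => ?_
    have := sph_dotProduct_sphIncl z.2 w
    rw [dotProduct_fin3] at this
    exact this
  exact (hI.isQuaternionicHermitian hg z.1).twistorInner_invariant (fun j => T j z.1)
    (sph_dotProduct_self z.2) (W := EuclideanSpace ℝ (Fin 2)) (j := sphJ z.2) hj hc (a z) (b z) u v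

-- The metric is built for arbitrary vector fields T and positive functions a, b. The balanced
-- metric needs a special choice of these; when M has dimension zero any choice will do.
set_option synthInstance.maxHeartbeats 400000 in
theorem IsHypercomplex.exists_twistorMetric {g : SmoothMetric I M} (hI : IsHypercomplex I₁ I₂ I₃)
    (hg : IsHyperhermitian I₁ I₂ I₃ g) {T : Fin 3 → Π x : M, TangentSpace I x}
    (hT : ∀ j x₀, ContDiffOn ℝ ∞ (chartVector I (T j) x₀) (extChartAt I x₀).target)
    {a b : M × Sph → ℝ} (ha : ∀ z, 0 < a z) (hb : ∀ z, 0 < b z)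
    (has : ∀ z₀ : M × Sph, ContDiffOn ℝ ∞ (fun p => a ((extChartAt (I.prod (𝓡 2)) z₀).symm p))
      (extChartAt (I.prod (𝓡 2)) z₀).target)
    (hbs : ∀ z₀ : M × Sph, ContDiffOn ℝ ∞ (fun p => b ((extChartAt (I.prod (𝓡 2)) z₀).symm p))
      (extChartAt (I.prod (𝓡 2)) z₀).target) :
    ∃ gZ : SmoothMetric (I.prod (𝓡 2)) (M × Sph), IsHermitian (twistorJ I₁ I₂ I₃) gZ ∧
      ∀ (k : ℕ) (z₀ : M × Sph), ∀ p ∈ (extChartAt (I.prod (𝓡 2)) z₀).target,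
        chartForm (I.prod (𝓡 2)) (hermitianFormPow (twistorJ I₁ I₂ I₃) gZ k) z₀ p
          = wedgePow (twistorForm (chartEnd I I₁ z₀.1 p.1) (chartEnd I I₂ z₀.1 p.1)
            (chartEnd I I₃ z₀.1 p.1) (chartBilin I g.inner z₀.1 p.1)
            (twistCovector (chartEnd I I₁ z₀.1 p.1) (chartEnd I I₂ z₀.1 p.1)
              (chartEnd I I₃ z₀.1 p.1) (chartBilin I g.inner z₀.1 p.1)
              (fun j => chartVector I (T j) z₀.1 p.1) (WithLp.ofLp (sphParam z₀.2 p.2)))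
            (WithLp.ofLp (sphParam z₀.2 p.2)) (sphCovector z₀.2 p.2)
            (a ((extChartAt (I.prod (𝓡 2)) z₀).symm p))
            (b ((extChartAt (I.prod (𝓡 2)) z₀).symm p))) k := by
  have hq := fun z : M × Sph => hI.isQuaternionicHermitian hg z.1
  have hdx : ∀ (A : Sph) (v : EuclideanSpace ℝ (Fin 2)),
      (∀ i, ((EuclideanSpace.proj i).comp (sphIncl A) : EuclideanSpace ℝ (Fin 2) →L[ℝ] ℝ) v = 0) →
      v = 0 := fun A v hv => by
    refine sphIncl_injective A ((show sphIncl A v = 0 from ?_).trans (map_zero _).symm)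
    ext i
    exact hv i
  have hsm : ∀ (J : Π x : M, TangentSpace I x →L[ℝ] TangentSpace I x), IsComplexStructure I J →
      ∀ x₀, ContDiffOn ℝ ∞ (chartEnd I J x₀) (extChartAt I x₀).target :=
    fun J hJ => (contMDiff_end_iff I J).1 hJ.smooth
  have hgs := (contMDiff_bilin_iff I g.inner).1 g.contMDiff
  obtain ⟨gZ, hgZ⟩ : ∃ gZ : SmoothMetric (I.prod (𝓡 2)) (M × Sph),
      gZ.inner = twistorMetricInner I₁ I₂ I₃ g T a b := by
    refine ⟨SmoothMetric.ofChart (F := F × EuclideanSpace ℝ (Fin 2))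
      (twistorMetricInner I₁ I₂ I₃ g T a b)
      (fun z => twistorInner_symm (E := F) (W := EuclideanSpace ℝ (Fin 2)) (hq z).symm _ _ _ _)
      (fun z v hv => twistorInner_pos (E := F) (W := EuclideanSpace ℝ (Fin 2)) (hq z).pos _
        (hdx z.2) (ha z) (hb z) hv) (fun z₀ => ?_), rfl⟩
    refine ContDiffOn.congr ?_ fun p hp => chartBilin_twistorMetricInner g T a b hp
    have hf : MapsTo (Prod.fst : F × EuclideanSpace ℝ (Fin 2) → F)
        (extChartAt (I.prod (𝓡 2)) z₀).target (extChartAt I z₀.1).target :=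
      fun p hp => by rw [extChartAt_prod] at hp; exact hp.1
    have hf' : MapsTo (Prod.snd : F × EuclideanSpace ℝ (Fin 2) → EuclideanSpace ℝ (Fin 2))
        (extChartAt (I.prod (𝓡 2)) z₀).target (extChartAt (𝓡 2) z₀.2).target :=
      fun p hp => by rw [extChartAt_prod] at hp; exact hp.2
    have g₁ := (hsm I₁ hI.fst z₀.1).comp contDiffOn_fst hf
    have g₂ := (hsm I₂ hI.snd z₀.1).comp contDiffOn_fst hf
    have g₃ := (hsm I₃ hI.trd z₀.1).comp contDiffOn_fst hf
    have gg := (hgs z₀.1).comp contDiffOn_fst hf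
    have gT := fun j => (hT j z₀.1).comp contDiffOn_fst hf
    have gx := fun i => (((contDiffOn_euclidean (n := ∞)).1 (contDiffOn_sphParam z₀.2)) i).comp
      contDiffOn_snd hf'
    have gdx : ContDiffOn ℝ ∞ (fderiv ℝ (sphParam z₀.2)) (extChartAt (𝓡 2) z₀.2).target :=
      (contDiffOn_sphParam z₀.2).fderiv_of_isOpen (isOpen_extChartAt_target z₀.2) (by simp)
    have gdx' : ∀ i, ContDiffOn ℝ ∞ (fun s => sphCovector z₀.2 s i)
        (extChartAt (𝓡 2) z₀.2).target := fun i => contDiffOn_const.clm_comp gdx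
    exact gg.twistorInner
      (fun i => g₁.twistCovector g₂ g₃ gg gT
        (A := fun p : F × EuclideanSpace ℝ (Fin 2) => WithLp.ofLp (sphParam z₀.2 p.2)) gx i)
      (fun i => (gdx' i).comp contDiffOn_snd hf') (has z₀) (hbs z₀)
  refine ⟨gZ, fun z u v => ?_, fun k z₀ p hp => ?_⟩
  · rw [hgZ]
    exact twistorMetricInner_twistorJ hI hg T a b z u v
  · have hp' := hp
    rw [extChartAt_prod] at hp'
    have hj : ∀ v, (fun i => sphCovector z₀.2 p.2 i (chartEnd (𝓡 2) sphJ z₀.2 p.2 v))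
        = WithLp.ofLp (sphParam z₀.2 p.2) ⨯₃ (fun i => sphCovector z₀.2 p.2 i v) :=
      fun v => funext fun i => congrArg (fun w : EuclideanSpace ℝ (Fin 3) => w i)
        (fderiv_sphParam_chartEnd hp'.2 v)
    have h1 := (hI.isQuaternionicHermitian_chart hg hp'.1).twistorInner_comp
      (fun j => chartVector I (T j) z₀.1 p.1) (sphParam_dotProduct_self z₀.2 p.2) hj
      (a ((extChartAt (I.prod (𝓡 2)) z₀).symm p)) (b ((extChartAt (I.prod (𝓡 2)) z₀).symm p))
    rw [chartForm_hermitianFormPow _ _ k hp, chartEnd_twistorJ I₁ I₂ I₃ hp, twistorField, ← h1,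
      hgZ, chartBilin_twistorMetricInner g T a b hp]

end TwistorMetric

/-! ### Vector fields and functions obtained by dividing by a volume form. -/

section DualVectorFields

variable {F : Type*} [NormedAddCommGroup F] [NormedSpace ℝ F] [FiniteDimensional ℝ F]
  {H : Type*} [TopologicalSpace H] {I : ModelWithCorners ℝ F H}
  {X : Type*} [TopologicalSpace X] [ChartedSpace H X] [IsManifold I ∞ X] {m : ℕ}

omit [FiniteDimensional ℝ F] in
theorem chartForm_ne_zero {α : Π x : X, TangentSpace I x [⋀^Fin m]→L[ℝ] ℝ} (h : ∀ x, α x ≠ 0)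
    {x₀ : X} {y : F} (hy : y ∈ (extChartAt I x₀).target) : chartForm I α x₀ y ≠ 0 := by
  intro h0
  refine h ((extChartAt I x₀).symm y) ?_
  ext v
  have h1 := congrArg (fun α : F [⋀^Fin m]→L[ℝ] ℝ => α fun i => chartCoframe I x₀ y (v i)) h0
  refine Eq.trans ?_ h1
  exact congrArg (α ((extChartAt I x₀).symm y))
    (funext fun i => (chartFrame_chartCoframe I hy (v i)).symm)

omit [FiniteDimensional ℝ F] in
theorem chartForm_curryLeft (ν : Π x : X, TangentSpace I x [⋀^Fin (m + 1)]→L[ℝ] ℝ)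
    (U : Π x : X, TangentSpace I x) {x₀ : X} {y : F} (hy : y ∈ (extChartAt I x₀).target) :
    chartForm I (fun x => ContinuousAlternatingMap.curryLeft (E := F) (ν x) (U x)) x₀ y
      = (chartForm I ν x₀ y).curryLeft (chartVector I U x₀ y) := by
  refine Eq.trans ?_ (compContinuousLinearMap_curryLeft (V := F) (V' := F)
    (ν ((extChartAt I x₀).symm y)) (chartFrame I x₀ y) (chartVector I U x₀ y)).symm
  exact congrArg (fun u : F => (ContinuousAlternatingMap.curryLeft (E := F)
    (ν ((extChartAt I x₀).symm y)) u).compContinuousLinearMap (chartFrame I x₀ y))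
    (chartFrame_chartCoframe I hy (U ((extChartAt I x₀).symm y))).symm

omit [FiniteDimensional ℝ F] in
theorem chartVector_end (J : Π x : X, TangentSpace I x →L[ℝ] TangentSpace I x)
    (U : Π x : X, TangentSpace I x) {x₀ : X} {y : F} (hy : y ∈ (extChartAt I x₀).target) :
    chartVector I (fun x => J x (U x)) x₀ y = chartEnd I J x₀ y (chartVector I U x₀ y) :=
  congrArg (fun w : F => chartCoframe I x₀ y (J ((extChartAt I x₀).symm y) w))
    (chartFrame_chartCoframe I hy (U ((extChartAt I x₀).symm y))).symm

variable (b : Module.Basis (Fin (m + 1)) ℝ F)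

/-- The vector field whose contraction with the volume form `ν` is `τ`. -/
def dualVector (ν : Π x : X, TangentSpace I x [⋀^Fin (m + 1)]→L[ℝ] ℝ)
    (τ : Π x : X, TangentSpace I x [⋀^Fin m]→L[ℝ] ℝ) (x : X) : TangentSpace I x :=
  contractInv (V := F) b (ν x) (τ x)

/-- The quotient of a form of top degree by the volume form `ν`. -/
def density (ν η : Π x : X, TangentSpace I x [⋀^Fin (m + 1)]→L[ℝ] ℝ) (x : X) : ℝ :=
  η x b / ν x b

variable {ν : Π x : X, TangentSpace I x [⋀^Fin (m + 1)]→L[ℝ] ℝ} (hν : ∀ x, ν x ≠ 0)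
include hν

theorem chartForm_curryLeft_dualVector (τ : Π x : X, TangentSpace I x [⋀^Fin m]→L[ℝ] ℝ) {x₀ : X}
    {y : F} (hy : y ∈ (extChartAt I x₀).target) :
    (chartForm I ν x₀ y).curryLeft (chartVector I (dualVector b ν τ) x₀ y)
      = chartForm I τ x₀ y := by
  rw [← chartForm_curryLeft ν _ hy]
  exact congrArg (fun α : F [⋀^Fin m]→L[ℝ] ℝ => α.compContinuousLinearMap (chartFrame I x₀ y))
    (curryLeft_contractInv (V := F) b (hν ((extChartAt I x₀).symm y))
      (τ ((extChartAt I x₀).symm y)))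

theorem contDiffOn_chartVector_dualVector (hνs : IsSmoothForm I ν)
    {τ : Π x : X, TangentSpace I x [⋀^Fin m]→L[ℝ] ℝ} (hτ : IsSmoothForm I τ) (x₀ : X) :
    ContDiffOn ℝ ∞ (chartVector I (dualVector b ν τ) x₀) (extChartAt I x₀).target := by
  refine (ContDiffOn.contractInv b (hνs x₀) (hτ x₀) fun y hy => chartForm_ne_zero hν hy).congr
    fun y hy => ?_
  rw [← chartForm_curryLeft_dualVector b hν τ hy, contractInv_curryLeft b (chartForm_ne_zero hν hy)]

-- The quotient of two top forms does not depend on the basis on which they are evaluated, so the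
-- pointwise quotient in the model basis is also the quotient in any chart.
omit [IsManifold I ∞ X] in
theorem chartForm_eq_density_smul (η : Π x : X, TangentSpace I x [⋀^Fin (m + 1)]→L[ℝ] ℝ) {x₀ : X}
    {y : F} :
    chartForm I η x₀ y = density b ν η ((extChartAt I x₀).symm y) • chartForm I ν x₀ y := by
  have hd : Module.finrank ℝ F = m + 1 := by simp [Module.finrank_eq_card_basis b]
  have h0 := hν ((extChartAt I x₀).symm y)
  obtain ⟨c, hc⟩ := exists_eq_smul_of_ne_zero (V := F) hd (η ((extChartAt I x₀).symm y))
    (ν ((extChartAt I x₀).symm y)) h0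
  have hc' : density b ν η ((extChartAt I x₀).symm y) = c := by
    have h1 := apply_basis_ne_zero (V := F) b h0
    have h2 : η ((extChartAt I x₀).symm y) b = c * ν ((extChartAt I x₀).symm y) b :=
      congrArg (fun α : F [⋀^Fin (m + 1)]→L[ℝ] ℝ => α b) hc
    rw [density, h2]
    exact mul_div_cancel_right₀ _ h1
  rw [hc']
  exact congrArg (fun α : F [⋀^Fin (m + 1)]→L[ℝ] ℝ =>
    α.compContinuousLinearMap (chartFrame I x₀ y)) hc

theorem contDiffOn_density (hνs : IsSmoothForm I ν)
    {η : Π x : X, TangentSpace I x [⋀^Fin (m + 1)]→L[ℝ] ℝ} (hη : IsSmoothForm I η) (x₀ : X) :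
    ContDiffOn ℝ ∞ (fun y => density b ν η ((extChartAt I x₀).symm y)) (extChartAt I x₀).target := by
  have h0 : ∀ y ∈ (extChartAt I x₀).target, chartForm I ν x₀ y b ≠ 0 := fun y hy =>
    apply_basis_ne_zero b (chartForm_ne_zero hν hy)
  refine (ContDiffOn.div ((hη x₀).alternating_apply (v := fun _ => b) fun i => contDiffOn_const)
    ((hνs x₀).alternating_apply (v := fun _ => b) fun i => contDiffOn_const) h0).congr fun y hy => ?_
  change _ = chartForm I η x₀ y b / chartForm I ν x₀ y b
  rw [chartForm_eq_density_smul b hν η]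
  exact (mul_div_cancel_right₀ _ (h0 y hy)).symm

end DualVectorFields

theorem IsQuaternionicHermitian.wedgePow_fst_ne_zero {E : Type*} [NormedAddCommGroup E]
    [NormedSpace ℝ E] [FiniteDimensional ℝ E] {I₁ I₂ I₃ : E →L[ℝ] E} {g : E →L[ℝ] E →L[ℝ] ℝ}
    (h : IsQuaternionicHermitian I₁ I₂ I₃ g) {k : ℕ} (hk : 2 * k ≤ Module.finrank ℝ E) :
    wedgePow (g.comp I₁) k ≠ 0 := by
  have h1 := h.wedgePow_ne_zero (A := ![1, 0, 0]) (by simp) hk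
  rwa [show quatAct I₁ I₂ I₃ ![1, 0, 0] = I₁ by simp [quatAct]] at h1

/-! ### The forms `ωᵏ / k!`. -/

section BalancedMetric

open scoped Matrix Nat

/-- The form `ωᵏ / k!`, where `ω` is the Hermitian form. -/
def lefschetzForm {F : Type*} [NormedAddCommGroup F] [NormedSpace ℝ F]
    {H : Type*} [TopologicalSpace H] {I : ModelWithCorners ℝ F H}
    {M : Type*} [TopologicalSpace M] [ChartedSpace H M] [IsManifold I ∞ M]
    (J : Π x : M, TangentSpace I x →L[ℝ] TangentSpace I x) (g : SmoothMetric I M) (k : ℕ) (x : M) :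
    TangentSpace I x [⋀^Fin (2 * k)]→L[ℝ] ℝ :=
  (k ! : ℝ)⁻¹ • (hermitianFormPow J g k x : F [⋀^Fin (2 * k)]→L[ℝ] ℝ)

variable {F : Type*} [NormedAddCommGroup F] [InnerProductSpace ℝ F] [FiniteDimensional ℝ F]
  {H : Type*} [TopologicalSpace H] {I : ModelWithCorners ℝ F H} [I.Boundaryless]
  {M : Type*} [TopologicalSpace M] [ChartedSpace H M] [IsManifold I ∞ M]
  {I₁ I₂ I₃ : Π x : M, TangentSpace I x →L[ℝ] TangentSpace I x} {g : SmoothMetric I M}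

omit [FiniteDimensional ℝ F] [I.Boundaryless] in
theorem wedgePow_chart_eq (J : Π x : M, TangentSpace I x →L[ℝ] TangentSpace I x) (k : ℕ) {x₀ : M}
    {y : F} (hy : y ∈ (extChartAt I x₀).target) :
    wedgePow ((chartBilin I g.inner x₀ y).comp (chartEnd I J x₀ y)) k
      = (k ! : ℝ) • chartForm I (lefschetzForm J g k) x₀ y := by
  rw [← chartForm_hermitianFormPow J g k hy]
  have h : chartForm I (lefschetzForm J g k) x₀ y
      = (k ! : ℝ)⁻¹ • chartForm I (hermitianFormPow J g k) x₀ y := rfl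
  rw [h, smul_smul, mul_inv_cancel₀ (by positivity), one_smul]

theorem IsComplexStructure.isSmoothForm_lefschetzForm
    {J : Π x : M, TangentSpace I x →L[ℝ] TangentSpace I x} (hJ : IsComplexStructure I J)
    (g : SmoothMetric I M) (k : ℕ) : IsSmoothForm I (lefschetzForm J g k) := fun x₀ => by
  have hg := (contMDiff_bilin_iff I g.inner).1 g.contMDiff x₀
  have hJ' := (contMDiff_end_iff I J).1 hJ.smooth x₀
  refine (ContDiffOn.const_smul (k ! : ℝ)⁻¹ ((hg.clm_comp hJ').wedgePow k)).congr fun y hy => ?_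
  rw [wedgePow_chart_eq J k hy, smul_smul, inv_mul_cancel₀ (by positivity), one_smul]

omit [I.Boundaryless] in
theorem IsHypercomplex.lefschetzForm_ne_zero (hI : IsHypercomplex I₁ I₂ I₃)
    (hg : IsHyperhermitian I₁ I₂ I₃ g) {k : ℕ} (hk : 2 * k ≤ Module.finrank ℝ F) (x : M) :
    lefschetzForm I₁ g k x ≠ 0 := by
  have h := (hI.isQuaternionicHermitian hg x).wedgePow_fst_ne_zero hk
  exact smul_ne_zero (M := F [⋀^Fin (2 * k)]→L[ℝ] ℝ) (by positivity) h

end BalancedMetric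

/-! ### The choice of the functions a and b, and the balanced metric. -/

section BalancedTwistorMetric

open scoped Matrix Nat

theorem continuous_of_chart {F : Type*} [NormedAddCommGroup F] [NormedSpace ℝ F]
    {H : Type*} [TopologicalSpace H] (I : ModelWithCorners ℝ F H) [I.Boundaryless]
    {X : Type*} [TopologicalSpace X] [ChartedSpace H X] [IsManifold I ∞ X] {f : X → ℝ}
    (h : ∀ x₀ : X, ContDiffOn ℝ ∞ (fun y => f ((extChartAt I x₀).symm y))
      (extChartAt I x₀).target) : Continuous f := by
  have h1 : ContMDiff I 𝓘(ℝ, ℝ) ∞ f := by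
    rw [contMDiff_iff_forall_source]
    refine fun x₀ => (contMDiffOn_source_iff I x₀ fun x hx => ?_).2 (h x₀)
    rw [(extChartAt I x₀).left_inv (by simpa using hx)]
  exact h1.continuous

/-- On a compact manifold, a smooth function `S` subtracted from a large constant is
`(k + 1)! aᵏ⁺¹` for a positive smooth function `a`. -/
theorem exists_positive_root {F : Type*} [NormedAddCommGroup F] [NormedSpace ℝ F]
    {H : Type*} [TopologicalSpace H] (I : ModelWithCorners ℝ F H) [I.Boundaryless]
    {X : Type*} [TopologicalSpace X] [CompactSpace X] [ChartedSpace H X] [IsManifold I ∞ X]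
    {S : X → ℝ} (hS : ∀ x₀ : X, ContDiffOn ℝ ∞ (fun y => S ((extChartAt I x₀).symm y))
      (extChartAt I x₀).target) (k : ℕ) :
    ∃ (C : ℝ) (a b : X → ℝ), (∀ x, 0 < a x) ∧ (∀ x, 0 < b x) ∧
      (∀ x, ((k + 1)! : ℝ) * a x ^ (k + 1) = C - S x) ∧
      (∀ x, ((k + 1)! : ℝ) * (a x ^ k * b x) = 2) ∧
      (∀ x₀ : X, ContDiffOn ℝ ∞ (fun y => a ((extChartAt I x₀).symm y)) (extChartAt I x₀).target) ∧
      (∀ x₀ : X, ContDiffOn ℝ ∞ (fun y => b ((extChartAt I x₀).symm y)) (extChartAt I x₀).target) := by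
  obtain ⟨C, hC⟩ := (isCompact_range (continuous_of_chart I hS)).bddAbove
  -- C only bounds S from above; adding 1 makes the inequality strict, so the real power used for
  -- the root is smooth.
  have hpos : ∀ x, 0 < C + 1 - S x := fun x => by
    have := hC (mem_range_self x)
    linarith
  have hf : (0 : ℝ) < ((k + 1)! : ℝ) := by positivity
  set a : X → ℝ := fun x => ((C + 1 - S x) / ((k + 1)! : ℝ)) ^ (((k + 1 : ℕ) : ℝ)⁻¹) with ha
  have ha0 : ∀ x, 0 < a x := fun x => Real.rpow_pos_of_pos (div_pos (hpos x) hf) _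
  have has : ∀ x₀ : X, ContDiffOn ℝ ∞ (fun y => a ((extChartAt I x₀).symm y))
      (extChartAt I x₀).target := fun x₀ =>
    ((contDiffOn_const.sub (hS x₀)).div_const _).rpow_const_of_ne fun y _ =>
      (div_pos (hpos _) hf).ne'
  refine ⟨C + 1, a, fun x => 2 / (((k + 1)! : ℝ) * a x ^ k), ha0, fun x => ?_, fun x => ?_,
    fun x => ?_, has, fun x₀ => ?_⟩
  · have := ha0 x
    positivity
  · rw [ha]
    simp only
    rw [Real.rpow_inv_natCast_pow (div_pos (hpos x) hf).le (by omega)]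
    field_simp
  · have := (ha0 x).ne'
    field_simp
  · exact contDiffOn_const.div (contDiffOn_const.mul ((has x₀).pow k)) fun y _ =>
      mul_ne_zero hf.ne' (pow_ne_zero _ (ha0 _).ne')

variable {F : Type*} [NormedAddCommGroup F] [InnerProductSpace ℝ F] [FiniteDimensional ℝ F]
  {H : Type*} [TopologicalSpace H] {I : ModelWithCorners ℝ F H} [I.Boundaryless]
  {M : Type*} [TopologicalSpace M] [ChartedSpace H M] [IsManifold I ∞ M]
  {I₁ I₂ I₃ : Π x : M, TangentSpace I x →L[ℝ] TangentSpace I x} {g : SmoothMetric I M}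

/-- The squared length of `twistVector`, summed over the three coordinate directions. -/
def twistLength (I₁ I₂ I₃ : Π x : M, TangentSpace I x →L[ℝ] TangentSpace I x)
    (g : SmoothMetric I M) (T : Fin 3 → Π x : M, TangentSpace I x) (z : M × Sph) : ℝ :=
  ∑ i, g.inner z.1
    (twistVector (E := F) (I₁ z.1) (I₂ z.1) (I₃ z.1) (fun j => T j z.1)
      (WithLp.ofLp (z.2 : EuclideanSpace ℝ (Fin 3))) (Pi.single i 1))
    (twistVector (E := F) (I₁ z.1) (I₂ z.1) (I₃ z.1) (fun j => T j z.1)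
      (WithLp.ofLp (z.2 : EuclideanSpace ℝ (Fin 3))) (Pi.single i 1))

omit [FiniteDimensional ℝ F] [I.Boundaryless] in
theorem twistLength_chart (T : Fin 3 → Π x : M, TangentSpace I x) {z₀ : M × Sph}
    {p : F × EuclideanSpace ℝ (Fin 2)} (hp : p ∈ (extChartAt (I.prod (𝓡 2)) z₀).target) :
    twistLength I₁ I₂ I₃ g T ((extChartAt (I.prod (𝓡 2)) z₀).symm p)
      = ∑ i, chartBilin I g.inner z₀.1 p.1
        (twistVector (chartEnd I I₁ z₀.1 p.1) (chartEnd I I₂ z₀.1 p.1) (chartEnd I I₃ z₀.1 p.1)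
          (fun j => chartVector I (T j) z₀.1 p.1) (WithLp.ofLp (sphParam z₀.2 p.2)) (Pi.single i 1))
        (twistVector (chartEnd I I₁ z₀.1 p.1) (chartEnd I I₂ z₀.1 p.1) (chartEnd I I₃ z₀.1 p.1)
          (fun j => chartVector I (T j) z₀.1 p.1) (WithLp.ofLp (sphParam z₀.2 p.2))
          (Pi.single i 1)) := by
  have hp' := hp
  rw [extChartAt_prod] at hp'
  refine Finset.sum_congr rfl fun i _ => ?_
  have h1 := twistVector_conj (E := F) (I₁ ((extChartAt I z₀.1).symm p.1))
    (I₂ ((extChartAt I z₀.1).symm p.1)) (I₃ ((extChartAt I z₀.1).symm p.1))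
    (fun j => T j ((extChartAt I z₀.1).symm p.1)) (chartFrame_chartCoframe I hp'.1)
    (WithLp.ofLp (sphParam z₀.2 p.2)) (Pi.single i 1)
  exact congrArg₂ (fun u v : F => g.inner ((extChartAt I z₀.1).symm p.1) u v) h1.symm h1.symm

set_option synthInstance.maxHeartbeats 400000 in
/-- The twistor space of a compact hypercomplex manifold of positive dimension has a Hermitian
metric with closed top power. -/
theorem IsHypercomplex.exists_closed_hermitianFormPow [CompactSpace M] {k : ℕ}
    (b : Module.Basis (Fin (2 * k + 1 + 1)) ℝ F) (hI : IsHypercomplex I₁ I₂ I₃)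
    (hg : IsHyperhermitian I₁ I₂ I₃ g) :
    ∃ gZ : SmoothMetric (I.prod (𝓡 2)) (M × Sph), IsHermitian (twistorJ I₁ I₂ I₃) gZ ∧
      IsClosedForm (I.prod (𝓡 2)) (hermitianFormPow (twistorJ I₁ I₂ I₃) gZ (k + 1)) := by
  have hE : Module.finrank ℝ F = 2 * (k + 1) := by
    rw [Module.finrank_eq_card_basis b]; simp; ring
  set J : Fin 3 → Π x : M, TangentSpace I x →L[ℝ] TangentSpace I x := ![I₁, I₂, I₃] with hJdef
  have hJ : ∀ i, IsComplexStructure I (J i) := by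
    intro i
    fin_cases i
    exacts [hI.fst, hI.snd, hI.trd]
  have hJc : ∀ (x₀ : M) (y : F) (i : Fin 3), chartEnd I (J i) x₀ y
      = (![chartEnd I I₁ x₀ y, chartEnd I I₂ x₀ y, chartEnd I I₃ x₀ y] : Fin 3 → F →L[ℝ] F) i := by
    intro x₀ y i
    fin_cases i <;> rfl
  have hJs := fun i => (contMDiff_end_iff I (J i)).1 (hJ i).smooth
  have hgs := (contMDiff_bilin_iff I g.inner).1 g.contMDiff
  set ν : Π x : M, TangentSpace I x [⋀^Fin (2 * k + 1 + 1)]→L[ℝ] ℝ :=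
    lefschetzForm I₁ g (k + 1) with hνdef
  have hνs : IsSmoothForm I ν := hI.fst.isSmoothForm_lefschetzForm g (k + 1)
  have hν0 : ∀ x, ν x ≠ 0 := fun x => hI.lefschetzForm_ne_zero hg hE.ge x
  set θ : Fin 3 → Π x : M, TangentSpace I x [⋀^Fin (2 * k)]→L[ℝ] ℝ :=
    fun i => lefschetzForm (J i) g k with hθdef
  have hθs : ∀ i, IsSmoothForm I (θ i) := fun i => (hJ i).isSmoothForm_lefschetzForm g k
  -- The fields T encode `dθⱼ = ι_{Tⱼ} ν`; below, l holds the contractions of ν with `IᵢTⱼ`, and δ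
  -- their divergences, `d lᵢⱼ = δᵢⱼ ν`.
  set T : Fin 3 → Π x : M, TangentSpace I x := fun j => dualVector b ν (mextDeriv I (θ j)) with hTdef
  have hTs : ∀ j x₀, ContDiffOn ℝ ∞ (chartVector I (T j) x₀) (extChartAt I x₀).target :=
    fun j x₀ => contDiffOn_chartVector_dualVector b hν0 hνs ((hθs j).mextDeriv I) x₀
  set l : Fin 3 → Fin 3 → Π x : M, TangentSpace I x [⋀^Fin (2 * k + 1)]→L[ℝ] ℝ := fun i j x =>
    ContinuousAlternatingMap.curryLeft (E := F) (ν x) (J i x (T j x)) with hldef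
  have hlc : ∀ i j (x₀ : M), ∀ y ∈ (extChartAt I x₀).target, chartForm I (l i j) x₀ y
      = (chartForm I ν x₀ y).curryLeft (chartEnd I (J i) x₀ y (chartVector I (T j) x₀ y)) :=
    fun i j x₀ y hy => by
      rw [← chartVector_end (J i) (T j) hy, ← chartForm_curryLeft ν _ hy]
  have hls : ∀ i j, IsSmoothForm I (l i j) := fun i j x₀ =>
    ((hνs x₀).curryLeft ((hJs i x₀).clm_apply (hTs j x₀))).congr (hlc i j x₀)
  set δ : Fin 3 → Fin 3 → M → ℝ := fun i j => density b ν (mextDeriv I (l i j)) with hδdef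
  have hδs : ∀ i j (x₀ : M), ContDiffOn ℝ ∞ (fun y => δ i j ((extChartAt I x₀).symm y))
      (extChartAt I x₀).target := fun i j x₀ =>
    contDiffOn_density b hν0 hνs ((hls i j).mextDeriv I) x₀
  -- S collects all contributions to the coefficient of ν other than `(k+1)! aᵏ⁺¹`: the divergences
  -- of the correction term and the squared length of the shear. It does not involve a or b, so the
  -- equation for a is solved pointwise.
  set S : M × Sph → ℝ := fun z => ∑ i, ∑ j, (z.2 : EuclideanSpace ℝ (Fin 3)) i
    * (z.2 : EuclideanSpace ℝ (Fin 3)) j * δ i j z.1 + 4⁻¹ * twistLength I₁ I₂ I₃ g T z with hSdef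
  have hSs : ∀ z₀ : M × Sph, ContDiffOn ℝ ∞ (fun p => S ((extChartAt (I.prod (𝓡 2)) z₀).symm p))
      (extChartAt (I.prod (𝓡 2)) z₀).target := fun z₀ => by
    have hf : MapsTo (Prod.fst : F × EuclideanSpace ℝ (Fin 2) → F)
        (extChartAt (I.prod (𝓡 2)) z₀).target (extChartAt I z₀.1).target :=
      fun p hp => by rw [extChartAt_prod] at hp; exact hp.1
    have hf' : MapsTo (Prod.snd : F × EuclideanSpace ℝ (Fin 2) → EuclideanSpace ℝ (Fin 2))
        (extChartAt (I.prod (𝓡 2)) z₀).target (extChartAt (𝓡 2) z₀.2).target :=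
      fun p hp => by rw [extChartAt_prod] at hp; exact hp.2
    have g₁ := (hJs 0 z₀.1).comp contDiffOn_fst hf
    have g₂ := (hJs 1 z₀.1).comp contDiffOn_fst hf
    have g₃ := (hJs 2 z₀.1).comp contDiffOn_fst hf
    have gg := (hgs z₀.1).comp contDiffOn_fst hf
    have gT := fun j => (hTs j z₀.1).comp contDiffOn_fst hf
    have gδ := fun i j => (hδs i j z₀.1).comp contDiffOn_fst hf
    have gx := fun i => (((contDiffOn_euclidean (n := ∞)).1 (contDiffOn_sphParam z₀.2)) i).comp
      contDiffOn_snd hf'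
    have hΦ := fun i => g₁.twistVector g₂ g₃ gT
      (A := fun p : F × EuclideanSpace ℝ (Fin 2) => WithLp.ofLp (sphParam z₀.2 p.2)) gx
      (Pi.single i 1)
    have h1 := ContDiffOn.sum (s := Finset.univ) fun i _ => (gg.clm_apply (hΦ i)).clm_apply (hΦ i)
    have h2 := ContDiffOn.sum (s := Finset.univ) fun i _ =>
      ContDiffOn.sum (s := Finset.univ) fun j _ => ((gx i).mul (gx j)).mul (gδ i j)
    refine (h2.add ((contDiffOn_const (c := (4⁻¹ : ℝ))).mul h1)).congr fun p hp => ?_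
    exact congrArg (fun c => _ + 4⁻¹ * c) (twistLength_chart (I₁ := I₁) (I₂ := I₂) (I₃ := I₃)
      (g := g) T hp)
  obtain ⟨C, a, c, ha, hc, haC, hac, has, hcs⟩ := exists_positive_root (I.prod (𝓡 2)) hSs k
  obtain ⟨gZ, hgZ, hform⟩ := hI.exists_twistorMetric hg hTs ha hc has hcs
  refine ⟨gZ, hgZ, isClosedForm_of_chartForm _ fun z₀ p hp => ?_⟩
  have hloc := extDeriv_wedgePow_twistorForm (W := EuclideanSpace ℝ (Fin 2)) hE
    (isOpen_extChartAt_target (I := I) z₀.1) (isOpen_extChartAt_target (I := 𝓡 2) z₀.2)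
    (fun y hy => hI.isQuaternionicHermitian_chart hg hy) (hνs z₀.1)
    (fun y hy => wedgePow_chart_eq I₁ (k + 1) hy) (θ := fun i => chartForm I (θ i) z₀.1)
    (fun i => hθs i z₀.1)
    (fun y hy i => by rw [← hJc]; exact wedgePow_chart_eq (J i) k hy)
    (T := fun j => chartVector I (T j) z₀.1)
    (fun y hy j => by
      rw [chartForm_curryLeft_dualVector b hν0 _ hy, chartForm_mextDeriv I (hθs j) hy])
    (l := fun i j => chartForm I (l i j) z₀.1) (fun i j => hls i j z₀.1)
    (fun y hy i j => by rw [← hJc]; exact hlc i j z₀.1 y hy)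
    (δ := fun i j y => δ i j ((extChartAt I z₀.1).symm y))
    (fun y hy i j => by
      rw [← chartForm_mextDeriv I (hls i j) hy]
      exact chartForm_eq_density_smul b hν0 _)
    (x := fun s => WithLp.ofLp (sphParam z₀.2 s))
    (fun i => ((contDiffOn_euclidean (n := ∞)).1 (contDiffOn_sphParam z₀.2)) i)
    (sphParam_dotProduct_self z₀.2) (dx := sphCovector z₀.2) (fun s hs i => hasFDerivAt_sphParam hs i)
    (fun s hs => combine_sphCovector hs)
    (a := fun p => a ((extChartAt (I.prod (𝓡 2)) z₀).symm p))
    (b := fun p => c ((extChartAt (I.prod (𝓡 2)) z₀).symm p)) (C := C)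
    (fun p hp => hac _)
    (fun p hp => by
      have hp' : p ∈ (extChartAt (I.prod (𝓡 2)) z₀).target := by rw [extChartAt_prod]; exact hp
      rw [← twistLength_chart (I₁ := I₁) (I₂ := I₂) (I₃ := I₃) (g := g) T hp', haC]
      have : S ((extChartAt (I.prod (𝓡 2)) z₀).symm p)
        = ∑ i, ∑ j, (sphParam z₀.2 p.2) i * (sphParam z₀.2 p.2) j
          * δ i j ((extChartAt I z₀.1).symm p.1)
          + 4⁻¹ * twistLength I₁ I₂ I₃ g T ((extChartAt (I.prod (𝓡 2)) z₀).symm p) := rfl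
      rw [this]
      ring)
  have heq := Filter.eventually_of_mem
    ((isOpen_extChartAt_target (I := I.prod (𝓡 2)) z₀).mem_nhds hp) (hform (k + 1) z₀)
  have hp' := hp
  rw [extChartAt_prod] at hp'
  exact (Filter.EventuallyEq.extDeriv_eq heq).trans (hloc p hp')

end BalancedTwistorMetric

theorem isClosedForm_hermitianFormPow_zero {F : Type*} [NormedAddCommGroup F] [NormedSpace ℝ F]
    {H : Type*} [TopologicalSpace H] {I : ModelWithCorners ℝ F H} [I.Boundaryless]
    {X : Type*} [TopologicalSpace X] [ChartedSpace H X] [IsManifold I ∞ X]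
    (J : Π x : X, TangentSpace I x →L[ℝ] TangentSpace I x) (g : SmoothMetric I X) :
    IsClosedForm I (hermitianFormPow J g 0) := by
  refine isClosedForm_of_chartForm I fun x₀ y hy => ?_
  have h : chartForm I (hermitianFormPow J g 0) x₀ = fun _ => wedgePow 0 0 := by
    funext z
    ext v
    exact (wedgePow_zero (V := F) (hermitianForm J g ((extChartAt I x₀).symm z)) _).trans
      (wedgePow_zero 0 v).symm
  rw [h]
  rw [extDeriv, fderiv_fun_const]
  exact map_zero (ContinuousAlternatingMap.alternatizeUncurryFinCLM ℝ F ℝ)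

end

theorem theorem2 (n : ℕ) (M : Type*) [TopologicalSpace M]
    [ChartedSpace (EuclideanSpace ℝ (Fin (2 * n))) M] [IsManifold (𝓡 (2 * n)) ∞ M]
    [CompactSpace M] [T2Space M]
    (I J K : Π x : M, TangentSpace (𝓡 (2 * n)) x →L[ℝ] TangentSpace (𝓡 (2 * n)) x)
    (hIJK : IsHypercomplex I J K) :
    (∃ g : SmoothMetric (𝓡 (2 * n)) M, IsHyperhermitian I J K g) ∧
    IsComplexStructure ((𝓡 (2 * n)).prod (𝓡 2)) (twistorJ I J K) ∧
    ∃ gZ : SmoothMetric ((𝓡 (2 * n)).prod (𝓡 2)) (M × Sph),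
      IsBalancedMetric (n + 1) (twistorJ I J K) gZ := by
  obtain ⟨g, hg⟩ := hIJK.exists_isHyperhermitian
  refine ⟨⟨g, hg⟩, hIJK.isComplexStructure_twistorJ hg, ?_⟩
  have hdim : Module.finrank ℝ (EuclideanSpace ℝ (Fin (2 * n)) × EuclideanSpace ℝ (Fin 2))
      = 2 * (n + 1) := by
    simp [Module.finrank_prod]; ring
  -- If M has dimension zero, the relevant power is ω⁰ = 1 and any Hermitian metric is balanced; the
  -- unsheared product metric is used.
  obtain _ | k := n
  · obtain ⟨gZ, hgZ, -⟩ := hIJK.exists_twistorMetric hg (T := fun _ _ => 0) (a := fun _ => 1)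
      (b := fun _ => 1) (fun j x₀ => (contDiffOn_const (c := 0)).congr fun y _ => map_zero _)
      (fun _ => one_pos) (fun _ => one_pos) (fun _ => contDiffOn_const) (fun _ => contDiffOn_const)
    exact ⟨gZ, hdim, hgZ, isClosedForm_hermitianFormPow_zero _ gZ⟩
  · obtain ⟨gZ, hgZ, hclosed⟩ := hIJK.exists_closed_hermitianFormPow
      (EuclideanSpace.basisFun (Fin (2 * (k + 1))) ℝ).toBasis hg
    exact ⟨gZ, hdim, hgZ, hclosed⟩
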